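/- Let $M$ be an oriented smooth spacetime: a smooth $4$-manifold with a smooth metric $g$ of signature $(-,+,+,+)$ and metric volume element $\eta$. Indices are raised and lowered with $g$. For double bivectors $A,B$ and (complex) bivectors $F,K$ put $(AB)_{\alpha\beta\mu\nu}=\frac12A_{\alpha\beta\lambda\rho}B^{\lambda\rho}{}_{\mu\nu}$, $\operatorname{Tr}A=\frac12A^{\mu\nu}{}_{\mu\nu}$, $A(F)_{\alpha\beta}=\frac12A_{\alpha\beta\mu\nu}F^{\mu\nu}$, $A(F,K)=\frac14A_{\alpha\beta\mu\nu}F^{\alpha\beta}K^{\mu\nu}$. Let $(*F)_{\alpha\beta}=\frac12\eta_{\alpha\beta\mu\nu}F^{\mu\nu}$, let $\mathcal W=\frac12(W-\mathrm i*W)$ be the self-dual Weyl tensor, and let $\mathcal G=\frac12(G-\mathrm i\,\eta)$, $G_{\alpha\beta\lambda\mu}=g_{\alpha\lambda}g_{\beta\mu}-g_{\alpha\mu}g_{\beta\lambda}$, be the metric on the space of self-dual bivectors, $(F,K)=\mathcal G(F,K)$. For an oriented orthonormal frame $\{e_a\}$ ($\eta(e_0,e_1,e_2,e_3)=1$) with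 dual basis $\{\theta^a\}$ and connection coefficients $\nabla e_a=\gamma^c_{ab}\,\theta^b\otimes e_c$, the connection tensor is $H=\gamma^c_{ab}\,\theta^b\otimes\theta^a\otimes e_c$, its last index being lowered below; the bivectors of the frame are $\mathcal U_A=\frac1{\sqrt2}(U_A-\mathrm i*U_A)$, $U_A=e_0\wedge e_A$ ($A=1,2,3$), and $\frac1{\sqrt2}(\mathcal U_2\pm\mathrm i\,\mathcal U_3)$. Assume that $\mathcal W$ is of Petrov-Bel type II at every point of an open subset $\Omega$ of a chart domain; that is, as an endomorphism of the space of self-dual bivectors it has minimal polynomial $(x-r)^2(x+2r)$ with some $r\neq0$. A Weyl principal frame is an oriented orthonormal frame for which $\mathcal W=3r\,\mathcal U\otimes\mathcal U+r\,\mathcal G+\mathcal L_+\otimes\mathcal L_+$ for some scalar $r$, where $\mathcal U=\mathcal U_1$ and $\mathcal L_+=\frac1{\sqrt2}(\mathcal U_2+\mathrm i\,\mathcal U_3)$. Put $$a=\operatorname{Tr}\mathcal W^2,\quad b=\operatorname{Tr}\mathcal W^3,\quad \rho=-\frac ba,\quad \mathcal P=(\mathcal W-\rho\,\mathcal G)^2,\quad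 \mathcal Q=\frac1{3\rho}(\mathcal W-\rho\,\mathcal G)(\mathcal W+2\rho\,\mathcal G).$$ Then $a\neq0$, $\rho\neq0$, and every point of $\Omega$ has a neighbourhood that carries a smooth Weyl principal frame. Moreover, let $\mathcal Y,\mathcal X,\mathcal Z$ be arbitrary differentiable bivector fields on $\Omega$ with $\mathcal P(\mathcal Y)\neq0$ and $\mathcal Q(\mathcal X)\neq0$ everywhere, and put $$\mathcal U=\frac{\mathcal P(\mathcal Y)}{\sqrt{-\mathcal P^2(\mathcal Y,\mathcal Y)}},\qquad \mathcal L_+=\frac{\mathcal Q(\mathcal X)}{\sqrt{\mathcal Q(\mathcal X,\mathcal X)}},$$ $$\mathcal L_-=\frac1{2(\mathcal L_+,\mathcal Z)^2}\Big[\mathcal S(\mathcal Z,\mathcal Z)\,\mathcal L_+-2(\mathcal L_+,\mathcal Z)\,\mathcal S(\mathcal Z)\Big],\qquad \mathcal S=\mathcal G+\mathcal U\otimes\mathcal U,$$ with any continuous branches of the square roots, and with $(\mathcal L_+,\mathcal Z)\neq0$ everywhere. Then both radicands are nowhere zero and $(\mathcal L_+,\mathcal X)\neq0$ (so that $\mathcal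 Z=\mathcal X$ is allowed); and for every differentiable Weyl principal frame $\{e_a\}$ on an open subset of $\Omega$, $\mathcal U$ coincides up to sign with the bivector $\mathcal U_1$ of the frame, $(\mathcal L_+,\mathcal L_-)$ coincides up to a common sign with its pair $\frac1{\sqrt2}(\mathcal U_2\pm\mathrm i\,\mathcal U_3)$, and the connection tensor of the frame is $$H=\frac1{\sqrt2}\big(\mathcal H+\bar{\mathcal H}\big),\qquad \mathcal H=-\frac1{\sqrt2}\big(\nabla\mathcal U\cdot\mathcal U+\nabla\mathcal L_+\cdot\mathcal L_-+\nabla\mathcal L_-\cdot\mathcal L_+\big),$$ where $(\nabla F\cdot K)_{\lambda\alpha\beta}=\nabla_\lambda F_{\alpha\mu}\,K^{\mu}{}_{\beta}$. -/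

import Mathlib

open scoped Manifold ContDiff Topology

noncomputable section

namespace Spacetime4

/-- Values of the coordinates of a chart; also the model space of the four-manifold. -/
abbrev Coord := Fin 4 → ℝ

/-- The components of a complex two-index covariant tensor at a point. -/
abbrev Tensor2 := Fin 4 → Fin 4 → ℂ

/-- The components of a complex four-index covariant tensor at a point. -/
abbrev Tensor4 := Fin 4 → Fin 4 → Fin 4 → Fin 4 → ℂ

/-- The signature symbol `diag(-1, 1, 1, 1)`. -/
def signature (a b : Fin 4) : ℝ := if a = b then (if a = 0 then -1 else 1) else 0

/-- The coordinate vector `∂_μ` of the chart `φ` at the point with coordinates `y`. -/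
def coordVec {M : Type*} [TopologicalSpace M] [ChartedSpace Coord M]
    (φ : OpenPartialHomeomorph M Coord) (y : Coord) (μ : Fin 4) :
    TangentSpace 𝓘(ℝ, Coord) (φ.symm y) :=
  mfderiv 𝓘(ℝ, Coord) 𝓘(ℝ, Coord) φ.symm y (Pi.single μ (1 : ℝ) : Coord)

/-- An oriented spacetime: a smooth four-manifold with a smooth metric of signature `(-,+,+,+)`
and a smooth metric volume element, that is, a smooth four-form that takes the values `±1` on
orthonormal bases (the choice of its sign is the orientation). -/
structure Spacetime (M : Type*) [TopologicalSpace M] [ChartedSpace Coord M]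
    [IsManifold 𝓘(ℝ, Coord) ∞ M] where
  metric : ∀ p : M, TangentSpace 𝓘(ℝ, Coord) p →ₗ[ℝ] TangentSpace 𝓘(ℝ, Coord) p →ₗ[ℝ] ℝ
  volume : ∀ p : M, (TangentSpace 𝓘(ℝ, Coord) p) [⋀^Fin 4]→ₗ[ℝ] ℝ
  metric_symm : ∀ p v w, metric p v w = metric p w v
  metric_signature : ∀ p, ∃ b : Fin 4 → TangentSpace 𝓘(ℝ, Coord) p,
    ∀ i j, metric p (b i) (b j) = signature i j
  volume_unit : ∀ p (b : Fin 4 → TangentSpace 𝓘(ℝ, Coord) p),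
    (∀ i j, metric p (b i) (b j) = signature i j) → volume p b = 1 ∨ volume p b = -1
  metric_smooth : ∀ φ ∈ IsManifold.maximalAtlas 𝓘(ℝ, Coord) ∞ M, ∀ μ ν : Fin 4,
    ContDiffOn ℝ ∞
      (fun y : Coord => metric (φ.symm y) (coordVec φ y μ) (coordVec φ y ν)) φ.target
  volume_smooth : ∀ φ ∈ IsManifold.maximalAtlas 𝓘(ℝ, Coord) ∞ M,
    ContDiffOn ℝ ∞ (fun y : Coord => volume (φ.symm y) (coordVec φ y)) φ.target

/-! ### Components in a chart -/

section Components

variable {M : Type*} [TopologicalSpace M] [ChartedSpace Coord M] [IsManifold 𝓘(ℝ, Coord) ∞ M]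

/-- The components `g_{μν}` of the metric in the chart `φ`. -/
def Spacetime.g (S : Spacetime M) (φ : OpenPartialHomeomorph M Coord) (y : Coord) :
    Matrix (Fin 4) (Fin 4) ℝ :=
  fun μ ν => S.metric (φ.symm y) (coordVec φ y μ) (coordVec φ y ν)

/-- The components `η_{αβγδ}` of the volume element in the chart `φ`. -/
def Spacetime.η (S : Spacetime M) (φ : OpenPartialHomeomorph M Coord) (y : Coord)
    (α β γ δ : Fin 4) : ℝ :=
  S.volume (φ.symm y) (fun i => coordVec φ y (![α, β, γ, δ] i))

end Components

/-! ### Levi-Civita connection and curvature, in coordinates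

Here `g` is the field of metric components on the coordinate domain. -/

/-- The partial derivative `∂_μ f`. -/
def pd {E : Type*} [NormedAddCommGroup E] [NormedSpace ℝ E] (μ : Fin 4) (f : Coord → E)
    (y : Coord) : E :=
  fderiv ℝ f y (Pi.single μ (1 : ℝ) : Coord)

/-- The Christoffel symbols `Γ^l_{μν}`. -/
def christoffel (g : Coord → Matrix (Fin 4) (Fin 4) ℝ) (l μ ν : Fin 4) (y : Coord) : ℝ :=
  (1 / 2) * ∑ σ, (g y)⁻¹ l σ *
    (pd μ (fun z => g z σ ν) y + pd ν (fun z => g z σ μ) y - pd σ (fun z => g z μ ν) y)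

/-- The Riemann tensor `R^α_{βμν}`. -/
def riemannUp (g : Coord → Matrix (Fin 4) (Fin 4) ℝ) (α β μ ν : Fin 4) (y : Coord) : ℝ :=
  pd μ (christoffel g α ν β) y - pd ν (christoffel g α μ β) y
    + ∑ σ, (christoffel g α μ σ y * christoffel g σ ν β y
      - christoffel g α ν σ y * christoffel g σ μ β y)

/-- The Riemann tensor `R_{αβμν}`. -/
def riemann (g : Coord → Matrix (Fin 4) (Fin 4) ℝ) (α β μ ν : Fin 4) (y : Coord) : ℝ :=
  ∑ σ, g y α σ * riemannUp g σ β μ ν y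

/-- The Ricci tensor `R_{βν} = R^α_{βαν}`. -/
def ricci (g : Coord → Matrix (Fin 4) (Fin 4) ℝ) (β ν : Fin 4) (y : Coord) : ℝ :=
  ∑ α, riemannUp g α β α ν y

/-- The scalar curvature. -/
def scalarCurvature (g : Coord → Matrix (Fin 4) (Fin 4) ℝ) (y : Coord) : ℝ :=
  ∑ β, ∑ ν, (g y)⁻¹ β ν * ricci g β ν y

/-- The Weyl tensor `W_{αβμν}` in dimension four. -/
def weyl (g : Coord → Matrix (Fin 4) (Fin 4) ℝ) (α β μ ν : Fin 4) (y : Coord) : ℝ :=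
  riemann g α β μ ν y
    - (1 / 2) * (g y α μ * ricci g β ν y - g y α ν * ricci g β μ y
      - g y β μ * ricci g α ν y + g y β ν * ricci g α μ y)
    + (scalarCurvature g y / 6) * (g y α μ * g y β ν - g y α ν * g y β μ)

/-- The covariant derivative `∇_l F_{αβ}` of a field of two-index covariant tensors. -/
def covDeriv (g : Coord → Matrix (Fin 4) (Fin 4) ℝ) (F : Coord → Tensor2) (l α β : Fin 4)
    (y : Coord) : ℂ :=
  pd l (fun z => F z α β) y
    - ∑ σ, ((christoffel g σ l α y : ℂ) * F y σ β + (christoffel g σ l β y : ℂ) * F y α σ)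

/-! ### Algebra of bivectors and double bivectors at a point

Here `g` is the matrix of metric components at the point; all tensors are given by their
covariant components. -/

/-- `F^{μν}`, the tensor `F` with both indices raised. -/
def raise (g : Matrix (Fin 4) (Fin 4) ℝ) (F : Tensor2) (μ ν : Fin 4) : ℂ :=
  ∑ α, ∑ β, ((g⁻¹ μ α : ℝ) : ℂ) * ((g⁻¹ ν β : ℝ) : ℂ) * F α β

/-- A bivector is an antisymmetric two-index tensor. -/
def IsBivector (F : Tensor2) : Prop := ∀ α β, F α β = -F β α

/-- `A(F)_{αβ} = (1/2) A_{αβμν} F^{μν}`, for a double bivector `A`. -/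
def act (g : Matrix (Fin 4) (Fin 4) ℝ) (A : Tensor4) (F : Tensor2) : Tensor2 :=
  fun α β => (1 / 2) * ∑ μ, ∑ ν, A α β μ ν * raise g F μ ν

/-- `A(F, K) = (1/4) A_{αβμν} F^{αβ} K^{μν}`, for a double bivector `A`. -/
def eval (g : Matrix (Fin 4) (Fin 4) ℝ) (A : Tensor4) (F K : Tensor2) : ℂ :=
  (1 / 4) * ∑ α, ∑ β, ∑ μ, ∑ ν, A α β μ ν * raise g F α β * raise g K μ ν

/-- The product `(A B)_{αβμν} = (1/2) A_{αβλρ} B^{λρ}_{μν}` of double bivectors. -/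
def comp (g : Matrix (Fin 4) (Fin 4) ℝ) (A B : Tensor4) : Tensor4 :=
  fun α β μ ν => (1 / 2) * ∑ l, ∑ r, A α β l r * raise g (fun κ τ => B κ τ μ ν) l r

/-- The trace `Tr A = (1/2) A^{μν}_{μν}` of a double bivector. -/
def trace (g : Matrix (Fin 4) (Fin 4) ℝ) (A : Tensor4) : ℂ :=
  (1 / 2) * ∑ μ, ∑ ν, raise g (fun κ τ => A κ τ μ ν) μ ν

/-- `F ⊗ K`. -/
def tensor (F K : Tensor2) : Tensor4 := fun α β μ ν => F α β * K μ ν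

/-- The Hodge dual `(*F)_{αβ} = (1/2) η_{αβμν} F^{μν}`. -/
def hodge (g : Matrix (Fin 4) (Fin 4) ℝ) (η : Fin 4 → Fin 4 → Fin 4 → Fin 4 → ℝ)
    (F : Tensor2) : Tensor2 :=
  act g (fun α β μ ν => (η α β μ ν : ℂ)) F

/-- `𝓖 = (1/2)(G - i η)`, `G_{αβμν} = g_{αμ} g_{βν} - g_{αν} g_{βμ}`: the induced metric on the
space of self-dual bivectors. -/
def sdMetric (g : Matrix (Fin 4) (Fin 4) ℝ) (η : Fin 4 → Fin 4 → Fin 4 → Fin 4 → ℝ) : Tensor4 :=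
  fun α β μ ν => (1 / 2) *
    (((g α μ * g β ν - g α ν * g β μ : ℝ) : ℂ) - Complex.I * (η α β μ ν : ℂ))

/-- The scalar `a = Tr 𝓦²`. -/
def scalarA (g : Matrix (Fin 4) (Fin 4) ℝ) (W : Tensor4) : ℂ := trace g (comp g W W)

/-- The scalar `b = Tr 𝓦³`. -/
def scalarB (g : Matrix (Fin 4) (Fin 4) ℝ) (W : Tensor4) : ℂ := trace g (comp g (comp g W W) W)

/-- The scalar `ρ = -b/a`. -/
def rho (g : Matrix (Fin 4) (Fin 4) ℝ) (W : Tensor4) : ℂ := -scalarB g W / scalarA g W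

/-- `W` (a self-dual Weyl tensor at a point, `G` being the metric of the self-dual bivectors) is of
Petrov-Bel type II: as an endomorphism of the three-dimensional space of self-dual bivectors
(whose identity is `G`) it has the minimal polynomial `(x - ρ)² (x + 2ρ)` for some `ρ ≠ 0`. -/
def IsTypeII (g : Matrix (Fin 4) (Fin 4) ℝ) (G W : Tensor4) : Prop :=
  ∃ ρ : ℂ, ρ ≠ 0 ∧
    comp g (comp g (W - ρ • G) (W - ρ • G)) (W + (2 * ρ) • G) = 0 ∧
    comp g (W - ρ • G) (W - ρ • G) ≠ 0 ∧
    comp g (W - ρ • G) (W + (2 * ρ) • G) ≠ 0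

/-- The concomitant `𝓟 = (𝓦 - ρ 𝓖)²`, `ρ = -b/a`. -/
def concP (g : Matrix (Fin 4) (Fin 4) ℝ) (G W : Tensor4) : Tensor4 :=
  comp g (W - rho g W • G) (W - rho g W • G)

/-- The concomitant `𝓠 = (1/(3ρ)) (𝓦 - ρ 𝓖)(𝓦 + 2ρ 𝓖)`, `ρ = -b/a`. -/
def concQ (g : Matrix (Fin 4) (Fin 4) ℝ) (G W : Tensor4) : Tensor4 :=
  (1 / (3 * rho g W)) • comp g (W - rho g W • G) (W + (2 * rho g W) • G)

/-- The bivector `𝓛₋` determined by `𝓤`, `𝓛₊` and an auxiliary bivector `Z` with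
`(𝓛₊, Z) ≠ 0`:
`𝓛₋ = (𝓢(Z,Z) 𝓛₊ - 2 (𝓛₊,Z) 𝓢(Z)) / (2 (𝓛₊,Z)²)`, `𝓢 = 𝓖 + 𝓤 ⊗ 𝓤`. -/
def lMinus (g : Matrix (Fin 4) (Fin 4) ℝ) (G : Tensor4) (U Lp Z : Tensor2) : Tensor2 :=
  (1 / (2 * eval g G Lp Z ^ 2)) •
    (eval g (G + tensor U U) Z Z • Lp - (2 * eval g G Lp Z) • act g (G + tensor U U) Z)

/-- The contraction of adjacent indices `(D · K)_{lαβ} = D_{lαμ} K^μ_β`. -/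
def contract (g : Matrix (Fin 4) (Fin 4) ℝ) (D : Fin 4 → Fin 4 → Fin 4 → ℂ) (K : Tensor2)
    (l α β : Fin 4) : ℂ :=
  ∑ μ, ∑ ν, D l α μ * ((g⁻¹ μ ν : ℝ) : ℂ) * K ν β

/-! ### Frames -/

/-- The components of the four vectors of a frame at a point, `e a μ = (e_a)^μ`, form an oriented
orthonormal frame: `g(e_a, e_b) = diag(-1,1,1,1)` and `η(e_0, e_1, e_2, e_3) = 1`. -/
def IsOrientedOrthonormal (g : Matrix (Fin 4) (Fin 4) ℝ)
    (η : Fin 4 → Fin 4 → Fin 4 → Fin 4 → ℝ) (e : Fin 4 → Fin 4 → ℝ) : Prop :=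
  (∀ a b, ∑ μ, ∑ ν, g μ ν * e a μ * e b ν = signature a b) ∧
    ∑ α, ∑ β, ∑ γ, ∑ δ, η α β γ δ * e 0 α * e 1 β * e 2 γ * e 3 δ = 1

/-- `(v ∧ w)_{αβ} = v_α w_β - v_β w_α`, for vectors `v`, `w` given by contravariant components. -/
def wedge (g : Matrix (Fin 4) (Fin 4) ℝ) (v w : Fin 4 → ℝ) : Tensor2 :=
  fun α β => ((g.mulVec v α * g.mulVec w β - g.mulVec v β * g.mulVec w α : ℝ) : ℂ)

/-- The bivectors `𝓤_A = (U_A - i *U_A)/√2`, `U_A = e_0 ∧ e_A`, of a frame (`A = 1, 2, 3`). -/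
def frameU (g : Matrix (Fin 4) (Fin 4) ℝ) (η : Fin 4 → Fin 4 → Fin 4 → Fin 4 → ℝ)
    (e : Fin 4 → Fin 4 → ℝ) (A : Fin 4) : Tensor2 :=
  (1 / (Real.sqrt 2 : ℂ)) • (wedge g (e 0) (e A) - Complex.I • hodge g η (wedge g (e 0) (e A)))

/-- The null bivector `𝓛₊ = (𝓤_2 + i 𝓤_3)/√2` of a frame. -/
def frameLp (g : Matrix (Fin 4) (Fin 4) ℝ) (η : Fin 4 → Fin 4 → Fin 4 → Fin 4 → ℝ)
    (e : Fin 4 → Fin 4 → ℝ) : Tensor2 :=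
  (1 / (Real.sqrt 2 : ℂ)) • (frameU g η e 2 + Complex.I • frameU g η e 3)

/-- The null bivector `𝓛₋ = (𝓤_2 - i 𝓤_3)/√2` of a frame. -/
def frameLm (g : Matrix (Fin 4) (Fin 4) ℝ) (η : Fin 4 → Fin 4 → Fin 4 → Fin 4 → ℝ)
    (e : Fin 4 → Fin 4 → ℝ) : Tensor2 :=
  (1 / (Real.sqrt 2 : ℂ)) • (frameU g η e 2 - Complex.I • frameU g η e 3)

/-- `e` is a Weyl principal frame (at a point) for the self-dual Weyl tensor `W` of type II: it is
oriented and orthonormal, and its bivectors `𝓤 = 𝓤_1` and `𝓛₊` put `W` in the canonical form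
`W = 3ρ 𝓤 ⊗ 𝓤 + ρ 𝓖 + 𝓛₊ ⊗ 𝓛₊`. -/
def IsWeylPrincipalFrame (g : Matrix (Fin 4) (Fin 4) ℝ)
    (η : Fin 4 → Fin 4 → Fin 4 → Fin 4 → ℝ) (W : Tensor4) (e : Fin 4 → Fin 4 → ℝ) : Prop :=
  IsOrientedOrthonormal g η e ∧
    ∃ ρ : ℂ, W = (3 * ρ) • tensor (frameU g η e 1) (frameU g η e 1) + ρ • sdMetric g η
      + tensor (frameLp g η e) (frameLp g η e)

/-- The algebraic dual basis: `dualFrame e a μ = (θ^a)_μ`, with `θ^a(e_b) = δ^a_b`. -/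
def dualFrame (e : Fin 4 → Fin 4 → ℝ) (a μ : Fin 4) : ℝ := (Matrix.of e)⁻¹ μ a

/-- The connection coefficients `γ^c_{ab}` of a frame field, `∇ e_a = γ^c_{ab} θ^b ⊗ e_c`, that is,
`γ^c_{ab} = θ^c(∇_{e_b} e_a)`. -/
def connCoeff (g : Coord → Matrix (Fin 4) (Fin 4) ℝ) (e : Coord → Fin 4 → Fin 4 → ℝ)
    (c a b : Fin 4) (y : Coord) : ℝ :=
  ∑ μ, ∑ l, dualFrame (e y) c μ * e y b l *
    (pd l (fun z => e z a μ) y + ∑ σ, christoffel g μ l σ y * e y a σ)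

/-- The connection tensor `H = γ^c_{ab} θ^b ⊗ θ^a ⊗ e_c` of a frame field, with its last index
lowered by the metric. -/
def connTensor (g : Coord → Matrix (Fin 4) (Fin 4) ℝ) (e : Coord → Fin 4 → Fin 4 → ℝ)
    (l α β : Fin 4) (y : Coord) : ℝ :=
  ∑ a, ∑ b, ∑ c, connCoeff g e c a b y * dualFrame (e y) b l * dualFrame (e y) a α *
    (g y).mulVec (e y c) β

/-- `𝓗 = -(1/√2) (∇𝓤 · 𝓤 + ∇𝓛₊ · 𝓛₋ + ∇𝓛₋ · 𝓛₊)`. -/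
def sdConn (g : Coord → Matrix (Fin 4) (Fin 4) ℝ) (U Lp Lm : Coord → Tensor2)
    (l α β : Fin 4) (y : Coord) : ℂ :=
  -(1 / (Real.sqrt 2 : ℂ)) *
    (contract (g y) (fun l α β => covDeriv g U l α β y) (U y) l α β
      + contract (g y) (fun l α β => covDeriv g Lp l α β y) (Lm y) l α β
      + contract (g y) (fun l α β => covDeriv g Lm l α β y) (Lp y) l α β)

/-! ### The self-dual Weyl tensor of a spacetime -/

section SelfDual

variable {M : Type*} [TopologicalSpace M] [ChartedSpace Coord M] [IsManifold 𝓘(ℝ, Coord) ∞ M]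

/-- The components of `𝓖` in the chart `φ`. -/
def Spacetime.G (S : Spacetime M) (φ : OpenPartialHomeomorph M Coord) (y : Coord) : Tensor4 :=
  sdMetric (S.g φ y) (S.η φ y)

/-- The components of the self-dual Weyl tensor `𝓦 = (1/2)(W - i *W)`,
`(*W)_{αβμν} = (1/2) η_{αβ}^{λρ} W_{λρμν}`, in the chart `φ`. -/
def Spacetime.W (S : Spacetime M) (φ : OpenPartialHomeomorph M Coord) (y : Coord) : Tensor4 :=
  fun α β μ ν => (1 / 2) * ((weyl (S.g φ) α β μ ν y : ℂ)
    - Complex.I * hodge (S.g φ y) (S.η φ y) (fun l r => (weyl (S.g φ) l r μ ν y : ℂ)) α β)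

end SelfDual

end Spacetime4

end

noncomputable section

namespace Spacetime4

/-! ### Orthonormal frames at a point -/

/-! Everything pointwise is reduced to complex 3×3 matrices. For an oriented orthonormal frame the
self-dual bivectors `triad` satisfy `(u_i, u_j) = -δ_ij`, and `tri u A = -∑ A_ij u_i ⊗ u_j` is an
injective algebra homomorphism that sends `1` to `𝓖` and the matrix trace to `trace`. In the
canonical form (`canonII r`) matrix multiplication gives `Tr 𝓦² = 6r²` and `Tr 𝓦³ = -6r³`, hence `ρ
= r`, and also `𝓟 = -9r² 𝓤 ⊗ 𝓤` and `𝓠 = 𝓛₊ ⊗ 𝓛₊`. So `𝓟(Y)` and `𝓠(X)` are multiples of `𝓤` and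
`𝓛₊`, the radicands are the squares `(9r²(𝓤,Y))²` and `(𝓛₊,X)²`, and division by any of their roots
recovers `𝓤` and `𝓛₊` up to sign. Since `𝓢 = -(𝓛₊ ⊗ 𝓛₋ + 𝓛₋ ⊗ 𝓛₊)`, the formula for `𝓛₋` returns the
partner of `𝓛₊` with the same sign, whatever `Z` is (`IsCanonical.recover`).

Existence of a principal frame at a point (`exists_principal_frame`). A tensor with the pair
symmetries of a Weyl tensor and no trace does not mix self-dual with anti-self-dual bivectors, so `𝓦
= tri u A` with `A` symmetric (`IsWeylLike.exists_tri`). Type II gives a null eigenvector of `A`. A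
spatial rotation carries its direction to `(0, 1, i)`, a null rotation removes the remaining mixing
of `u_1` with `𝓛₊`, and a boost together with a rotation in the plane of `e_2`, `e_3` normalizes the
coefficient of `𝓛₊ ⊗ 𝓛₊`.

Smoothness (`Spacetime.exists_smooth_frame`). The pointwise frames may be chosen without any
regularity, because tensors quadratic in their bivectors are smooth concomitants of `g`, `η` and
`𝓦`. A smooth tensor `F ⊗ F` has a smooth local root, equal to `F` up to sign. This yields smooth
`𝓤`, `𝓛₊`, then `𝓛₋`, then `e_0` from a quadratic expression for `θ_0 ⊗ θ_0`, and finally the other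
vectors by letting `𝓛₊` act on `e_0`. The sign ambiguities that survive amount to a proper Lorentz
transformation that preserves the canonical form.

Connection (`IsMetricOn.connTensor_eq_sdConn`). The bivectors of a frame have constant frame
components, so their covariant derivatives are commutator-like expressions in the antisymmetric
matrix `h` of connection coefficients. Summing `∇u_A · u_A` over the self-dual triad annihilates the
anti-self-dual part of `h` and multiplies its self-dual part by a constant (`derivCoeff_eq`); adding
the complex conjugate restores `h`. The given fields agree with those of the frame up to locally
constant signs, and these cancel because `𝓗` is quadratic, with a common sign for `𝓛₊` and `𝓛₋`. -/

/-- The determinant of four row vectors. -/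
def det4 (a b c d : Fin 4 → ℝ) : ℝ := (Matrix.of ![a, b, c, d]).det

lemma det4_eq (a b c d : Fin 4 → ℝ) :
    det4 a b c d =
      a 0 * (b 1 * (c 2 * d 3 - c 3 * d 2) - b 2 * (c 1 * d 3 - c 3 * d 1)
        + b 3 * (c 1 * d 2 - c 2 * d 1))
      - a 1 * (b 0 * (c 2 * d 3 - c 3 * d 2) - b 2 * (c 0 * d 3 - c 3 * d 0)
        + b 3 * (c 0 * d 2 - c 2 * d 0))
      + a 2 * (b 0 * (c 1 * d 3 - c 3 * d 1) - b 1 * (c 0 * d 3 - c 3 * d 0)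
        + b 3 * (c 0 * d 1 - c 1 * d 0))
      - a 3 * (b 0 * (c 1 * d 2 - c 2 * d 1) - b 1 * (c 0 * d 2 - c 2 * d 0)
        + b 2 * (c 0 * d 1 - c 1 * d 0)) := by
  simp [det4, Matrix.det_succ_row_zero, Fin.sum_univ_succ, Fin.succAbove]
  ring

/-- A totally antisymmetric four-index symbol. -/
def IsVolumeSymbol (η : Fin 4 → Fin 4 → Fin 4 → Fin 4 → ℝ) : Prop :=
  ∃ k : ℝ, ∀ α β γ δ, η α β γ δ =
    k * det4 (Pi.single α 1) (Pi.single β 1) (Pi.single γ 1) (Pi.single δ 1)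

/-- Multilinearity in the rows, applied to one slot at a time so that no single ring identity
involves all 256 terms. -/
lemma sum_det4_single (a b c d : Fin 4 → ℝ) :
    ∑ α, ∑ β, ∑ γ, ∑ δ, det4 (Pi.single α 1) (Pi.single β 1) (Pi.single γ 1) (Pi.single δ 1)
      * a α * b β * c γ * d δ = det4 a b c d := by
  have h4 : ∀ x y z : Fin 4 → ℝ, ∑ δ, det4 x y z (Pi.single δ 1) * d δ = det4 x y z d := by
    intro x y z; simp [det4_eq, Fin.sum_univ_four]; ring
  have h3 : ∀ x y : Fin 4 → ℝ, ∑ γ, det4 x y (Pi.single γ 1) d * c γ = det4 x y c d := by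
    intro x y; simp [det4_eq, Fin.sum_univ_four]; ring
  have h2 : ∀ x : Fin 4 → ℝ, ∑ β, det4 x (Pi.single β 1) c d * b β = det4 x b c d := by
    intro x; simp [det4_eq, Fin.sum_univ_four]; ring
  have h1 : ∑ α, det4 (Pi.single α 1) b c d * a α = det4 a b c d := by
    simp [det4_eq, Fin.sum_univ_four]; ring
  rw [← h1]
  refine Finset.sum_congr rfl fun α _ => ?_
  rw [← h2, Finset.sum_mul]
  refine Finset.sum_congr rfl fun β _ => ?_
  rw [← h3, Finset.sum_mul, Finset.sum_mul]
  refine Finset.sum_congr rfl fun γ _ => ?_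
  rw [← h4, Finset.sum_mul, Finset.sum_mul, Finset.sum_mul]
  refine Finset.sum_congr rfl fun δ _ => ?_
  ring

/-- The covariant components of the vectors of a frame. -/
def lower (g : Matrix (Fin 4) (Fin 4) ℝ) (e : Fin 4 → Fin 4 → ℝ) (a μ : Fin 4) : ℝ :=
  g.mulVec (e a) μ

/-- The signature matrix. -/
def sgn : Matrix (Fin 4) (Fin 4) ℝ := Matrix.of signature

/-- The diagonal entries of the signature matrix. -/
def sg (a : Fin 4) : ℝ := if a = 0 then -1 else 1

lemma signature_eq (a b : Fin 4) : signature a b = if a = b then sg a else 0 := rfl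

lemma sgn_mul_sgn : sgn * sgn = 1 := by
  ext i j; fin_cases i <;> fin_cases j <;>
    simp [sgn, Matrix.mul_apply, signature]

lemma det_sgn : sgn.det = -1 := by
  simp [sgn, signature, Matrix.det_succ_row_zero, Fin.sum_univ_succ, Fin.succAbove]

section

variable {g : Matrix (Fin 4) (Fin 4) ℝ} {η : Fin 4 → Fin 4 → Fin 4 → Fin 4 → ℝ}
  {e : Fin 4 → Fin 4 → ℝ}

/-- Orthonormality of a frame. -/
def IsOrthonormal (g : Matrix (Fin 4) (Fin 4) ℝ) (e : Fin 4 → Fin 4 → ℝ) : Prop :=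
  ∀ a b, ∑ μ, ∑ ν, g μ ν * e a μ * e b ν = signature a b

lemma IsOrthonormal.matrix (he : IsOrthonormal g e) :
    Matrix.of e * g * (Matrix.of e).transpose = sgn := by
  ext a b
  rw [sgn, Matrix.of_apply, ← he a b, Matrix.mul_apply, Finset.sum_comm]
  refine Finset.sum_congr rfl fun ν _ => ?_
  rw [Matrix.mul_apply, Finset.sum_mul]
  refine Finset.sum_congr rfl fun μ _ => ?_
  simp only [Matrix.transpose_apply, Matrix.of_apply]; ring

lemma IsOrthonormal.det (he : IsOrthonormal g e) :
    (Matrix.of e).det * g.det * (Matrix.of e).det = -1 := by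
  have := congrArg Matrix.det he.matrix
  simpa [Matrix.det_mul, det_sgn] using this

lemma IsOrthonormal.isUnit_det (he : IsOrthonormal g e) : IsUnit (Matrix.of e).det := by
  refine isUnit_iff_ne_zero.2 fun h => ?_
  have := he.det
  simp [h] at this

lemma IsOrthonormal.isUnit_det_metric (he : IsOrthonormal g e) : IsUnit g.det := by
  refine isUnit_iff_ne_zero.2 fun h => ?_
  have := he.det
  simp [h] at this

lemma IsOrthonormal.inv_frame (he : IsOrthonormal g e) :
    (Matrix.of e)⁻¹ = g * (Matrix.of e).transpose * sgn := by
  apply Matrix.inv_eq_right_inv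
  rw [← Matrix.mul_assoc, ← Matrix.mul_assoc, he.matrix, sgn_mul_sgn]

lemma IsOrthonormal.inv_metric (he : IsOrthonormal g e) :
    g⁻¹ = (Matrix.of e).transpose * sgn * Matrix.of e := by
  apply Matrix.inv_eq_right_inv
  rw [← Matrix.mul_assoc, ← Matrix.mul_assoc, ← he.inv_frame]
  exact Matrix.nonsing_inv_mul _ he.isUnit_det

lemma IsOrthonormal.inv_metric_apply (he : IsOrthonormal g e) (μ ν : Fin 4) :
    g⁻¹ μ ν = ∑ a, sg a * e a μ * e a ν := by
  rw [he.inv_metric, Matrix.mul_apply]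
  refine Finset.sum_congr rfl fun a _ => ?_
  simp [Matrix.mul_apply, sgn, signature_eq, Matrix.transpose, mul_comm]

lemma lower_eq (hs : g.IsSymm) (a μ : Fin 4) :
    lower g e a μ = (Matrix.of e * g) a μ := by
  rw [lower, Matrix.mulVec, dotProduct, Matrix.mul_apply]
  refine Finset.sum_congr rfl fun ν _ => ?_
  rw [hs.apply, Matrix.of_apply]; ring

lemma lower_eq' (a μ : Fin 4) :
    lower g e a μ = (g * (Matrix.of e).transpose) μ a := by
  rw [lower, Matrix.mulVec, dotProduct, Matrix.mul_apply]
  rfl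

lemma IsOrthonormal.sum_lower (he : IsOrthonormal g e) (a b : Fin 4) :
    ∑ μ, lower g e a μ * e b μ = signature a b := by
  have h := he b a
  rw [signature_eq] at h ⊢
  rw [Finset.sum_congr rfl fun μ _ => ?_, h]
  · by_cases hab : a = b
    · simp [hab]
    · simp [hab, Ne.symm hab]
  · rw [lower, Matrix.mulVec, dotProduct, Finset.sum_mul]
    exact Finset.sum_congr rfl fun ν _ => by ring

lemma IsOrthonormal.metric_apply (hs : g.IsSymm) (he : IsOrthonormal g e) (μ ν : Fin 4) :
    g μ ν = ∑ a, sg a * lower g e a μ * lower g e a ν := by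
  have h : g = g * (Matrix.of e).transpose * sgn * (Matrix.of e * g) := by
    rw [← he.inv_frame, ← Matrix.mul_assoc, Matrix.nonsing_inv_mul _ he.isUnit_det, Matrix.one_mul]
  rw [congrFun (congrFun h μ) ν, Matrix.mul_apply]
  refine Finset.sum_congr rfl fun a _ => ?_
  rw [← lower_eq hs, Matrix.mul_apply]
  simp [lower_eq', sgn, signature_eq, mul_comm]

lemma IsOrthonormal.dualFrame_eq (he : IsOrthonormal g e) (a μ : Fin 4) :
    dualFrame e a μ = sg a * lower g e a μ := by
  rw [dualFrame, he.inv_frame, Matrix.mul_apply]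
  simp [sgn, signature_eq, lower_eq']
  ring

lemma IsOrthonormal.inv_metric_lower (he : IsOrthonormal g e) (a μ : Fin 4) :
    ∑ ν, g⁻¹ μ ν * lower g e a ν = e a μ := by
  have : (g⁻¹.mulVec (g.mulVec (e a))) μ = e a μ := by
    rw [Matrix.mulVec_mulVec, Matrix.nonsing_inv_mul _ he.isUnit_det_metric, Matrix.one_mulVec]
  exact this

lemma inv_symm (hs : g.IsSymm) (μ ν : Fin 4) : g⁻¹ μ ν = g⁻¹ ν μ :=
  (hs.inv.apply _ _)

lemma det4_frame (e : Fin 4 → Fin 4 → ℝ) : det4 (e 0) (e 1) (e 2) (e 3) = (Matrix.of e).det := by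
  rw [det4]; congr 1; ext i j; fin_cases i <;> rfl

lemma IsVolumeSymbol.sum_eq (hη : IsVolumeSymbol η) :
    ∃ k : ℝ, (∀ α β γ δ, η α β γ δ =
      k * det4 (Pi.single α 1) (Pi.single β 1) (Pi.single γ 1) (Pi.single δ 1)) ∧
      ∀ v : Fin 4 → Fin 4 → ℝ,
        ∑ α, ∑ β, ∑ γ, ∑ δ, η α β γ δ * v 0 α * v 1 β * v 2 γ * v 3 δ
          = k * (Matrix.of v).det := by
  obtain ⟨k, hk⟩ := hη
  refine ⟨k, hk, fun v => ?_⟩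
  rw [← det4_frame, ← sum_det4_single]
  simp only [hk, Finset.mul_sum]
  refine Finset.sum_congr rfl fun _ _ => Finset.sum_congr rfl fun _ _ =>
    Finset.sum_congr rfl fun _ _ => Finset.sum_congr rfl fun _ _ => by ring

lemma IsOrientedOrthonormal.orthonormal (he : IsOrientedOrthonormal g η e) :
    IsOrthonormal g e := he.1

/-- The normalization `η(e_0, e_1, e_2, e_3) = 1` says `k det e = 1`, while orthonormality gives
`det e · det g · det e = -1`. Hence `k = -det (g eᵀ)`, and `g eᵀ` is the matrix of lowered frame
vectors. The minus sign is that of the Lorentzian signature. -/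
lemma IsOrientedOrthonormal.volume_eq (hη : IsVolumeSymbol η)
    (he : IsOrientedOrthonormal g η e) (α β γ δ : Fin 4) :
    η α β γ δ = -det4 (fun a => lower g e a α) (fun a => lower g e a β)
      (fun a => lower g e a γ) (fun a => lower g e a δ) := by
  obtain ⟨k, hk, hk'⟩ := hη.sum_eq
  have h1 := he.2
  rw [hk'] at h1
  have hM : Matrix.of ![(fun a => lower g e a α), (fun a => lower g e a β),
      (fun a => lower g e a γ), (fun a => lower g e a δ)]
      = Matrix.of ![Pi.single α 1, Pi.single β 1, Pi.single γ 1, Pi.single δ 1]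
        * (g * (Matrix.of e).transpose) := by
    ext i a
    rw [Matrix.mul_apply]
    fin_cases i <;> simp [lower_eq', Pi.single_apply]
  rw [hk, det4, det4, hM, Matrix.det_mul, Matrix.det_mul, Matrix.det_transpose]
  have h2 := IsOrthonormal.det he.1
  linear_combination (-(Matrix.of ![Pi.single α 1, Pi.single β 1, Pi.single γ 1,
      Pi.single δ (1 : ℝ)]).det * g.det * (Matrix.of e).det) * h1
    - k * (Matrix.of ![Pi.single α 1, Pi.single β 1, Pi.single γ 1,
      Pi.single δ (1 : ℝ)]).det * (-1) * h2

/-- A Lorentz transformation of unit determinant takes oriented orthonormal frames to oriented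
orthonormal frames. -/
lemma IsOrientedOrthonormal.transform (hη : IsVolumeSymbol η)
    (he : IsOrientedOrthonormal g η e) (Λ : Matrix (Fin 4) (Fin 4) ℝ)
    (hΛ : Λ * sgn * Λ.transpose = sgn) (hd : Λ.det = 1) :
    IsOrientedOrthonormal g η (fun a μ => ∑ b, Λ a b * e b μ) := by
  have hE : Matrix.of (fun a μ => ∑ b, Λ a b * e b μ) = Λ * Matrix.of e := by
    ext a μ; simp [Matrix.mul_apply]
  constructor
  · intro a b
    have h := IsOrthonormal.matrix he.1
    have : (Λ * Matrix.of e) * g * (Λ * Matrix.of e).transpose = sgn := by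
      rw [Matrix.transpose_mul, ← hΛ, ← h]
      simp only [Matrix.mul_assoc]
    rw [← hE] at this
    have h2 := congrFun (congrFun this a) b
    rw [sgn, Matrix.of_apply] at h2
    rw [← h2, Matrix.mul_apply, Finset.sum_comm]
    refine Finset.sum_congr rfl fun ν _ => ?_
    rw [Matrix.mul_apply, Finset.sum_mul]
    refine Finset.sum_congr rfl fun μ _ => ?_
    simp only [Matrix.transpose_apply, Matrix.of_apply]; ring
  · obtain ⟨k, hk, hk'⟩ := hη.sum_eq
    have h1 := he.2
    rw [hk'] at h1
    rw [hk' (fun a μ => ∑ b, Λ a b * e b μ), hE, Matrix.det_mul, hd, one_mul, h1]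

end

/-! ### The scalar product of bivectors -/

/-- `(F, K) = (1/2) F_{μν} K^{μν}`. -/
def dot (g : Matrix (Fin 4) (Fin 4) ℝ) : Tensor2 →ₗ[ℂ] Tensor2 →ₗ[ℂ] ℂ :=
  LinearMap.mk₂ ℂ (fun F K => (1 / 2) * ∑ μ, ∑ ν, F μ ν * raise g K μ ν)
    (fun F F' K => by
      simp only [Pi.add_apply, add_mul, Finset.sum_add_distrib, mul_add])
    (fun c F K => by
      simp only [Pi.smul_apply, smul_eq_mul, Finset.mul_sum]
      exact Finset.sum_congr rfl fun _ _ => Finset.sum_congr rfl fun _ _ => by ring)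
    (fun F K K' => by
      simp only [raise, Pi.add_apply, mul_add, Finset.sum_add_distrib])
    (fun c F K => by
      simp only [raise, Pi.smul_apply, smul_eq_mul, Finset.mul_sum]
      exact Finset.sum_congr rfl fun _ _ => Finset.sum_congr rfl fun _ _ =>
        Finset.sum_congr rfl fun _ _ => Finset.sum_congr rfl fun _ _ => by ring)

section

variable {g : Matrix (Fin 4) (Fin 4) ℝ} {η : Fin 4 → Fin 4 → Fin 4 → Fin 4 → ℝ}
  {e : Fin 4 → Fin 4 → ℝ}

lemma dot_apply (F K : Tensor2) :
    dot g F K = (1 / 2) * ∑ μ, ∑ ν, F μ ν * raise g K μ ν := rfl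

lemma dot_comm (hs : g.IsSymm) (F K : Tensor2) : dot g F K = dot g K F := by
  simp only [dot_apply, raise, Finset.mul_sum]
  have h3 : ∀ G : Fin 4 → Fin 4 → Fin 4 → ℂ,
      ∑ μ, ∑ ν, ∑ α, G μ ν α = ∑ α, ∑ μ, ∑ ν, G μ ν α := fun G => by
    rw [Finset.sum_congr rfl fun μ _ => Finset.sum_comm, Finset.sum_comm]
  have h : ∀ G : Fin 4 → Fin 4 → Fin 4 → Fin 4 → ℂ,
      ∑ μ, ∑ ν, ∑ α, ∑ β, G μ ν α β = ∑ α, ∑ β, ∑ μ, ∑ ν, G μ ν α β := fun G => by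
    rw [h3]
    exact Finset.sum_congr rfl fun α _ => h3 _
  rw [h]
  refine Finset.sum_congr rfl fun μ _ => Finset.sum_congr rfl fun ν _ =>
    Finset.sum_congr rfl fun α _ => Finset.sum_congr rfl fun β _ => ?_
  rw [inv_symm hs μ α, inv_symm hs ν β]; ring

lemma act_apply (A : Tensor4) (F : Tensor2) (α β : Fin 4) : act g A F α β = dot g (A α β) F := rfl

lemma comp_apply (A B : Tensor4) (α β μ ν : Fin 4) :
    comp g A B α β μ ν = dot g (A α β) (fun κ τ => B κ τ μ ν) := rfl

lemma eval_eq_dot (hs : g.IsSymm) (A : Tensor4) (F K : Tensor2) :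
    eval g A F K = dot g F (act g A K) := by
  rw [dot_comm hs, dot_apply, eval]
  simp only [act, Finset.mul_sum, Finset.sum_mul]
  exact Finset.sum_congr rfl fun _ _ => Finset.sum_congr rfl fun _ _ =>
    Finset.sum_congr rfl fun _ _ => Finset.sum_congr rfl fun _ _ => by ring

lemma act_tensor (F K L : Tensor2) : act g (tensor F K) L = dot g K L • F := by
  ext α β
  rw [act_apply]
  have : tensor F K α β = F α β • K := rfl
  rw [this, map_smul, LinearMap.smul_apply]
  simp [mul_comm]

lemma act_add (A B : Tensor4) (F : Tensor2) : act g (A + B) F = act g A F + act g B F := by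
  ext α β; simp [act_apply]

lemma act_smul (c : ℂ) (A : Tensor4) (F : Tensor2) : act g (c • A) F = c • act g A F := by
  ext α β; simp [act_apply]

lemma act_neg (A : Tensor4) (F : Tensor2) : act g (-A) F = -act g A F := by
  ext α β; simp [act_apply]

lemma act_sum {ι : Type*} (s : Finset ι) (A : ι → Tensor4) (F : Tensor2) :
    act g (∑ i ∈ s, A i) F = ∑ i ∈ s, act g (A i) F := by
  ext α β; simp [act_apply, Finset.sum_apply, map_sum]

/-- The real bivector `F` with `F^{μν}`: raising the indices of a wedge product. -/
lemma IsOrthonormal.raise_wedge (he : IsOrthonormal g e) (a b : Fin 4) (μ ν : Fin 4) :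
    raise g (wedge g (e a) (e b)) μ ν = ((e a μ * e b ν - e b μ * e a ν : ℝ) : ℂ) := by
  rw [← he.inv_metric_lower a μ, ← he.inv_metric_lower b ν, ← he.inv_metric_lower b μ,
    ← he.inv_metric_lower a ν]
  simp only [raise, wedge, lower, Finset.sum_mul_sum]
  push_cast
  rw [← Finset.sum_sub_distrib]
  refine Finset.sum_congr rfl fun α _ => ?_
  rw [← Finset.sum_sub_distrib]
  exact Finset.sum_congr rfl fun β _ => by ring

lemma wedge_apply (a b α β : Fin 4) : wedge g (e a) (e b) α β =
    ((lower g e a α * lower g e b β - lower g e a β * lower g e b α : ℝ) : ℂ) := rfl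

lemma IsOrthonormal.dot_wedge_wedge (he : IsOrthonormal g e) (a b c d : Fin 4) :
    dot g (wedge g (e a) (e b)) (wedge g (e c) (e d)) =
      ((signature a c * signature b d - signature a d * signature b c : ℝ) : ℂ) := by
  rw [dot_apply]
  simp only [he.raise_wedge, wedge_apply]
  rw [← he.sum_lower a c, ← he.sum_lower b d, ← he.sum_lower a d, ← he.sum_lower b c]
  simp only [Fin.sum_univ_four]
  push_cast; ring

lemma sum_det4_right (x y z : Fin 4 → ℝ) (F : Fin 4 → Fin 4 → ℝ) (c : Fin 4 → ℝ) :
    ∑ ν, det4 x y z (fun a => F a ν) * c ν = det4 x y z (fun a => ∑ ν, F a ν * c ν) := by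
  simp only [det4_eq, Fin.sum_univ_four]; ring

lemma sum_det4_mid (x y z : Fin 4 → ℝ) (F : Fin 4 → Fin 4 → ℝ) (c : Fin 4 → ℝ) :
    ∑ ν, det4 x y (fun a => F a ν) z * c ν = det4 x y (fun a => ∑ ν, F a ν * c ν) z := by
  simp only [det4_eq, Fin.sum_univ_four]; ring

/-- With `η` written as a determinant of lowered frame vectors, contraction with `e_i` and `e_j`
replaces two rows of the determinant by rows of the signature. The three duals needed for the triad
can then be read off. -/
lemma IsOrientedOrthonormal.hodge_wedge (hη : IsVolumeSymbol η)
    (he : IsOrientedOrthonormal g η e) (i j α β : Fin 4) :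
    hodge g η (wedge g (e i) (e j)) α β =
      ((-det4 (fun a => lower g e a α) (fun a => lower g e a β)
        (fun a => signature a i) (fun a => signature a j) : ℝ) : ℂ) := by
  have he' : IsOrthonormal g e := he.1
  have h1 : ∀ i j, ∑ μ, ∑ ν, η α β μ ν * e i μ * e j ν =
      -det4 (fun a => lower g e a α) (fun a => lower g e a β)
        (fun a => signature a i) (fun a => signature a j) := by
    intro i j
    simp only [he.volume_eq hη]
    rw [Finset.sum_congr rfl fun μ _ => (Finset.sum_congr rfl fun ν _ =>
      (show _ = (-e i μ) * (det4 (fun a => lower g e a α) (fun a => lower g e a β)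
      (fun a => lower g e a μ) (fun a => lower g e a ν) * e j ν) by ring))]
    simp only [← Finset.mul_sum, sum_det4_right, he'.sum_lower]
    rw [Finset.sum_congr rfl fun μ _ =>
      (show _ = (-1) * (det4 (fun a => lower g e a α) (fun a => lower g e a β)
      (fun a => lower g e a μ) (fun a => signature a j) * e i μ) by ring)]
    rw [← Finset.mul_sum, sum_det4_mid]
    simp only [he'.sum_lower]; ring
  have h2 := h1 j i
  rw [show -det4 (fun a => lower g e a α) (fun a => lower g e a β)
        (fun a => signature a j) (fun a => signature a i) = det4 (fun a => lower g e a α)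
        (fun a => lower g e a β) (fun a => signature a i) (fun a => signature a j) by
      simp only [det4_eq]; ring] at h2
  rw [hodge, act]
  simp only [he'.raise_wedge]
  have h3 : ∑ μ, ∑ ν, (η α β μ ν : ℂ) * ((e i μ * e j ν - e j μ * e i ν : ℝ) : ℂ) =
      ((∑ μ, ∑ ν, η α β μ ν * e i μ * e j ν - ∑ μ, ∑ ν, η α β μ ν * e j μ * e i ν : ℝ) : ℂ) := by
    simp only [← Finset.sum_sub_distrib]
    push_cast
    exact Finset.sum_congr rfl fun μ _ => Finset.sum_congr rfl fun ν _ => by ring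
  rw [h3, h1, h2]; push_cast; ring

/-! ### The self-dual triad of a frame -/

/-- The self-dual bivectors `𝓤_A` of a frame, `A = 1, 2, 3`. -/
def triad (g : Matrix (Fin 4) (Fin 4) ℝ) (η : Fin 4 → Fin 4 → Fin 4 → Fin 4 → ℝ)
    (e : Fin 4 → Fin 4 → ℝ) (i : Fin 3) : Tensor2 := frameU g η e i.succ

/-- `1 / √2`. -/
def isq : ℂ := 1 / (Real.sqrt 2 : ℂ)

lemma isq_sq : isq * isq = 1 / 2 := by
  rw [isq, div_mul_div_comm, one_mul, ← Complex.ofReal_mul, Real.mul_self_sqrt (by norm_num)]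
  norm_num

lemma conj_isq : (starRingEnd ℂ) isq = isq := by simp [isq]

/-- The bivector `e_0 ∧ e_A - i e_B ∧ e_C`, up to normalization. -/
def selfDualWedge (g : Matrix (Fin 4) (Fin 4) ℝ) (e : Fin 4 → Fin 4 → ℝ) (a b c : Fin 4) :
    Tensor2 := isq • (wedge g (e 0) (e a) - Complex.I • wedge g (e b) (e c))

lemma IsOrientedOrthonormal.triad_zero (hη : IsVolumeSymbol η)
    (he : IsOrientedOrthonormal g η e) : triad g η e 0 = selfDualWedge g e 1 2 3 := by
  have : hodge g η (wedge g (e 0) (e 1)) = wedge g (e 2) (e 3) := by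
    ext α β
    rw [he.hodge_wedge hη, wedge_apply]
    simp [det4_eq, signature]; ring
  rw [triad, frameU, selfDualWedge, ← this]; rfl

lemma IsOrientedOrthonormal.triad_one (hη : IsVolumeSymbol η)
    (he : IsOrientedOrthonormal g η e) : triad g η e 1 = selfDualWedge g e 2 3 1 := by
  have : hodge g η (wedge g (e 0) (e 2)) = wedge g (e 3) (e 1) := by
    ext α β
    rw [he.hodge_wedge hη, wedge_apply]
    simp [det4_eq, signature]; ring
  rw [triad, frameU, selfDualWedge, ← this]; rfl

lemma IsOrientedOrthonormal.triad_two (hη : IsVolumeSymbol η)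
    (he : IsOrientedOrthonormal g η e) : triad g η e 2 = selfDualWedge g e 3 1 2 := by
  have : hodge g η (wedge g (e 0) (e 3)) = wedge g (e 1) (e 2) := by
    ext α β
    rw [he.hodge_wedge hη, wedge_apply]
    simp [det4_eq, signature]; ring
  rw [triad, frameU, selfDualWedge, ← this]; rfl

lemma IsOrthonormal.dot_selfDualWedge (he : IsOrthonormal g e) (a b c a' b' c' : Fin 4) :
    dot g (selfDualWedge g e a b c) (selfDualWedge g e a' b' c') =
      1 / 2 * (((signature 0 0 * signature a a' - signature 0 a' * signature a 0
          - (signature b b' * signature c c' - signature b c' * signature c b') : ℝ) : ℂ)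
        - Complex.I * ((signature 0 b' * signature a c' - signature 0 c' * signature a b'
          + (signature b 0 * signature c a' - signature b a' * signature c 0) : ℝ) : ℂ)) := by
  simp only [selfDualWedge, map_smul, map_sub, LinearMap.smul_apply, LinearMap.sub_apply,
    he.dot_wedge_wedge, smul_eq_mul]
  rw [← isq_sq]; push_cast
  linear_combination (-isq * isq *
    (-(signature b b' * signature c c' - signature b c' * signature c b') : ℂ)) * Complex.I_mul_I

lemma IsOrientedOrthonormal.dot_triad (hη : IsVolumeSymbol η)
    (he : IsOrientedOrthonormal g η e) (i j : Fin 3) :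
    dot g (triad g η e i) (triad g η e j) = if i = j then -1 else 0 := by
  have he' : IsOrthonormal g e := he.1
  fin_cases i <;> fin_cases j <;>
    simp [he.triad_zero hη, he.triad_one hη, he.triad_two hη, he'.dot_selfDualWedge, signature] <;>
    norm_num

/-- Completeness of the self-dual triad: `𝓖` is the projector onto the self-dual bivectors, and the
minus sign compensates `(u_i, u_i) = -1`. With `g` and `η` expressed in the lowered frame this is a
polynomial identity modulo `i² = -1`. -/
lemma IsOrientedOrthonormal.sdMetric_eq (hs : g.IsSymm) (hη : IsVolumeSymbol η)
    (he : IsOrientedOrthonormal g η e) :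
    sdMetric g η = -∑ i, tensor (triad g η e i) (triad g η e i) := by
  have he' : IsOrthonormal g e := he.1
  ext α β μ ν
  rw [sdMetric, he.volume_eq hη, he'.metric_apply hs, he'.metric_apply hs, he'.metric_apply hs,
    he'.metric_apply hs, det4_eq]
  simp only [Fin.sum_univ_three, Fin.sum_univ_four, he.triad_zero hη, he.triad_one hη,
    he.triad_two hη]
  have hf : ∀ a b c : Fin 4, tensor (selfDualWedge g e a b c) (selfDualWedge g e a b c) α β μ ν =
      1 / 2 * ((wedge g (e 0) (e a) α β - Complex.I * wedge g (e b) (e c) α β)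
        * (wedge g (e 0) (e a) μ ν - Complex.I * wedge g (e b) (e c) μ ν)) := fun a b c => by
    simp only [tensor, selfDualWedge, Pi.smul_apply, Pi.sub_apply, smul_eq_mul]
    rw [mul_mul_mul_comm, isq_sq]
  simp only [Pi.neg_apply, Pi.add_apply, hf]
  simp only [wedge_apply, sg]
  simp only [if_true, one_ne_zero, if_false, show (2 : Fin 4) ≠ 0 by decide,
    show (3 : Fin 4) ≠ 0 by decide]
  push_cast
  have hI := congrArg (fun x => 1 / 2 * (wedge g (e 2) (e 3) α β * wedge g (e 2) (e 3) μ ν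
    + wedge g (e 3) (e 1) α β * wedge g (e 3) (e 1) μ ν
    + wedge g (e 1) (e 2) α β * wedge g (e 1) (e 2) μ ν) * x) Complex.I_mul_I
  simp only [wedge_apply] at hI
  push_cast at hI
  linear_combination hI

end

/-! ### Double bivectors as matrices in an orthonormal triad -/

section

variable {g : Matrix (Fin 4) (Fin 4) ℝ} {η : Fin 4 → Fin 4 → Fin 4 → Fin 4 → ℝ}
  {e : Fin 4 → Fin 4 → ℝ} {u : Fin 3 → Tensor2}

/-- Three bivectors with `(u_i, u_j) = -δ_{ij}`. -/
def IsTriad (g : Matrix (Fin 4) (Fin 4) ℝ) (u : Fin 3 → Tensor2) : Prop :=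
  ∀ i j, dot g (u i) (u j) = if i = j then -1 else 0

/-- The double bivector that acts on the triad `u` as the matrix `A`. -/
def tri (u : Fin 3 → Tensor2) (A : Matrix (Fin 3) (Fin 3) ℂ) : Tensor4 :=
  -∑ i, ∑ j, A i j • tensor (u i) (u j)

lemma tri_add (A B : Matrix (Fin 3) (Fin 3) ℂ) : tri u (A + B) = tri u A + tri u B := by
  simp only [tri, Matrix.add_apply, add_smul, Finset.sum_add_distrib, neg_add]

lemma tri_smul (c : ℂ) (A : Matrix (Fin 3) (Fin 3) ℂ) : tri u (c • A) = c • tri u A := by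
  simp only [tri, Matrix.smul_apply, smul_neg, Finset.smul_sum, smul_smul, smul_eq_mul]

lemma tri_sub (A B : Matrix (Fin 3) (Fin 3) ℂ) : tri u (A - B) = tri u A - tri u B := by
  simp only [tri, Matrix.sub_apply, sub_smul, Finset.sum_sub_distrib]; abel

lemma tri_one : tri u 1 = -∑ i, tensor (u i) (u i) := by
  simp [tri, Matrix.one_apply, Finset.sum_ite_eq]

lemma tri_apply_left (A : Matrix (Fin 3) (Fin 3) ℂ) (α β : Fin 4) :
    tri u A α β = -∑ i, ∑ j, (A i j * u i α β) • u j := by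
  ext μ ν
  simp only [tri, tensor, Finset.sum_apply, Pi.neg_apply, Pi.smul_apply, smul_eq_mul, mul_assoc]

lemma tri_apply_right (A : Matrix (Fin 3) (Fin 3) ℂ) (μ ν : Fin 4) :
    (fun α β => tri u A α β μ ν) = -∑ i, ∑ j, (A i j * u j μ ν) • u i := by
  ext α β
  simp only [tri, tensor, Finset.sum_apply, Pi.neg_apply, Pi.smul_apply, smul_eq_mul]
  congr 1
  exact Finset.sum_congr rfl fun _ _ => Finset.sum_congr rfl fun _ _ => by ring

/-- The minus sign in `tri` is there for this: each contraction of adjacent factors gives `-δ_ij`,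
so two signs and one contraction leave a single sign, and `tri` is multiplicative. -/
lemma comp_tri (hu : IsTriad g u) (A B : Matrix (Fin 3) (Fin 3) ℂ) :
    comp g (tri u A) (tri u B) = tri u (A * B) := by
  ext α β μ ν
  rw [comp_apply, tri_apply_left, tri_apply_right, tri_apply_left]
  have hu' : ∀ i j, dot g (u i) (u j) = if i = j then -1 else 0 := hu
  simp only [Fin.sum_univ_three, map_neg, map_add, map_smul, LinearMap.neg_apply,
    LinearMap.add_apply, LinearMap.smul_apply, smul_eq_mul, hu', Matrix.mul_apply, Pi.neg_apply,
    Pi.add_apply, Pi.smul_apply]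
  simp
  ring

lemma trace_tri (hu : IsTriad g u) (A : Matrix (Fin 3) (Fin 3) ℂ) :
    trace g (tri u A) = A.trace := by
  have h1 : trace g (tri u A) = -∑ i, ∑ j, A i j * dot g (u j) (u i) := by
    simp only [trace, dot_apply, raise, Fin.sum_univ_three, Finset.mul_sum,
      ← Finset.sum_neg_distrib, ← Finset.sum_add_distrib]
    simp only [tri, tensor, Fin.sum_univ_three, Pi.neg_apply, Pi.add_apply, Pi.smul_apply,
      smul_eq_mul]
    exact Finset.sum_congr rfl fun _ _ => Finset.sum_congr rfl fun _ _ =>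
      Finset.sum_congr rfl fun _ _ => Finset.sum_congr rfl fun _ _ => by ring
  have hu' : ∀ i j, dot g (u i) (u j) = if i = j then -1 else 0 := hu
  rw [h1]
  simp [hu', Matrix.trace]

lemma act_tri (A : Matrix (Fin 3) (Fin 3) ℂ) (F : Tensor2) :
    act g (tri u A) F = -∑ i, ∑ j, (A i j * dot g (u j) F) • u i := by
  rw [tri, act_neg, act_sum]
  congr 1
  refine Finset.sum_congr rfl fun i _ => ?_
  rw [act_sum]
  exact Finset.sum_congr rfl fun j _ => by rw [act_smul, act_tensor, smul_smul]

lemma eval_tri_triad (hs : g.IsSymm) (hu : IsTriad g u) (A : Matrix (Fin 3) (Fin 3) ℂ)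
    (i j : Fin 3) : eval g (tri u A) (u i) (u j) = -A i j := by
  rw [eval_eq_dot hs, act_tri]
  have hu' : ∀ i j, dot g (u i) (u j) = if i = j then -1 else 0 := hu
  simp [hu']

/-- The matrix entries are recovered by evaluation on the triad. This lets vanishing and
nonvanishing conditions on double bivectors be read as conditions on matrices. -/
lemma tri_injective (hs : g.IsSymm) (hu : IsTriad g u) : Function.Injective (tri u) := by
  intro A B h
  ext i j
  have := congrArg (fun T => eval g T (u i) (u j)) h
  simpa [eval_tri_triad hs hu] using this

/-- The null bivector `(u_2 + i u_3)/√2` of a triad. -/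
def triadLp (u : Fin 3 → Tensor2) : Tensor2 := isq • (u 1 + Complex.I • u 2)

/-- The null bivector `(u_2 - i u_3)/√2` of a triad. -/
def triadLm (u : Fin 3 → Tensor2) : Tensor2 := isq • (u 1 - Complex.I • u 2)

/-- The matrix of the canonical form of type II. -/
def canonII (r : ℂ) : Matrix (Fin 3) (Fin 3) ℂ :=
  !![-2 * r, 0, 0; 0, r - 1 / 2, -(Complex.I / 2); 0, -(Complex.I / 2), r + 1 / 2]

lemma tri_canonII (r : ℂ) : tri u (canonII r) =
    (3 * r) • tensor (u 0) (u 0) + r • tri u 1 + tensor (triadLp u) (triadLp u) := by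
  have h : ∀ F K : Tensor2, tensor (isq • (F + Complex.I • K)) (isq • (F + Complex.I • K)) =
      (1 / 2 : ℂ) • (tensor F F + Complex.I • tensor F K + Complex.I • tensor K F
        - tensor K K) := fun F K => by
    ext α β μ ν
    simp only [tensor, Pi.smul_apply, Pi.add_apply, Pi.sub_apply, smul_eq_mul]
    rw [← isq_sq]
    linear_combination (isq * isq * K α β * K μ ν) * Complex.I_mul_I
  rw [triadLp, h, tri_one]
  ext α β μ ν
  simp only [tri, canonII, Fin.sum_univ_three, Pi.smul_apply, Pi.add_apply, Pi.sub_apply,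
    Pi.neg_apply, smul_eq_mul]
  simp
  ring

lemma canonII_sq_trace (r : ℂ) : (canonII r * canonII r).trace = 6 * r ^ 2 := by
  simp [canonII, Matrix.trace, Fin.sum_univ_three]
  ring_nf; simp

lemma canonII_cube_trace (r : ℂ) :
    (canonII r * canonII r * canonII r).trace = -6 * r ^ 3 := by
  simp [canonII, Matrix.trace, Fin.sum_univ_three]
  ring_nf; simp

lemma canonII_sub_sq (r : ℂ) :
    (canonII r - r • 1) * (canonII r - r • 1) = !![9 * r ^ 2, 0, 0; 0, 0, 0; 0, 0, 0] := by
  ext i j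
  fin_cases i <;> fin_cases j <;>
    simp [canonII, Fin.sum_univ_three, Matrix.mul_apply] <;>
    ring_nf <;> simp

lemma canonII_sub_mul_add (r : ℂ) :
    (canonII r - r • 1) * (canonII r + (2 * r) • 1) =
      (3 * r) • !![0, 0, 0; 0, -(1 / 2), -(Complex.I / 2); 0, -(Complex.I / 2), 1 / 2] := by
  ext i j
  fin_cases i <;> fin_cases j <;>
    simp [canonII, Fin.sum_univ_three, Matrix.mul_apply] <;>
    ring_nf <;> simp

/-- The double bivector `W` has the canonical form of type II in the triad `u`. -/
def IsCanonical (g : Matrix (Fin 4) (Fin 4) ℝ) (G W : Tensor4) (u : Fin 3 → Tensor2)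
    (r : ℂ) : Prop :=
  g.IsSymm ∧ IsTriad g u ∧ G = tri u 1 ∧ W = tri u (canonII r)

variable {G W : Tensor4} {r : ℂ}

lemma IsCanonical.scalarA (h : IsCanonical g G W u r) : scalarA g W = 6 * r ^ 2 := by
  obtain ⟨hs, hu, -, rfl⟩ := h
  rw [Spacetime4.scalarA, comp_tri hu, trace_tri hu, canonII_sq_trace]

lemma IsCanonical.scalarB (h : IsCanonical g G W u r) : scalarB g W = -6 * r ^ 3 := by
  obtain ⟨hs, hu, -, rfl⟩ := h
  rw [Spacetime4.scalarB, comp_tri hu, comp_tri hu, trace_tri hu, canonII_cube_trace]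

/-- Valid for `r = 0` as well. The definition of a Weyl principal frame does not require its scalar
to be nonzero; this equality is what shows it. -/
lemma IsCanonical.rho (h : IsCanonical g G W u r) : rho g W = r := by
  rw [Spacetime4.rho, h.scalarA, h.scalarB]
  -- Here the quotient is `0 / 0`, which evaluates to `0 = r`.
  by_cases hr : r = 0
  · simp [hr]
  · field_simp

lemma IsCanonical.concP (h : IsCanonical g G W u r) :
    concP g G W = (-9 * r ^ 2) • tensor (u 0) (u 0) := by
  rw [Spacetime4.concP, h.rho]
  obtain ⟨hs, hu, rfl, rfl⟩ := h
  rw [← tri_smul, ← tri_sub, comp_tri hu, canonII_sub_sq]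
  simp [tri, Fin.sum_univ_three]

lemma IsCanonical.concQ (h : IsCanonical g G W u r) (hr : r ≠ 0) :
    concQ g G W = tensor (triadLp u) (triadLp u) := by
  rw [Spacetime4.concQ, h.rho]
  obtain ⟨hs, hu, rfl, rfl⟩ := h
  rw [← tri_smul, ← tri_smul, ← tri_sub, ← tri_add, comp_tri hu, canonII_sub_mul_add, tri_smul,
    smul_smul, one_div_mul_cancel (by simpa using hr), one_smul]
  -- At `r = 0` the canonical form is just `𝓛₊ ⊗ 𝓛₊`, so `canonII 0` is the nilpotent matrix that
  -- remains.
  have := tri_canonII (u := u) 0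
  simp only [mul_zero, zero_smul, zero_add] at this
  rw [← this]
  simp [canonII]

lemma IsTriad.dot_zero_zero (hu : IsTriad g u) : dot g (u 0) (u 0) = -1 := by simpa using hu 0 0

lemma IsTriad.dot_Lp_Lm (hu : IsTriad g u) : dot g (triadLp u) (triadLm u) = -1 := by
  have hu' : ∀ i j, dot g (u i) (u j) = if i = j then -1 else 0 := hu
  simp [triadLp, triadLm, hu']
  linear_combination (-2) * isq_sq

/-- Passing to the null basis of the plane of `u_2`, `u_3`. In this form adding `𝓤 ⊗ 𝓤` visibly
leaves only the two mixed null terms. -/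
lemma tri_one_eq : tri u 1 = -(tensor (u 0) (u 0) + tensor (triadLp u) (triadLm u)
    + tensor (triadLm u) (triadLp u)) := by
  have h : ∀ F K : Tensor2, tensor (isq • (F + Complex.I • K)) (isq • (F - Complex.I • K))
      + tensor (isq • (F - Complex.I • K)) (isq • (F + Complex.I • K)) =
      tensor F F + tensor K K := fun F K => by
    ext α β μ ν
    simp only [tensor, Pi.smul_apply, Pi.add_apply, Pi.sub_apply, smul_eq_mul]
    linear_combination (-2 * isq * isq * K α β * K μ ν) * Complex.I_mul_I
      + 2 * (F α β * F μ ν + K α β * K μ ν) * isq_sq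
  rw [tri_one, Fin.sum_univ_three, add_assoc, ← h, triadLp, triadLm, add_assoc]

/-- `F` is arbitrary: the auxiliary tensors `X`, `Y`, `Z` need not be self-dual, since only their
projections on the triad enter. -/
lemma IsTriad.dot_act_one (hu : IsTriad g u) (i : Fin 3) (F : Tensor2) :
    dot g (u i) (act g (tri u 1) F) = dot g (u i) F := by
  have hu' : ∀ i j, dot g (u i) (u j) = if i = j then -1 else 0 := hu
  rw [act_tri]
  simp [hu', Matrix.one_apply]

lemma IsTriad.eval_one_Lp (hs : g.IsSymm) (hu : IsTriad g u) (F : Tensor2) :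
    eval g (tri u 1) (triadLp u) F = dot g (triadLp u) F := by
  rw [eval_eq_dot hs, triadLp]
  simp [hu.dot_act_one]

lemma eval_smul_left (c : ℂ) (A : Tensor4) (F K : Tensor2) :
    eval g A (c • F) K = c * eval g A F K := by
  simp only [eval, raise, Pi.smul_apply, smul_eq_mul, Finset.mul_sum]
  exact Finset.sum_congr rfl fun _ _ => Finset.sum_congr rfl fun _ _ =>
    Finset.sum_congr rfl fun _ _ => Finset.sum_congr rfl fun _ _ => by
      simp only [Finset.sum_mul, Finset.mul_sum]
      exact Finset.sum_congr rfl fun _ _ => Finset.sum_congr rfl fun _ _ =>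
        Finset.sum_congr rfl fun _ _ => Finset.sum_congr rfl fun _ _ => by ring

lemma tensor_smul_smul (c d : ℂ) (F K : Tensor2) :
    tensor (c • F) (d • K) = (c * d) • tensor F K := by
  ext α β μ ν; simp only [tensor, Pi.smul_apply, smul_eq_mul]; ring

/-- The bivector `𝓛₋` does not depend on the auxiliary bivector, and changes sign with `𝓛₊`. -/
lemma IsTriad.lMinus_eq (hs : g.IsSymm) (hu : IsTriad g u) {c d : ℂ} (hc : c * c = 1)
    (hd : d * d = 1) {Z : Tensor2} (hZ : dot g (triadLp u) Z ≠ 0) :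
    lMinus g (tri u 1) (c • u 0) (d • triadLp u) Z = d • triadLm u := by
  have hd0 : d ≠ 0 := fun h => by simp [h] at hd
  -- The sign of `𝓤` enters only through its square, and the term `u_1 ⊗ u_1` cancels that in `𝓖`.
  have hS : tri u 1 + tensor (c • u 0) (c • u 0) =
      -(tensor (triadLp u) (triadLm u) + tensor (triadLm u) (triadLp u)) := by
    rw [tensor_smul_smul, hc, one_smul, tri_one_eq]; abel
  have h1 : act g (tri u 1 + tensor (c • u 0) (c • u 0)) Z =
      -(dot g (triadLm u) Z • triadLp u + dot g (triadLp u) Z • triadLm u) := by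
    rw [hS, act_neg, act_add, act_tensor, act_tensor]
  have h2 : eval g (tri u 1 + tensor (c • u 0) (c • u 0)) Z Z =
      -2 * (dot g (triadLp u) Z * dot g (triadLm u) Z) := by
    rw [eval_eq_dot hs, h1]
    simp [dot_comm hs Z]; ring
  rw [lMinus, h1, h2, eval_smul_left, hu.eval_one_Lp hs]
  ext α β
  simp only [Pi.smul_apply, Pi.sub_apply, Pi.neg_apply, Pi.add_apply, smul_eq_mul]
  field_simp
  linear_combination (-dot g (triadLp u) Z * triadLm u α β) * hd

end

/-! ### Self-dual double bivectors of Weyl type -/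

section

variable {g : Matrix (Fin 4) (Fin 4) ℝ} {η : Fin 4 → Fin 4 → Fin 4 → Fin 4 → ℝ}
  {e : Fin 4 → Fin 4 → ℝ} {u : Fin 3 → Tensor2} {G W : Tensor4} {r : ℂ}

lemma IsOrientedOrthonormal.isTriad (hη : IsVolumeSymbol η)
    (he : IsOrientedOrthonormal g η e) : IsTriad g (triad g η e) := he.dot_triad hη

lemma IsOrientedOrthonormal.sdMetric_eq_tri (hs : g.IsSymm) (hη : IsVolumeSymbol η)
    (he : IsOrientedOrthonormal g η e) : sdMetric g η = tri (triad g η e) 1 := by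
  rw [tri_one, he.sdMetric_eq hs hη]

lemma IsWeylPrincipalFrame.isCanonical (hs : g.IsSymm) (hη : IsVolumeSymbol η)
    (h : IsWeylPrincipalFrame g η W e) :
    ∃ r, IsCanonical g (sdMetric g η) W (triad g η e) r := by
  obtain ⟨he, r, hW⟩ := h
  refine ⟨r, hs, he.isTriad hη, he.sdMetric_eq_tri hs hη, ?_⟩
  rw [hW, tri_canonII, ← he.sdMetric_eq_tri hs hη]
  rfl

lemma IsOrientedOrthonormal.isWeylPrincipalFrame (hs : g.IsSymm) (hη : IsVolumeSymbol η)
    (he : IsOrientedOrthonormal g η e) (hW : W = tri (triad g η e) (canonII r)) :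
    IsWeylPrincipalFrame g η W e := by
  refine ⟨he, r, ?_⟩
  rw [hW, tri_canonII, ← he.sdMetric_eq_tri hs hη]
  rfl

lemma comp_tensor (F K L N : Tensor2) :
    comp g (tensor F K) (tensor L N) = dot g K L • tensor F N := by
  ext α β μ ν
  rw [comp_apply]
  have h1 : tensor F K α β = F α β • K := rfl
  have h2 : (fun κ τ => tensor L N κ τ μ ν) = N μ ν • L := by
    ext κ τ; simp [tensor, mul_comm]
  rw [h1, h2]
  simp [tensor]; ring

lemma comp_smul_smul (c d : ℂ) (A B : Tensor4) :
    comp g (c • A) (d • B) = (c * d) • comp g A B := by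
  ext α β μ ν
  have h1 : (c • A) α β = c • A α β := rfl
  have h2 : (fun κ τ => (d • B) κ τ μ ν) = d • fun κ τ => B κ τ μ ν := rfl
  rw [comp_apply, h1, h2]
  simp only [comp_apply, map_smul, LinearMap.smul_apply, Pi.smul_apply, smul_eq_mul]
  ring

lemma eval_smul (hs : g.IsSymm) (c : ℂ) (A : Tensor4) (F K : Tensor2) :
    eval g (c • A) F K = c * eval g A F K := by
  rw [eval_eq_dot hs, eval_eq_dot hs, act_smul, map_smul, smul_eq_mul]

lemma eval_tensor (hs : g.IsSymm) (A B F K : Tensor2) :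
    eval g (tensor A B) F K = dot g A F * dot g B K := by
  rw [eval_eq_dot hs, act_tensor, map_smul, smul_eq_mul, dot_comm hs F A, mul_comm]

/-- Recovering `𝓤` up to sign from the concomitant `𝓟`. -/
lemma IsCanonical.recover_U (h : IsCanonical g G W u r) (hr : r ≠ 0) {Y : Tensor2} {s : ℂ}
    (hY : act g (Spacetime4.concP g G W) Y ≠ 0)
    (hsq : s ^ 2 = -eval g (comp g (Spacetime4.concP g G W) (Spacetime4.concP g G W)) Y Y) :
    s ≠ 0 ∧ ∃ c : ℂ, (c = 1 ∨ c = -1) ∧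
      (1 / s) • act g (Spacetime4.concP g G W) Y = c • u 0 := by
  obtain ⟨hs, hu, hG, hW⟩ := id h
  rw [h.concP] at hY hsq ⊢
  rw [act_smul, act_tensor, smul_smul] at hY ⊢
  have hd : dot g (u 0) Y ≠ 0 := fun h0 => hY (by simp [h0])
  rw [comp_smul_smul, comp_tensor, hu.dot_zero_zero, smul_smul, eval_smul hs,
    eval_tensor hs] at hsq
  -- Since `𝓟 = -9r² u_1 ⊗ u_1` and `(u_1, u_1) = -1`, the square is `𝓟² = -81r⁴ u_1 ⊗ u_1`; this
  -- explains the sign in the radicand and makes it a perfect square.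
  have hsq' : s ^ 2 = (9 * r ^ 2 * dot g (u 0) Y) ^ 2 := by rw [hsq]; ring
  have hne : 9 * r ^ 2 * dot g (u 0) Y ≠ 0 :=
    mul_ne_zero (mul_ne_zero (by norm_num) (pow_ne_zero 2 hr)) hd
  rcases sq_eq_sq_iff_eq_or_eq_neg.1 hsq' with hc | hc
  · have hs0 : s ≠ 0 := by rw [hc]; exact hne
    refine ⟨hs0, -1, Or.inr rfl, ?_⟩
    rw [smul_smul]; congr 1
    rw [mul_assoc, one_div, inv_mul_eq_iff_eq_mul₀ hs0, hc]; ring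
  · have hs0 : s ≠ 0 := by rw [hc]; exact neg_ne_zero.2 hne
    refine ⟨hs0, 1, Or.inl rfl, ?_⟩
    rw [smul_smul]; congr 1
    rw [mul_assoc, one_div, inv_mul_eq_iff_eq_mul₀ hs0, hc]; ring

/-- Recovering `𝓛₊` up to sign from the concomitant `𝓠`. -/
lemma IsCanonical.recover_Lp (h : IsCanonical g G W u r) (hr : r ≠ 0) {X : Tensor2} {t : ℂ}
    (hX : act g (Spacetime4.concQ g G W) X ≠ 0)
    (hsq : t ^ 2 = eval g (Spacetime4.concQ g G W) X X) :
    t ≠ 0 ∧ dot g (triadLp u) X ≠ 0 ∧ ∃ c : ℂ, (c = 1 ∨ c = -1) ∧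
      (1 / t) • act g (Spacetime4.concQ g G W) X = c • triadLp u := by
  obtain ⟨hs, hu, hG, hW⟩ := id h
  rw [h.concQ hr] at hX hsq ⊢
  rw [act_tensor] at hX ⊢
  have hd : dot g (triadLp u) X ≠ 0 := fun h0 => hX (by simp [h0])
  rw [eval_tensor hs, ← sq] at hsq
  rcases sq_eq_sq_iff_eq_or_eq_neg.1 hsq with hc | hc
  · have hs0 : t ≠ 0 := by rw [hc]; exact hd
    refine ⟨hs0, hd, 1, Or.inl rfl, ?_⟩
    rw [smul_smul, hc, one_div_mul_cancel hd]
  · have hs0 : t ≠ 0 := by rw [hc]; exact neg_ne_zero.2 hd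
    refine ⟨hs0, hd, -1, Or.inr rfl, ?_⟩
    rw [smul_smul, hc]; congr 1; field_simp

lemma sum_metric_raise (hg : IsUnit g.det) (F : Tensor2) (α β : Fin 4) :
    ∑ μ, ∑ ν, (g α μ : ℂ) * (g β ν : ℂ) * raise g F μ ν = F α β := by
  have hinv : ∀ α κ, ∑ μ, (g α μ : ℂ) * ((g⁻¹ μ κ : ℝ) : ℂ) = if α = κ then 1 else 0 := by
    intro α κ
    have := congrFun (congrFun (Matrix.mul_nonsing_inv g hg) α) κ
    rw [Matrix.mul_apply, Matrix.one_apply] at this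
    have h2 := congrArg (fun x : ℝ => (x : ℂ)) this
    push_cast at h2
    rw [h2]; split_ifs <;> simp
  have h : ∀ μ ν, (g α μ : ℂ) * (g β ν : ℂ) * raise g F μ ν = ∑ κ, ∑ τ,
      ((g α μ : ℂ) * ((g⁻¹ μ κ : ℝ) : ℂ)) * (((g β ν : ℂ) * ((g⁻¹ ν τ : ℝ) : ℂ)) * F κ τ) := by
    intro μ ν
    rw [raise, Finset.mul_sum]
    refine Finset.sum_congr rfl fun κ _ => ?_
    rw [Finset.mul_sum]
    exact Finset.sum_congr rfl fun τ _ => by ring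
  have h2 : ∀ μ, ∑ ν, (g α μ : ℂ) * (g β ν : ℂ) * raise g F μ ν =
      ∑ κ, ((g α μ : ℂ) * ((g⁻¹ μ κ : ℝ) : ℂ)) * F κ β := by
    intro μ
    rw [Finset.sum_congr rfl fun ν _ => h μ ν, Finset.sum_comm]
    refine Finset.sum_congr rfl fun κ _ => ?_
    rw [Finset.sum_comm]
    simp only [← Finset.mul_sum, ← Finset.sum_mul, hinv, ite_mul, one_mul, zero_mul,
      Finset.sum_ite_eq, Finset.mem_univ, if_true]
  rw [Finset.sum_congr rfl fun μ _ => h2 μ, Finset.sum_comm]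
  simp only [← Finset.sum_mul, hinv, ite_mul, one_mul, zero_mul, Finset.sum_ite_eq,
    Finset.mem_univ, if_true]

/-- Stated for a general `c` because `c = -i` gives the self-dual and `c = i` the anti-self-dual
projection. -/
lemma act_metric_add (hg : IsUnit g.det) {F : Tensor2} (hF : IsBivector F) (c : ℂ) :
    act g (fun α β μ ν => (1 / 2) * (((g α μ * g β ν - g α ν * g β μ : ℝ) : ℂ)
      + c * (η α β μ ν : ℂ))) F = (1 / 2 : ℂ) • (F + c • hodge g η F) := by
  ext α β
  have h1 := sum_metric_raise hg F α β
  have h2 := sum_metric_raise hg F β α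
  rw [Finset.sum_comm, hF β α] at h2
  simp only [act, hodge, Pi.smul_apply, Pi.add_apply, smul_eq_mul]
  have h3 : ∑ μ, ∑ ν, (1 / 2 : ℂ) * (((g α μ * g β ν - g α ν * g β μ : ℝ) : ℂ)
      + c * (η α β μ ν : ℂ)) * raise g F μ ν =
      1 / 2 * (∑ μ, ∑ ν, (g α μ : ℂ) * (g β ν : ℂ) * raise g F μ ν
      - ∑ μ, ∑ ν, (g β μ : ℂ) * (g α ν : ℂ) * raise g F μ ν
      + c * ∑ μ, ∑ ν, (η α β μ ν : ℂ) * raise g F μ ν) := by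
    simp only [Finset.mul_sum, ← Finset.sum_sub_distrib, ← Finset.sum_add_distrib]
    push_cast
    exact Finset.sum_congr rfl fun _ _ => Finset.sum_congr rfl fun _ _ => by ring
  rw [Finset.sum_comm] at h2
  rw [h3, h1, h2]
  ring

lemma act_sdMetric (hg : IsUnit g.det) {F : Tensor2} (hF : IsBivector F) :
    act g (sdMetric g η) F = (1 / 2 : ℂ) • (F - Complex.I • hodge g η F) := by
  have := act_metric_add (η := η) hg hF (-Complex.I)
  simp only [neg_mul, ← sub_eq_add_neg, neg_smul] at this
  exact this

/-- The complex conjugate of a bivector. -/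
def conj2 (F : Tensor2) : Tensor2 := fun α β => (starRingEnd ℂ) (F α β)

/-- A bivector is the sum of its self-dual and anti-self-dual parts. The projectors are `𝓖` and its
complex conjugate, so the expansion of the second follows by conjugating that of the first, `g` and
`η` being real. -/
lemma IsOrientedOrthonormal.completeness (hs : g.IsSymm) (hη : IsVolumeSymbol η)
    (he : IsOrientedOrthonormal g η e) {F : Tensor2} (hF : IsBivector F) :
    F = -∑ i, dot g (triad g η e i) F • triad g η e i
      - ∑ i, dot g (conj2 (triad g η e i)) F • conj2 (triad g η e i) := by
  have hg := he.orthonormal.isUnit_det_metric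
  have h1 := act_sdMetric (η := η) hg hF
  have h2 := act_metric_add (η := η) hg hF Complex.I
  have h3 : (fun α β μ ν => (1 / 2 : ℂ) * (((g α μ * g β ν - g α ν * g β μ : ℝ) : ℂ)
      + Complex.I * (η α β μ ν : ℂ))) =
      -∑ i, tensor (conj2 (triad g η e i)) (conj2 (triad g η e i)) := by
    ext α β μ ν
    have := congrArg (starRingEnd ℂ) (congrFun (congrFun (congrFun (congrFun
      (he.sdMetric_eq hs hη) α) β) μ) ν)
    simp only [sdMetric, map_mul, map_sub, Complex.conj_I, Complex.conj_ofReal, map_div₀, map_one,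
      Complex.conj_ofNat, Pi.neg_apply, Finset.sum_apply, map_neg, map_sum, tensor] at this
    simp only [Pi.neg_apply, Finset.sum_apply, tensor, conj2, ← this]
    ring
  rw [h3, act_neg, act_sum] at h2
  rw [he.sdMetric_eq hs hη, act_neg, act_sum] at h1
  simp only [act_tensor] at h1 h2
  rw [h1, sub_eq_add_neg, h2, ← smul_add]
  ext α β
  simp only [Pi.smul_apply, Pi.add_apply, Pi.sub_apply, smul_eq_mul]
  ring

/-- The algebraic properties of a Weyl tensor. -/
structure IsWeylLike (g : Matrix (Fin 4) (Fin 4) ℝ) (w : Fin 4 → Fin 4 → Fin 4 → Fin 4 → ℝ) :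
    Prop where
  anti : ∀ α β μ ν, w α β μ ν = -w β α μ ν
  pair : ∀ α β μ ν, w α β μ ν = w μ ν α β
  traceless : ∀ β ν, ∑ α, ∑ μ, g⁻¹ α μ * w α β μ ν = 0

/-- A real four-index tensor as a complex one. -/
def ofRealT (w : Fin 4 → Fin 4 → Fin 4 → Fin 4 → ℝ) : Tensor4 := fun α β μ ν => (w α β μ ν : ℂ)

lemma sum_anti (H x : Fin 4 → Fin 4 → ℝ) (hH : ∀ α β, H α β = -H β α) :
    ∑ α, ∑ β, H α β * (x α β - x β α) = 2 * ∑ α, ∑ β, H α β * x α β := by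
  have : ∑ α, ∑ β, H α β * x β α = -∑ α, ∑ β, H α β * x α β := by
    rw [Finset.sum_comm, ← Finset.sum_neg_distrib]
    refine Finset.sum_congr rfl fun α _ => ?_
    rw [← Finset.sum_neg_distrib]
    exact Finset.sum_congr rfl fun β _ => by rw [hH α β]; ring
  simp only [mul_sub, Finset.sum_sub_distrib, this]
  ring

/-- The components of a real four-index tensor in a frame. -/
def frameComp (e : Fin 4 → Fin 4 → ℝ) (w : Fin 4 → Fin 4 → Fin 4 → Fin 4 → ℝ)
    (a b c d : Fin 4) : ℝ :=
  ∑ α, ∑ β, (∑ μ, ∑ ν, w α β μ ν * (e c μ * e d ν)) * (e a α * e b β)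

variable {w : Fin 4 → Fin 4 → Fin 4 → Fin 4 → ℝ}

lemma IsWeylLike.eval_wedge (hw : IsWeylLike g w) (he : IsOrthonormal g e) (a b c d : Fin 4) :
    eval g (ofRealT w) (wedge g (e a) (e b)) (wedge g (e c) (e d)) =
      (frameComp e w a b c d : ℂ) := by
  have hanti2 : ∀ α β μ ν, w α β μ ν = -w α β ν μ := fun α β μ ν => by
    rw [hw.pair, hw.anti, hw.pair]
  have h1 : ∀ α β, ∑ μ, ∑ ν, w α β μ ν * (e c μ * e d ν - e c ν * e d μ) =
      2 * ∑ μ, ∑ ν, w α β μ ν * (e c μ * e d ν) := fun α β =>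
    sum_anti _ (fun μ ν => e c μ * e d ν) (hanti2 α β)
  have h2 := sum_anti (fun α β => ∑ μ, ∑ ν, w α β μ ν * (e c μ * e d ν))
    (fun α β => e a α * e b β) (fun α β => by
      simp only [← Finset.sum_neg_distrib]
      exact Finset.sum_congr rfl fun _ _ => Finset.sum_congr rfl fun _ _ => by
        rw [hw.anti]; ring)
  rw [frameComp, eval]
  simp only [he.raise_wedge, ofRealT]
  have h3 : ∑ α, ∑ β, ∑ μ, ∑ ν, w α β μ ν * (e a α * e b β - e b α * e a β)
      * (e c μ * e d ν - e d μ * e c ν) =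
      4 * ∑ α, ∑ β, (∑ μ, ∑ ν, w α β μ ν * (e c μ * e d ν)) * (e a α * e b β) := by
    rw [show (4 : ℝ) = 2 * 2 by norm_num, mul_assoc, ← h2, Finset.mul_sum]
    refine Finset.sum_congr rfl fun α _ => ?_
    rw [Finset.mul_sum]
    refine Finset.sum_congr rfl fun β _ => ?_
    rw [← mul_assoc, ← h1, Finset.sum_mul]
    refine Finset.sum_congr rfl fun μ _ => ?_
    rw [Finset.sum_mul]
    exact Finset.sum_congr rfl fun ν _ => by ring
  have h4 := congrArg (fun x : ℝ => (x : ℂ)) h3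
  push_cast at h4 ⊢
  rw [h4]; ring

lemma IsWeylLike.frameComp_anti (hw : IsWeylLike g w) (a b c d : Fin 4) :
    frameComp e w a b c d = -frameComp e w b a c d := by
  rw [frameComp, frameComp, Finset.sum_comm, ← Finset.sum_neg_distrib]
  refine Finset.sum_congr rfl fun β _ => ?_
  rw [← Finset.sum_neg_distrib]
  refine Finset.sum_congr rfl fun α _ => ?_
  simp only [Finset.sum_mul, ← Finset.sum_neg_distrib]
  exact Finset.sum_congr rfl fun _ _ => Finset.sum_congr rfl fun _ _ => by
    rw [hw.anti]; ring

lemma IsWeylLike.eval_comm (hw : IsWeylLike g w) (F K : Tensor2) :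
    eval g (ofRealT w) F K = eval g (ofRealT w) K F := by
  have h3 : ∀ G : Fin 4 → Fin 4 → Fin 4 → ℂ,
      ∑ μ, ∑ ν, ∑ α, G μ ν α = ∑ α, ∑ μ, ∑ ν, G μ ν α := fun G => by
    rw [Finset.sum_congr rfl fun μ _ => Finset.sum_comm, Finset.sum_comm]
  rw [eval, eval, h3]
  rw [Finset.sum_congr rfl fun α _ => h3 _]
  congr 1
  refine Finset.sum_congr rfl fun _ _ => Finset.sum_congr rfl fun _ _ =>
    Finset.sum_congr rfl fun _ _ => Finset.sum_congr rfl fun _ _ => ?_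
  rw [ofRealT, ofRealT, hw.pair]; ring

lemma IsWeylLike.frameComp_pair (hw : IsWeylLike g w) (he : IsOrthonormal g e)
    (a b c d : Fin 4) : frameComp e w a b c d = frameComp e w c d a b := by
  have h := hw.eval_comm (wedge g (e a) (e b)) (wedge g (e c) (e d))
  rw [hw.eval_wedge he, hw.eval_wedge he] at h
  exact_mod_cast h

lemma IsWeylLike.frameComp_traceless (hw : IsWeylLike g w) (he : IsOrthonormal g e)
    (b d : Fin 4) : ∑ a, sg a * frameComp e w a b a d = 0 := by
  have h : ∑ a, sg a * frameComp e w a b a d =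
      ∑ β, ∑ ν, (∑ α, ∑ μ, g⁻¹ α μ * w α β μ ν) * (e b β * e d ν) := by
    simp only [frameComp, he.inv_metric_apply, Finset.sum_mul, Finset.mul_sum]
    rw [Finset.sum_comm]
    conv_rhs => rw [Finset.sum_congr rfl fun _ _ => Finset.sum_comm, Finset.sum_comm]
    refine Finset.sum_congr rfl fun α _ => ?_
    rw [Finset.sum_comm]
    refine Finset.sum_congr rfl fun β _ => ?_
    rw [Finset.sum_comm]
    conv_rhs => rw [Finset.sum_comm]
    refine Finset.sum_congr rfl fun μ _ => ?_
    rw [Finset.sum_comm]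
    exact Finset.sum_congr rfl fun ν _ => Finset.sum_congr rfl fun a _ => by ring
  rw [h]
  simp [hw.traceless]

lemma conj2_selfDualWedge (a b c : Fin 4) : conj2 (selfDualWedge g e a b c) =
    isq • (wedge g (e 0) (e a) + Complex.I • wedge g (e b) (e c)) := by
  ext α β
  simp only [conj2, selfDualWedge, Pi.smul_apply, Pi.sub_apply, Pi.add_apply, smul_eq_mul,
    map_mul, map_sub, conj_isq, Complex.conj_I, wedge_apply, Complex.conj_ofReal]
  ring

lemma act_add_right (A : Tensor4) (F K : Tensor2) : act g A (F + K) = act g A F + act g A K := by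
  ext α β; simp [act_apply]

lemma act_smul_right (c : ℂ) (A : Tensor4) (F : Tensor2) : act g A (c • F) = c • act g A F := by
  ext α β; simp [act_apply]

/-- The expansion of `w(ū, u')` has the real part `(w_{0a0a'} + w_{bcb'c'}) / 2` and the imaginary
part `(w_{bc0a'} - w_{0ab'c'}) / 2`; the two hypotheses say that these vanish. -/
lemma IsWeylLike.eval_conj_selfDualWedge (hs : g.IsSymm) (hw : IsWeylLike g w)
    (he : IsOrthonormal g e) (a b c a' b' c' : Fin 4)
    (h1 : frameComp e w 0 a 0 a' + frameComp e w b c b' c' = 0)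
    (h2 : frameComp e w b c 0 a' = frameComp e w 0 a b' c') :
    eval g (ofRealT w) (conj2 (selfDualWedge g e a b c)) (selfDualWedge g e a' b' c') = 0 := by
  have hB : ∀ p q p' q', dot g (wedge g (e p) (e q)) (act g (ofRealT w)
      (wedge g (e p') (e q'))) = (frameComp e w p q p' q' : ℂ) := fun p q p' q' => by
    rw [← eval_eq_dot hs, hw.eval_wedge he]
  rw [eval_eq_dot hs, conj2_selfDualWedge, selfDualWedge, sub_eq_add_neg, ← neg_smul]
  simp only [act_add_right, act_smul_right, map_smul, map_add, LinearMap.smul_apply,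
    LinearMap.add_apply, hB, smul_eq_mul]
  have h1' : (frameComp e w 0 a 0 a' : ℂ) + frameComp e w b c b' c' = 0 := by exact_mod_cast h1
  have h2' : (frameComp e w b c 0 a' : ℂ) = frameComp e w 0 a b' c' := by exact_mod_cast h2
  linear_combination (isq * isq) * h1' + (isq * isq * Complex.I) * h2'
    - (isq * isq * frameComp e w b c b' c') * Complex.I_mul_I

/-- The mixed block of a curvature-type tensor between self-dual and anti-self-dual bivectors
carries exactly its trace-free Ricci part, so vanishing of the trace suffices. The first Bianchi
identity is not needed: it would only constrain the trace of the self-dual block. -/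
lemma IsWeylLike.eval_conj_triad (hs : g.IsSymm) (hη : IsVolumeSymbol η) (hw : IsWeylLike g w)
    (he : IsOrientedOrthonormal g η e) (i j : Fin 3) :
    eval g (ofRealT w) (conj2 (triad g η e i)) (triad g η e j) = 0 := by
  have he' := he.orthonormal
  have anti := hw.frameComp_anti (e := e)
  have pair := hw.frameComp_pair he'
  have diag : ∀ a c d, frameComp e w a a c d = 0 := fun a c d => by
    have := anti a a c d; linarith
  have diag' : ∀ a c d, frameComp e w c d a a = 0 := fun a c d => by rw [pair, diag]
  have anti' : ∀ a b c d, frameComp e w a b c d = -frameComp e w a b d c := fun a b c d => by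
    rw [pair, anti, pair]
  have tr : ∀ b d, -frameComp e w 0 b 0 d + frameComp e w 1 b 1 d + frameComp e w 2 b 2 d
      + frameComp e w 3 b 3 d = 0 := fun b d => by
    have := hw.frameComp_traceless he' b d
    simpa [Fin.sum_univ_four, sg] using this
  have t00 := tr 0 0
  have t01 := tr 0 1
  have t02 := tr 0 2
  have t03 := tr 0 3
  have t11 := tr 1 1
  have t12 := tr 1 2
  have t13 := tr 1 3
  have t22 := tr 2 2
  have t23 := tr 2 3
  have t33 := tr 3 3
  -- a normal form of the components with respect to the symmetries
  have n20 : ∀ c d, frameComp e w 2 0 c d = -frameComp e w 0 2 c d := fun c d => anti _ _ _ _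
  have n10 : ∀ c d, frameComp e w 1 0 c d = -frameComp e w 0 1 c d := fun c d => anti _ _ _ _
  have n30 : ∀ c d, frameComp e w 3 0 c d = -frameComp e w 0 3 c d := fun c d => anti _ _ _ _
  have n21 : ∀ c d, frameComp e w 2 1 c d = -frameComp e w 1 2 c d := fun c d => anti _ _ _ _
  have n13 : ∀ c d, frameComp e w 1 3 c d = -frameComp e w 3 1 c d := fun c d => anti _ _ _ _
  have n32 : ∀ c d, frameComp e w 3 2 c d = -frameComp e w 2 3 c d := fun c d => anti _ _ _ _
  have m20 : ∀ c d, frameComp e w c d 2 0 = -frameComp e w c d 0 2 := fun c d => anti' _ _ _ _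
  have m10 : ∀ c d, frameComp e w c d 1 0 = -frameComp e w c d 0 1 := fun c d => anti' _ _ _ _
  have m30 : ∀ c d, frameComp e w c d 3 0 = -frameComp e w c d 0 3 := fun c d => anti' _ _ _ _
  have m21 : ∀ c d, frameComp e w c d 2 1 = -frameComp e w c d 1 2 := fun c d => anti' _ _ _ _
  have m13 : ∀ c d, frameComp e w c d 1 3 = -frameComp e w c d 3 1 := fun c d => anti' _ _ _ _
  have m32 : ∀ c d, frameComp e w c d 3 2 = -frameComp e w c d 2 3 := fun c d => anti' _ _ _ _
  have p1 := pair 0 2 0 1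
  have p2 := pair 0 3 0 1
  have p3 := pair 0 3 0 2
  have p4 := pair 3 1 2 3
  have p5 := pair 1 2 2 3
  have p6 := pair 1 2 3 1
  have q2 : ∀ a, frameComp e w 2 3 0 a = frameComp e w 0 a 2 3 := fun a => pair _ _ _ _
  have q3 : ∀ a, frameComp e w 3 1 0 a = frameComp e w 0 a 3 1 := fun a => pair _ _ _ _
  have q4 : ∀ a, frameComp e w 1 2 0 a = frameComp e w 0 a 1 2 := fun a => pair _ _ _ _
  simp only [n20, n10, n30, n21, n13, n32, m20, m10, m30, m21, m13, m32, diag, diag',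
    neg_neg, neg_zero, add_zero, zero_add]
    at t00 t01 t02 t03 t11 t12 t13 t22 t23 t33
  -- In each of the nine cases the two conditions are linear combinations of the ten trace equations
  -- and the symmetries.
  fin_cases i <;> fin_cases j <;>
    simp only [Fin.zero_eta, Fin.mk_one, Fin.reduceFinMk, he.triad_zero hη, he.triad_one hη,
      he.triad_two hη] <;>
    apply hw.eval_conj_selfDualWedge hs he' <;>
    first | linarith | (simp only [q2, q3, q4] <;> linarith)

/-- The self-dual part of a tensor of Weyl type is a symmetric form in any self-dual triad. -/
lemma IsWeylLike.exists_tri (hs : g.IsSymm) (hη : IsVolumeSymbol η) (hw : IsWeylLike g w)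
    (he : IsOrientedOrthonormal g η e) :
    ∃ A : Matrix (Fin 3) (Fin 3) ℂ, A.IsSymm ∧
      (fun α β μ ν => (1 / 2 : ℂ) * ((w α β μ ν : ℂ)
        - Complex.I * hodge g η (fun l r => (w l r μ ν : ℂ)) α β)) = tri (triad g η e) A := by
  set u := triad g η e with hu
  refine ⟨fun i j => -eval g (ofRealT w) (u i) (u j), ?_, ?_⟩
  · ext i j
    simp [Matrix.transpose, hw.eval_comm (u i) (u j)]
  · have hg := he.orthonormal.isUnit_det_metric
    have hpair : ∀ μ ν, (fun l r => (w l r μ ν : ℂ)) = ofRealT w μ ν := fun μ ν => by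
      ext l r; rw [ofRealT, hw.pair]
    have hb : ∀ i, IsBivector (act g (ofRealT w) (u i)) := fun i α β => by
      have : ofRealT w α β = -ofRealT w β α := by
        ext μ ν; simp only [ofRealT, Pi.neg_apply]; rw [hw.anti]; push_cast; rfl
      rw [act_apply, act_apply, this, map_neg, LinearMap.neg_apply]
    have hexp : ∀ i, act g (ofRealT w) (u i) = -∑ j, eval g (ofRealT w) (u i) (u j) • u j := by
      intro i
      -- The anti-self-dual terms vanish, so `w(u_i)` lies in the span of the triad; its
      -- coefficients form the matrix sought.
      have h := he.completeness hs hη (hb i)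
      have h0 : ∀ j, dot g (conj2 (triad g η e j)) (act g (ofRealT w) (u i)) = 0 := fun j => by
        rw [← eval_eq_dot hs, hw.eval_conj_triad hs hη he]
      simp only [h0, zero_smul, Finset.sum_const_zero, sub_zero] at h
      rw [h]; congr 1
      refine Finset.sum_congr rfl fun j _ => ?_
      rw [← hu, ← eval_eq_dot hs, hw.eval_comm]
    ext α β μ ν
    have hF : IsBivector (fun l r => (w l r μ ν : ℂ)) := fun α β => by
      simp only; rw [hw.anti]; push_cast; rfl
    have h1 := act_sdMetric (η := η) hg hF
    rw [he.sdMetric_eq hs hη, act_neg, act_sum] at h1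
    have h2 := congrFun (congrFun h1 α) β
    simp only [Pi.smul_apply, Pi.sub_apply, smul_eq_mul] at h2
    rw [← h2]
    simp only [act_tensor, hpair, Pi.neg_apply, Finset.sum_apply, Pi.smul_apply, smul_eq_mul,
      tri, tensor, ← hu]
    congr 1
    refine Finset.sum_congr rfl fun i _ => ?_
    rw [dot_comm hs, ← act_apply, hexp i]
    simp only [Pi.neg_apply, Finset.sum_apply, Pi.smul_apply, smul_eq_mul, neg_mul,
      Finset.sum_mul, ← Finset.sum_neg_distrib]
    exact Finset.sum_congr rfl fun j _ => by ring

end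

/-! ### Lorentz transformations of a frame and of its self-dual triad -/

section

variable {g : Matrix (Fin 4) (Fin 4) ℝ} {η : Fin 4 → Fin 4 → Fin 4 → Fin 4 → ℝ}
  {e : Fin 4 → Fin 4 → ℝ} {u : Fin 3 → Tensor2} {G W : Tensor4} {r : ℂ}

/-- The frame with vectors `Λ_a^b e_b`. -/
def mulFrame (Λ : Matrix (Fin 4) (Fin 4) ℝ) (e : Fin 4 → Fin 4 → ℝ) (a μ : Fin 4) : ℝ :=
  ∑ b, Λ a b * e b μ

lemma lower_mulFrame (Λ : Matrix (Fin 4) (Fin 4) ℝ) (a μ : Fin 4) :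
    lower g (mulFrame Λ e) a μ = ∑ b, Λ a b * lower g e b μ := by
  simp only [lower, Matrix.mulVec, dotProduct, mulFrame, Finset.mul_sum]
  rw [Finset.sum_comm]
  exact Finset.sum_congr rfl fun _ _ => Finset.sum_congr rfl fun _ _ => by ring

/-- `selfDualWedge` without its normalization. -/
def rawWedge (g : Matrix (Fin 4) (Fin 4) ℝ) (e : Fin 4 → Fin 4 → ℝ) (a b c : Fin 4) : Tensor2 :=
  wedge g (e 0) (e a) - Complex.I • wedge g (e b) (e c)

lemma selfDualWedge_eq (a b c : Fin 4) :
    selfDualWedge g e a b c = isq • rawWedge g e a b c := rfl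

lemma rawWedge_apply (a b c α β : Fin 4) : rawWedge g e a b c α β =
    ((lower g e 0 α * lower g e a β - lower g e 0 β * lower g e a α : ℝ) : ℂ)
    - Complex.I * ((lower g e b α * lower g e c β - lower g e b β * lower g e c α : ℝ) : ℂ) := rfl

lemma mul_sgn_mul_transpose {Λ : Matrix (Fin 4) (Fin 4) ℝ}
    (h : ∀ a b, -(Λ a 0 * Λ b 0) + Λ a 1 * Λ b 1 + Λ a 2 * Λ b 2 + Λ a 3 * Λ b 3 =
      signature a b) : Λ * sgn * Λ.transpose = sgn := by
  ext a b
  rw [sgn, Matrix.of_apply, ← h]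
  simp only [Matrix.mul_apply, Matrix.of_apply, Matrix.transpose_apply, signature,
    Fin.sum_univ_four]
  simp

/-- A spatial rotation. -/
def rotation (R : Matrix (Fin 3) (Fin 3) ℝ) : Matrix (Fin 4) (Fin 4) ℝ :=
  !![1, 0, 0, 0; 0, R 0 0, R 0 1, R 0 2; 0, R 1 0, R 1 1, R 1 2; 0, R 2 0, R 2 1, R 2 2]

/-- The electric parts `e_0 ∧ e_A` transform by `R` and the magnetic parts `e_B ∧ e_C` by the
cofactors of `R`. These agree for `R` in `SO(3)`, hence the complex triad also transforms by `R`. -/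
lemma IsOrientedOrthonormal.rotate (hη : IsVolumeSymbol η)
    (he : IsOrientedOrthonormal g η e) {R : Matrix (Fin 3) (Fin 3) ℝ}
    (hR : R * R.transpose = 1) (hd : R.det = 1) :
    IsOrientedOrthonormal g η (mulFrame (rotation R) e) ∧
      ∀ i, triad g η (mulFrame (rotation R) e) i = ∑ j, (R i j : ℂ) • triad g η e j := by
  have h1 : rotation R * sgn * (rotation R).transpose = sgn := by
    have h := fun i j => congrFun (congrFun hR i) j
    simp only [Matrix.mul_apply, Matrix.transpose_apply, Fin.sum_univ_three] at h
    refine mul_sgn_mul_transpose fun a b => ?_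
    fin_cases a <;> fin_cases b <;> simp [rotation, signature, h]
  have h2 : (rotation R).det = 1 := by
    rw [← hd, Matrix.det_fin_three]
    simp [rotation, Matrix.det_succ_row_zero, Fin.sum_univ_succ, Fin.succAbove]
    ring
  have he' : IsOrientedOrthonormal g η (mulFrame (rotation R) e) := he.transform hη _ h1 h2
  refine ⟨he', ?_⟩
  -- The entries of this equality are the 2×2 minors that appear in the rotated `e_B ∧ e_C`.
  have hadj : R.adjugate = R.transpose := by
    have h3 : R * R.adjugate = 1 := by rw [Matrix.mul_adjugate, hd, one_smul]
    calc R.adjugate = (R.transpose * R) * R.adjugate := by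
          rw [mul_eq_one_comm.1 hR, one_mul]
      _ = R.transpose := by rw [mul_assoc, h3, mul_one]
  have hc := fun i j => congrArg (fun x : ℝ => (x : ℂ)) (congrFun (congrFun hadj j) i)
  rw [Matrix.adjugate_fin_three] at hc
  have h0 := hc 0
  have h1 := hc 1
  have h2 := hc 2
  simp only [Fin.forall_fin_succ, Matrix.of_apply, Matrix.transpose_apply] at h0 h1 h2
  simp at h0 h1 h2
  obtain ⟨h00, h01, h02⟩ := h0
  obtain ⟨h10, h11, h12⟩ := h1
  obtain ⟨h20, h21, h22⟩ := h2
  have hl : ∀ a μ, lower g (mulFrame (rotation R) e) a μ =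
    ∑ b, rotation R a b * lower g e b μ := lower_mulFrame _
  have key : ∀ i : Fin 3, ∀ a b c : Fin 4, triad g η (mulFrame (rotation R) e) i
      = selfDualWedge g (mulFrame (rotation R) e) a b c →
      rawWedge g (mulFrame (rotation R) e) a b c = (R i 0 : ℂ) • rawWedge g e 1 2 3
      + (R i 1 : ℂ) • rawWedge g e 2 3 1 + (R i 2 : ℂ) • rawWedge g e 3 1 2 →
      triad g η (mulFrame (rotation R) e) i = ∑ j, (R i j : ℂ) • triad g η e j := by
    intro i a b c h1 h2
    rw [h1, selfDualWedge_eq, h2, Fin.sum_univ_three, he.triad_zero hη, he.triad_one hη,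
      he.triad_two hη, selfDualWedge_eq, selfDualWedge_eq, selfDualWedge_eq]
    simp only [smul_add, smul_comm isq]
  intro i
  fin_cases i
  · refine key 0 1 2 3 (he'.triad_zero hη) ?_
    ext α β
    simp only [rawWedge_apply, Pi.add_apply, Pi.smul_apply, smul_eq_mul, hl, Fin.sum_univ_four]
    simp [rotation]
    linear_combination (-Complex.I) * (
      (lower g e 2 α * lower g e 3 β - lower g e 2 β * lower g e 3 α) * h00
      + (lower g e 3 α * lower g e 1 β - lower g e 3 β * lower g e 1 α) * h01
      + (lower g e 1 α * lower g e 2 β - lower g e 1 β * lower g e 2 α) * h02)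
  · refine key 1 2 3 1 (he'.triad_one hη) ?_
    ext α β
    simp only [rawWedge_apply, Pi.add_apply, Pi.smul_apply, smul_eq_mul, hl, Fin.sum_univ_four]
    simp [rotation]
    linear_combination (-Complex.I) * (
      (lower g e 2 α * lower g e 3 β - lower g e 2 β * lower g e 3 α) * h10
      + (lower g e 3 α * lower g e 1 β - lower g e 3 β * lower g e 1 α) * h11
      + (lower g e 1 α * lower g e 2 β - lower g e 1 β * lower g e 2 α) * h12)
  · refine key 2 3 1 2 (he'.triad_two hη) ?_
    ext α β
    simp only [rawWedge_apply, Pi.add_apply, Pi.smul_apply, smul_eq_mul, hl, Fin.sum_univ_four]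
    simp [rotation]
    linear_combination (-Complex.I) * (
      (lower g e 2 α * lower g e 3 β - lower g e 2 β * lower g e 3 α) * h20
      + (lower g e 3 α * lower g e 1 β - lower g e 3 β * lower g e 1 α) * h21
      + (lower g e 1 α * lower g e 2 β - lower g e 1 β * lower g e 2 α) * h22)

lemma IsOrientedOrthonormal.triadLp_eq (hη : IsVolumeSymbol η)
    (he : IsOrientedOrthonormal g η e) : triadLp (triad g η e) =
      (1 / 2 : ℂ) • (rawWedge g e 2 3 1 + Complex.I • rawWedge g e 3 1 2) := by
  rw [triadLp, he.triad_one hη, he.triad_two hη, selfDualWedge_eq, selfDualWedge_eq, ← isq_sq,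
    smul_comm Complex.I, ← smul_add, smul_smul]

/-- The null rotation with parameter `x + i y` about `e_0 + e_1`. -/
def nullRotation (x y : ℝ) : Matrix (Fin 4) (Fin 4) ℝ :=
  !![1 + (x ^ 2 + y ^ 2) / 2, (x ^ 2 + y ^ 2) / 2, x, y;
    -((x ^ 2 + y ^ 2) / 2), 1 - (x ^ 2 + y ^ 2) / 2, -x, -y; x, x, 1, 0; y, y, 0, 1]

/-- These transformations fix `𝓛₊` and add an arbitrary multiple of it to `𝓤`, which is the freedom
needed to diagonalize away the `𝓤`–`𝓛₊` terms. -/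
lemma IsOrientedOrthonormal.null_rotate (hη : IsVolumeSymbol η)
    (he : IsOrientedOrthonormal g η e) (x y : ℝ) :
    IsOrientedOrthonormal g η (mulFrame (nullRotation x y) e) ∧
      triad g η (mulFrame (nullRotation x y) e) 0 = triad g η e 0
        + ((-x + Complex.I * y) * (2 * isq)) • triadLp (triad g η e) ∧
      triadLp (triad g η (mulFrame (nullRotation x y) e)) = triadLp (triad g η e) := by
  have h1 : nullRotation x y * sgn * (nullRotation x y).transpose = sgn := by
    refine mul_sgn_mul_transpose fun a b => ?_
    fin_cases a <;> fin_cases b <;> simp [nullRotation, signature] <;> ring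
  have h2 : (nullRotation x y).det = 1 := by
    simp [nullRotation, Matrix.det_succ_row_zero, Fin.sum_univ_succ, Fin.succAbove]
    ring
  have he' : IsOrientedOrthonormal g η (mulFrame (nullRotation x y) e) := he.transform hη _ h1 h2
  have hl : ∀ a μ, lower g (mulFrame (nullRotation x y) e) a μ =
    ∑ b, nullRotation x y a b * lower g e b μ := lower_mulFrame _
  refine ⟨he', ?_, ?_⟩
  · have key : rawWedge g (mulFrame (nullRotation x y) e) 1 2 3 = rawWedge g e 1 2 3
        + (-x + Complex.I * y : ℂ) • (rawWedge g e 2 3 1 + Complex.I • rawWedge g e 3 1 2) := by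
      ext α β
      simp only [rawWedge_apply, Pi.add_apply, Pi.smul_apply, smul_eq_mul, hl, Fin.sum_univ_four]
      apply Complex.ext <;> simp [nullRotation] <;> ring
    rw [he.triadLp_eq hη, IsOrientedOrthonormal.triad_zero hη he', he.triad_zero hη,
      selfDualWedge_eq, selfDualWedge_eq, key, smul_add, smul_smul, smul_smul]
    congr 2; ring
  · rw [he.triadLp_eq hη, IsOrientedOrthonormal.triadLp_eq hη he']
    congr 1
    ext α β
    simp only [rawWedge_apply, Pi.add_apply, Pi.smul_apply, smul_eq_mul, hl, Fin.sum_univ_four]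
    apply Complex.ext <;> simp [nullRotation] <;> ring

/-- The boost with factor `k` in the plane of `e_0`, `e_1`, together with the rotation with cosine
`c` and sine `s` in the plane of `e_2`, `e_3`. -/
def boostRotation (k c s : ℝ) : Matrix (Fin 4) (Fin 4) ℝ :=
  !![(k + k⁻¹) / 2, (k - k⁻¹) / 2, 0, 0; (k - k⁻¹) / 2, (k + k⁻¹) / 2, 0, 0;
    0, 0, c, -s; 0, 0, s, c]

/-- Keeping `𝓤`, a boost rescales `𝓛₊` and a rotation changes its phase; together they reach every
nonzero complex factor. -/
lemma IsOrientedOrthonormal.boost_rotate (hη : IsVolumeSymbol η)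
    (he : IsOrientedOrthonormal g η e) {k c s : ℝ} (hk : k ≠ 0) (hcs : c ^ 2 + s ^ 2 = 1) :
    IsOrientedOrthonormal g η (mulFrame (boostRotation k c s) e) ∧
      triad g η (mulFrame (boostRotation k c s) e) 0 = triad g η e 0 ∧
      triadLp (triad g η (mulFrame (boostRotation k c s) e)) =
        (k * (c + Complex.I * s) : ℂ) • triadLp (triad g η e) := by
  have hk' : k * k⁻¹ = 1 := mul_inv_cancel₀ hk
  have h1 : boostRotation k c s * sgn * (boostRotation k c s).transpose = sgn := by
    refine mul_sgn_mul_transpose fun a b => ?_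
    fin_cases a <;> fin_cases b <;> simp [boostRotation, signature] <;>
      first | linear_combination hk' | linear_combination -hk' | linear_combination hcs | ring
  have h2 : (boostRotation k c s).det = 1 := by
    simp [boostRotation, Matrix.det_succ_row_zero, Fin.sum_univ_succ, Fin.succAbove]
    linear_combination hcs + (c ^ 2 + s ^ 2) * hk'
  have he' : IsOrientedOrthonormal g η (mulFrame (boostRotation k c s) e) := he.transform hη _ h1 h2
  have hl : ∀ a μ, lower g (mulFrame (boostRotation k c s) e) a μ =
    ∑ b, boostRotation k c s a b * lower g e b μ := lower_mulFrame _
  refine ⟨he', ?_, ?_⟩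
  · rw [IsOrientedOrthonormal.triad_zero hη he', he.triad_zero hη, selfDualWedge_eq,
      selfDualWedge_eq]
    congr 1
    ext α β
    simp only [rawWedge_apply, hl, Fin.sum_univ_four]
    apply Complex.ext <;> simp [boostRotation]
    · linear_combination (lower g e 0 α * lower g e 1 β - lower g e 0 β * lower g e 1 α) * hk'
    · linear_combination
        (-(lower g e 2 α * lower g e 3 β - lower g e 2 β * lower g e 3 α)) * hcs
  · rw [he.triadLp_eq hη, IsOrientedOrthonormal.triadLp_eq hη he', smul_comm _ (1 / 2 : ℂ)]
    congr 1
    ext α β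
    simp only [rawWedge_apply, Pi.add_apply, Pi.smul_apply, smul_eq_mul, hl, Fin.sum_univ_four]
    apply Complex.ext <;> simp [boostRotation] <;> ring

/-- A double bivector is a bilinear form on the triad, so its matrix changes by congruence. For
orthogonal `O` this is also a similarity. -/
lemma tri_transform {u' : Fin 3 → Tensor2} (O B : Matrix (Fin 3) (Fin 3) ℂ)
    (h : ∀ i, u' i = ∑ j, O i j • u j) : tri u' B = tri u (O.transpose * B * O) := by
  ext α β μ ν
  simp only [tri, h, Fin.sum_univ_three, Matrix.mul_apply, Matrix.transpose_apply]
  simp only [Pi.neg_apply, Pi.add_apply, Pi.smul_apply, tensor, smul_eq_mul]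
  ring

end

/-! ### Existence of principal frames at a point -/

section

variable {g : Matrix (Fin 4) (Fin 4) ℝ} {η : Fin 4 → Fin 4 → Fin 4 → Fin 4 → ℝ}
  {e : Fin 4 → Fin 4 → ℝ} {u : Fin 3 → Tensor2} {G W : Tensor4} {r : ℂ}

/-- The real and imaginary parts `p`, `q` of a null vector are orthogonal and of equal length,
nonzero as `w ≠ 0`. After scaling by `k` they are the last two rows of a rotation whose first row is
their cross product. -/
lemma exists_rotation (w : Fin 3 → ℂ) (hw : w ≠ 0) (h : w 0 * w 0 + w 1 * w 1 + w 2 * w 2 = 0) :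
    ∃ (R : Matrix (Fin 3) (Fin 3) ℝ) (k : ℂ), R * R.transpose = 1 ∧ R.det = 1 ∧
      ∀ j, (R 1 j : ℂ) + Complex.I * (R 2 j : ℂ) = k * w j := by
  obtain ⟨p, hp⟩ : ∃ p : Fin 3 → ℝ, ∀ j, p j = (w j).re := ⟨_, fun _ => rfl⟩
  obtain ⟨q, hq⟩ : ∃ q : Fin 3 → ℝ, ∀ j, q j = (w j).im := ⟨_, fun _ => rfl⟩
  have hre := congrArg Complex.re h
  have him := congrArg Complex.im h
  simp only [Complex.add_re, Complex.mul_re, Complex.add_im, Complex.mul_im, ← hp, ← hq,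
    Complex.zero_re, Complex.zero_im] at hre him
  have hpos : 0 < p 0 ^ 2 + p 1 ^ 2 + p 2 ^ 2 := by
    by_contra hc
    have hp0 : p 0 = 0 ∧ p 1 = 0 ∧ p 2 = 0 := by
      refine ⟨?_, ?_, ?_⟩ <;> nlinarith [sq_nonneg (p 0), sq_nonneg (p 1), sq_nonneg (p 2)]
    obtain ⟨h0, h1, h2⟩ := hp0
    have hq0 : q 0 = 0 ∧ q 1 = 0 ∧ q 2 = 0 := by
      rw [h0, h1, h2] at hre
      refine ⟨?_, ?_, ?_⟩ <;> nlinarith [sq_nonneg (q 0), sq_nonneg (q 1), sq_nonneg (q 2)]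
    obtain ⟨h0', h1', h2'⟩ := hq0
    apply hw
    ext j
    fin_cases j <;> apply Complex.ext <;> simp [← hp, ← hq, h0, h1, h2, h0', h1', h2']
  obtain ⟨k, hk0, hk⟩ : ∃ k : ℝ, k ≠ 0 ∧ k ^ 2 * (p 0 ^ 2 + p 1 ^ 2 + p 2 ^ 2) = 1 := by
    refine ⟨(Real.sqrt (p 0 ^ 2 + p 1 ^ 2 + p 2 ^ 2))⁻¹,
      inv_ne_zero (Real.sqrt_pos.2 hpos).ne', ?_⟩
    rw [inv_pow, Real.sq_sqrt hpos.le, inv_mul_cancel₀ hpos.ne']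
  have hkq : k ^ 2 * (q 0 ^ 2 + q 1 ^ 2 + q 2 ^ 2) = 1 := by
    rw [← hk]; linear_combination (-k ^ 2) * hre
  have hpq : p 0 * q 0 + p 1 * q 1 + p 2 * q 2 = 0 := by linarith
  have hR : ∀ R : Matrix (Fin 3) (Fin 3) ℝ, R = !![k ^ 2 * (p 1 * q 2 - p 2 * q 1),
      k ^ 2 * (p 2 * q 0 - p 0 * q 2), k ^ 2 * (p 0 * q 1 - p 1 * q 0);
      k * p 0, k * p 1, k * p 2; k * q 0, k * q 1, k * q 2] → R.det = 1 := by
    rintro R rfl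
    rw [Matrix.det_fin_three]
    simp
    linear_combination k ^ 2 * (q 0 ^ 2 + q 1 ^ 2 + q 2 ^ 2) * hk + hkq
      - k ^ 4 * (p 0 * q 0 + p 1 * q 1 + p 2 * q 2) * hpq
  refine ⟨_, k, ?_, hR _ rfl, fun j => ?_⟩
  · have h00 : (k ^ 2 * (p 1 * q 2 - p 2 * q 1)) * (k ^ 2 * (p 1 * q 2 - p 2 * q 1))
        + (k ^ 2 * (p 2 * q 0 - p 0 * q 2)) * (k ^ 2 * (p 2 * q 0 - p 0 * q 2))
        + (k ^ 2 * (p 0 * q 1 - p 1 * q 0)) * (k ^ 2 * (p 0 * q 1 - p 1 * q 0)) = 1 := by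
      linear_combination k ^ 2 * (q 0 ^ 2 + q 1 ^ 2 + q 2 ^ 2) * hk + hkq
        - k ^ 4 * (p 0 * q 0 + p 1 * q 1 + p 2 * q 2) * hpq
    ext i j
    fin_cases i <;> fin_cases j <;>
      simp [Matrix.mul_apply, Fin.sum_univ_three] <;>
      first
        | ring1
        | linear_combination h00
        | linear_combination hk
        | linear_combination hkq
        | linear_combination k ^ 2 * hpq
  · fin_cases j <;> apply Complex.ext <;> simp [← hp, ← hq]

/-- The minimal polynomial may be tested on the matrix, because `tri` is an injective algebra
homomorphism. -/
lemma IsTypeII.matrix (hu : IsTriad g u) (hs : g.IsSymm) (A : Matrix (Fin 3) (Fin 3) ℂ) (r : ℂ) :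
    (comp g (comp g (tri u A - r • tri u 1) (tri u A - r • tri u 1))
      (tri u A + (2 * r) • tri u 1) = 0 ↔
      (A - r • 1) * (A - r • 1) * (A + (2 * r) • 1) = 0) ∧
    (comp g (tri u A - r • tri u 1) (tri u A - r • tri u 1) = 0 ↔
      (A - r • 1) * (A - r • 1) = 0) ∧
    (comp g (tri u A - r • tri u 1) (tri u A + (2 * r) • tri u 1) = 0 ↔
      (A - r • 1) * (A + (2 * r) • 1) = 0) := by
  have h0 : tri u 0 = 0 := by simp [tri]
  have hi : ∀ B, tri u B = 0 ↔ B = 0 := fun B => by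
    rw [← h0]; exact (tri_injective hs hu).eq_iff
  simp only [← tri_smul, ← tri_sub, ← tri_add, comp_tri hu, hi, and_self]

/-- Let `N = A - r`. A nonzero vector `w = N (A + 2r) v` is killed by `N` and lies in the image of
`N`. As `N` is symmetric for the complex bilinear product, kernel and image are orthogonal, so `w`
is null. -/
lemma exists_null_vector {A : Matrix (Fin 3) (Fin 3) ℂ} (hA : A.IsSymm)
    (h1 : (A - r • 1) * (A - r • 1) * (A + (2 * r) • 1) = 0)
    (h3 : (A - r • 1) * (A + (2 * r) • 1) ≠ 0) :
    ∃ w : Fin 3 → ℂ, w ≠ 0 ∧ A.mulVec w = r • w ∧ w 0 * w 0 + w 1 * w 1 + w 2 * w 2 = 0 := by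
  set N := A - r • (1 : Matrix (Fin 3) (Fin 3) ℂ) with hN
  have hNs : N.transpose = N := by
    rw [hN, Matrix.transpose_sub, hA.eq, Matrix.transpose_smul, Matrix.transpose_one]
  obtain ⟨v, hv⟩ : ∃ v, (N * (A + (2 * r) • 1)).mulVec v ≠ 0 := by
    by_contra! hc
    exact h3 (Matrix.ext_of_mulVec_single fun i => by rw [hc, Matrix.zero_mulVec])
  set w := (N * (A + (2 * r) • 1)).mulVec v with hw
  have hNw : N.mulVec w = 0 := by
    rw [hw, Matrix.mulVec_mulVec, ← Matrix.mul_assoc, h1, Matrix.zero_mulVec]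
  refine ⟨w, hv, ?_, ?_⟩
  · have : A = N + r • 1 := by rw [hN]; abel
    rw [this, Matrix.add_mulVec, hNw, zero_add, Matrix.smul_mulVec, Matrix.one_mulVec]
  · have : w ⬝ᵥ w = 0 := by
      have h : w = N.mulVec ((A + (2 * r) • 1).mulVec v) := by rw [hw, Matrix.mulVec_mulVec]
      conv_lhs => rhs; rw [h]
      rw [Matrix.dotProduct_mulVec, ← Matrix.mulVec_transpose, hNs, hNw, zero_dotProduct]
    simpa [dotProduct, Fin.sum_univ_three] using this

lemma tensor_sum (v : Fin 3 → ℂ) : tensor (∑ i, v i • u i) (∑ i, v i • u i) =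
    -tri u (Matrix.of fun i j => v i * v j) := by
  ext α β μ ν
  simp only [tri, Fin.sum_univ_three, tensor, Pi.neg_apply, Pi.add_apply, Pi.smul_apply,
    smul_eq_mul, Matrix.of_apply]
  ring

/-- Normal form of a symmetric matrix with null eigenvector `(0, 1, i)`. -/
lemma exists_params {B : Matrix (Fin 3) (Fin 3) ℂ} (hB : B.IsSymm) (hr : r ≠ 0)
    (h1 : (B - r • 1) * (B - r • 1) * (B + (2 * r) • 1) = 0)
    (h2 : (B - r • 1) * (B - r • 1) ≠ 0)
    (h3 : (B - r • 1) * (B + (2 * r) • 1) ≠ 0)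
    (ht : B.mulVec ![0, 1, Complex.I] = r • ![0, 1, Complex.I]) :
    ∃ c l : ℂ, l ≠ 0 ∧ B = r • 1 - (3 * r) • (Matrix.of fun i j => ![1, c, c * Complex.I] i
      * ![1, c, c * Complex.I] j) - (l ^ 2 / 2) • (Matrix.of fun i j =>
        ![0, 1, Complex.I] i * ![0, 1, Complex.I] j) := by
  obtain ⟨k, hk⟩ : ∃ k, k = B 0 0 - r := ⟨_, rfl⟩
  obtain ⟨b, hb⟩ : ∃ b, b = B 0 1 := ⟨_, rfl⟩
  obtain ⟨d, hd⟩ : ∃ d, d = B 1 1 - r := ⟨_, rfl⟩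
  have I2 := Complex.I_mul_I
  have e0 := congrFun ht 0
  have e1 := congrFun ht 1
  have e2 := congrFun ht 2
  simp [Matrix.mulVec, dotProduct, Fin.sum_univ_three] at e0 e1 e2
  have s10 := hB.apply 0 1
  have s20 := hB.apply 0 2
  have s21 := hB.apply 1 2
  -- Each row of the eigenvector equation forces a column of `B - r` to be `i` times its neighbour.
  -- With the symmetry of `B`, three unknowns `k`, `b`, `d` remain.
  have b02 : B 0 2 = Complex.I * b := by
    rw [hb]; linear_combination (-Complex.I) * e0 + B 0 2 * I2
  have b12 : B 1 2 = Complex.I * d := by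
    rw [hd]; linear_combination (-Complex.I) * e1 + B 1 2 * I2
  have b22 : B 2 2 = r - d := by
    linear_combination (-Complex.I) * e2 + (B 2 2 - r) * I2 + Complex.I * s21 + Complex.I * b12
      + d * I2
  have hBe : B = !![k + r, b, Complex.I * b; b, d + r, Complex.I * d;
      Complex.I * b, Complex.I * d, r - d] := by
    ext i j
    fin_cases i <;> fin_cases j <;> simp [hk, hb, hd, b02, b12, b22, s10, s20, s21]
  have hN : B - r • 1 = !![k, b, Complex.I * b; b, d, Complex.I * d;
      Complex.I * b, Complex.I * d, -d] := by
    rw [hBe]; ext i j; fin_cases i <;> fin_cases j <;> simp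
  have hN2 : B + (2 * r) • 1 = !![k + 3 * r, b, Complex.I * b; b, d + 3 * r, Complex.I * d;
      Complex.I * b, Complex.I * d, 3 * r - d] := by
    rw [hBe]; ext i j; fin_cases i <;> fin_cases j <;> simp <;> ring
  have hNN : (B - r • 1) * (B - r • 1) = !![k ^ 2, k * b, k * (Complex.I * b);
      k * b, b ^ 2, Complex.I * b ^ 2; k * (Complex.I * b), Complex.I * b ^ 2, -b ^ 2] := by
    rw [hN]; ext i j
    fin_cases i <;> fin_cases j <;> simp [Matrix.mul_apply, Fin.sum_univ_three] <;> ring_nf <;>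
      simp
  have hNM : (B - r • 1) * (B + (2 * r) • 1) = !![k * (k + 3 * r), b * (k + 3 * r),
      Complex.I * b * (k + 3 * r); b * (k + 3 * r), b ^ 2 + 3 * r * d,
      Complex.I * (b ^ 2 + 3 * r * d); Complex.I * b * (k + 3 * r),
      Complex.I * (b ^ 2 + 3 * r * d), -(b ^ 2 + 3 * r * d)] := by
    rw [hN, hN2]; ext i j
    fin_cases i <;> fin_cases j <;> simp [Matrix.mul_apply, Fin.sum_univ_three] <;> ring_nf <;>
      simp
    ring
  rw [hNN, hN2] at h1
  have m00 := congrFun (congrFun h1 0) 0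
  have m11 := congrFun (congrFun h1 1) 1
  simp [Matrix.mul_apply, Fin.sum_univ_three] at m00 m11
  -- If `k = 0`, the annihilating polynomial forces `b = 0`, and then `(B - r)² = 0`, contrary to
  -- type II.
  have hk0 : k ≠ 0 := by
    intro h0
    have hb0 : b = 0 := by
      have : b ^ 2 * (3 * r) = 0 := by
        rw [h0] at m11
        linear_combination m11 - (b ^ 2 * d) * I2
      have h3r : 3 * r ≠ 0 := mul_ne_zero (by norm_num) hr
      exact pow_eq_zero_iff (two_ne_zero) |>.1 ((mul_eq_zero.1 this).resolve_right h3r)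
    apply h2
    rw [hNN, h0, hb0]
    ext i j; fin_cases i <;> fin_cases j <;> simp
  have hk3 : k = -3 * r := by
    have : k ^ 2 * (k + 3 * r) = 0 := by linear_combination m00 - (k * b ^ 2) * I2
    have := (mul_eq_zero.1 this).resolve_left (pow_ne_zero 2 hk0)
    linear_combination this
  -- With `k = -3r` every entry of `(B - r)(B + 2r)` is zero or a multiple of this number. It will
  -- be the coefficient of the nilpotent part, so that part is present.
  have hne : b ^ 2 + 3 * r * d ≠ 0 := by
    intro h0
    apply h3
    rw [hNM, h0, hk3]
    ext i j; fin_cases i <;> fin_cases j <;> simp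
  have h3r : 3 * r ≠ 0 := mul_ne_zero (by norm_num) hr
  -- Comparison of the first row gives `-3rc = b`; comparison of the entry `(1, 1)` then gives `l² /
  -- 2 = -(b² + 3rd) / (3r)`.
  obtain ⟨l, hl⟩ := IsAlgClosed.exists_eq_mul_self (2 * (-(b ^ 2 + 3 * r * d) / (3 * r)))
  have hl0 : l ≠ 0 := by
    rintro rfl
    rw [mul_zero, mul_eq_zero, div_eq_zero_iff, neg_eq_zero] at hl
    rcases hl with h | h | h
    · norm_num at h
    · exact hne h
    · exact h3r h
  refine ⟨-b / (3 * r), l, hl0, ?_⟩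
  have hl2 : l ^ 2 / 2 = -(b ^ 2 + 3 * r * d) / (3 * r) := by rw [sq, ← hl]; ring
  rw [hl2, hBe, hk3]
  ext i j
  fin_cases i <;> fin_cases j <;> simp <;> field_simp <;> ring_nf
  simp

/-- A symmetric double bivector of type II admits a principal frame. -/
theorem exists_principal_frame (hs : g.IsSymm) (hη : IsVolumeSymbol η)
    (he : IsOrientedOrthonormal g η e) {A : Matrix (Fin 3) (Fin 3) ℂ} (hA : A.IsSymm)
    (hW : W = tri (triad g η e) A) (hII : IsTypeII g (sdMetric g η) W) :
    ∃ (e' : Fin 4 → Fin 4 → ℝ) (r : ℂ), r ≠ 0 ∧ IsOrientedOrthonormal g η e' ∧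
      W = tri (triad g η e') (canonII r) := by
  obtain ⟨r, hr, h1, h2, h3⟩ := hII
  have hG := fun (f : Fin 4 → Fin 4 → ℝ) (hf : IsOrientedOrthonormal g η f) =>
    hf.sdMetric_eq_tri hs hη
  have hm := IsTypeII.matrix (he.isTriad hη) hs A r
  have h1A := h1
  have h3A := h3
  rw [hW, hG e he, hm.1] at h1A
  rw [hW, hG e he, Ne, hm.2.2] at h3A
  obtain ⟨w, hw0, hAw, hww⟩ := exists_null_vector hA h1A h3A
  obtain ⟨R, k, hR, hRd, hRw⟩ := exists_rotation w hw0 hww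
  obtain ⟨hf, hfu⟩ := he.rotate hη hR hRd
  set f := mulFrame (rotation R) e with hf_def
  set Rc : Matrix (Fin 3) (Fin 3) ℂ := R.map (fun x : ℝ => (x : ℂ)) with hRc
  have hRR : Rc * Rc.transpose = 1 := by
    ext i j
    have := congrArg (fun x : ℝ => (x : ℂ)) (congrFun (congrFun hR i) j)
    simp only [Matrix.mul_apply, Matrix.transpose_apply, Matrix.one_apply] at this ⊢
    push_cast at this
    simp only [hRc, Matrix.map_apply]
    rw [this]; split_ifs <;> simp
  have hRR' : Rc.transpose * Rc = 1 := mul_eq_one_comm.1 hRR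
  -- The matrix of `W` in the rotated triad; `Rc` carries the null eigenvector to a multiple of `(0,
  -- 1, i)`.
  set B := Rc * A * Rc.transpose with hB
  have hWB : W = tri (triad g η f) B := by
    rw [tri_transform Rc B hfu, hW]
    congr 1
    calc A = (Rc.transpose * Rc) * A * (Rc.transpose * Rc) := by rw [hRR', one_mul, mul_one]
      _ = _ := by rw [hB]; simp only [Matrix.mul_assoc]
  have hBs : B.IsSymm := by
    rw [Matrix.IsSymm, hB]
    simp [Matrix.transpose_mul, hA.eq, Matrix.mul_assoc]
  have hRt : Rc.transpose.mulVec ![0, 1, Complex.I] = k • w := by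
    ext j
    have := hRw j
    simp only [Matrix.mulVec, dotProduct, Fin.sum_univ_three, Matrix.transpose_apply, hRc,
      Matrix.map_apply, Pi.smul_apply, smul_eq_mul]
    rw [← this]; simp; ring
  have hBt : B.mulVec ![0, 1, Complex.I] = r • ![0, 1, Complex.I] := by
    rw [hB, ← Matrix.mulVec_mulVec, ← Matrix.mulVec_mulVec, hRt, Matrix.mulVec_smul, hAw,
      smul_comm k r, ← hRt, Matrix.mulVec_smul, Matrix.mulVec_mulVec, hRR, Matrix.one_mulVec]
  have hm' := IsTypeII.matrix (hf.isTriad hη) hs B r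
  rw [hWB, hG f hf, hm'.1] at h1
  rw [hWB, hG f hf, Ne, hm'.2.1] at h2
  rw [hWB, hG f hf, Ne, hm'.2.2] at h3
  obtain ⟨c, l, hl, hBc⟩ := exists_params hBs hr h1 h2 h3 hBt
  -- The null rotation with parameters `x`, `y` adds to `𝓤` a multiple of `𝓛₊` proportional to `-x +
  -- iy`, and this has to be `c`.
  obtain ⟨hn, hnu, hnl⟩ := hf.null_rotate hη (-c.re) c.im
  set n := mulFrame (nullRotation (-c.re) c.im) f
  have hl' : ‖l‖ ≠ 0 := norm_ne_zero_iff.2 hl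
  -- Polar form of `l`: the boost factor is `‖l‖`, and the phase gives the rotation.
  have hcs : (l.re / ‖l‖) ^ 2 + (l.im / ‖l‖) ^ 2 = 1 := by
    rw [div_pow, div_pow, ← add_div, Complex.sq_norm, Complex.normSq_apply, ← sq, ← sq]
    refine div_self fun h => hl' ?_
    rw [← pow_eq_zero_iff two_ne_zero, Complex.sq_norm, Complex.normSq_apply, ← sq, ← sq, h]
  obtain ⟨hb, hbu, hbl⟩ := IsOrientedOrthonormal.boost_rotate hη hn hl' hcs
  set m := mulFrame (boostRotation ‖l‖ (l.re / ‖l‖) (l.im / ‖l‖)) n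
  refine ⟨m, r, hr, hb, ?_⟩
  have hc : (-((-c.re : ℝ) : ℂ) + Complex.I * (c.im : ℂ)) = c := by
    apply Complex.ext <;> simp
  have hll : ((‖l‖ : ℝ) : ℂ) *
      (((l.re / ‖l‖ : ℝ) : ℂ) + Complex.I * ((l.im / ‖l‖ : ℝ) : ℂ)) = l := by
    have : ((‖l‖ : ℝ) : ℂ) ≠ 0 := by exact_mod_cast hl'
    push_cast
    field_simp
    apply Complex.ext <;> simp
  rw [hc] at hnu
  rw [hll, hnl] at hbl
  rw [hnu] at hbu
  have hu0 : triad g η m 0 = ∑ i, ![1, c, c * Complex.I] i • triad g η f i := by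
    rw [hbu, triadLp, smul_smul, show c * (2 * isq) * isq = c by linear_combination 2 * c * isq_sq]
    simp [Fin.sum_univ_three, smul_add, smul_smul, add_assoc]
  have hLp : triadLp (triad g η m) =
      (l * isq) • ∑ i, ![0, 1, Complex.I] i • triad g η f i := by
    rw [hbl, triadLp, smul_smul]
    simp [Fin.sum_univ_three]
  rw [tri_canonII, ← hG m hb, hG f hf, hu0, hLp, tensor_smul_smul, tensor_sum, tensor_sum, hWB, hBc,
    tri_sub, tri_sub, tri_smul, tri_smul, tri_smul,
    show l * isq * (l * isq) = l ^ 2 / 2 by linear_combination l ^ 2 * isq_sq]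
  simp only [smul_neg]
  abel

end

/-! ### Partial derivatives -/

section Derivatives

variable {E : Type*} [NormedAddCommGroup E] [NormedSpace ℝ E] {O : Set Coord} {y : Coord}

lemma pd_add {f h : Coord → E} (hf : DifferentiableAt ℝ f y) (hh : DifferentiableAt ℝ h y)
    (μ : Fin 4) : pd μ (fun z => f z + h z) y = pd μ f y + pd μ h y := by
  simp only [pd]; rw [fderiv_fun_add hf hh]; rfl

lemma pd_sub {f h : Coord → E} (hf : DifferentiableAt ℝ f y) (hh : DifferentiableAt ℝ h y)
    (μ : Fin 4) : pd μ (fun z => f z - h z) y = pd μ f y - pd μ h y := by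
  simp only [pd]; rw [fderiv_fun_sub hf hh]; rfl

lemma pd_sum {ι : Type*} {s : Finset ι} {f : ι → Coord → E}
    (hf : ∀ i ∈ s, DifferentiableAt ℝ (f i) y) (μ : Fin 4) :
    pd μ (fun z => ∑ i ∈ s, f i z) y = ∑ i ∈ s, pd μ (f i) y := by
  simp only [pd]; rw [fderiv_fun_sum hf]; simp

lemma pd_mul {A : Type*} [NormedCommRing A] [NormedAlgebra ℝ A] {f h : Coord → A}
    (hf : DifferentiableAt ℝ f y) (hh : DifferentiableAt ℝ h y)
    (μ : Fin 4) : pd μ (fun z => f z * h z) y = pd μ f y * h y + f y * pd μ h y := by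
  simp only [pd]; rw [fderiv_fun_mul hf hh]; simp [mul_comm, add_comm]

lemma pd_const_mul {A : Type*} [NormedCommRing A] [NormedAlgebra ℝ A] {h : Coord → A} (c : A)
    (hh : DifferentiableAt ℝ h y) (μ : Fin 4) :
    pd μ (fun z => c * h z) y = c * pd μ h y := by
  rw [pd_mul (differentiableAt_const c) hh]; simp [pd]

lemma pd_ofReal {f : Coord → ℝ} (hf : DifferentiableAt ℝ f y) (μ : Fin 4) :
    pd μ (fun z => (f z : ℂ)) y = ((pd μ f y : ℝ) : ℂ) := by
  have := (Complex.ofRealCLM.hasFDerivAt.comp y hf.hasFDerivAt).fderiv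
  simp only [pd]
  have h2 : (fun z => (f z : ℂ)) = Complex.ofRealCLM ∘ f := rfl
  rw [h2, this]; rfl

lemma pd_congr {f h : Coord → E} (hfh : f =ᶠ[𝓝 y] h) (μ : Fin 4) : pd μ f y = pd μ h y := by
  simp only [pd]; rw [hfh.fderiv_eq]

lemma contDiffOn_pd {f : Coord → E} (hO : IsOpen O) (hf : ContDiffOn ℝ ∞ f O) (μ : Fin 4) :
    ContDiffOn ℝ ∞ (pd μ f) O :=
  (hf.fderiv_of_isOpen hO (by simp)).clm_apply contDiffOn_const

lemma _root_.ContDiffOn.differentiableAt_of_isOpen {f : Coord → E} (hf : ContDiffOn ℝ ∞ f O)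
    (hO : IsOpen O) (hy : y ∈ O) : DifferentiableAt ℝ f y :=
  (hf.contDiffAt (hO.mem_nhds hy)).differentiableAt (by simp)

lemma pd_comm {f : Coord → E} (hO : IsOpen O) (hf : ContDiffOn ℝ ∞ f O) (hy : y ∈ O)
    (μ ν : Fin 4) : pd μ (pd ν f) y = pd ν (pd μ f) y := by
  have h1 := hf.contDiffAt (hO.mem_nhds hy)
  have h2 : DifferentiableAt ℝ (fderiv ℝ f) y :=
    (hf.fderiv_of_isOpen hO (m := ∞) (by simp)).differentiableAt_of_isOpen hO hy
  have h3 : ∀ μ ν, pd μ (pd ν f) y =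
      fderiv ℝ (fderiv ℝ f) y (Pi.single μ 1) (Pi.single ν 1) := by
    intro μ ν
    have : pd ν f = fun z => fderiv ℝ f z (Pi.single ν 1) := rfl
    rw [this, pd, fderiv_clm_apply h2 (differentiableAt_const _)]
    simp
  rw [h3, h3]
  exact (h1.isSymmSndFDerivAt (by
    rw [minSmoothness_of_isRCLikeNormedField]
    exact WithTop.coe_le_coe.2 (le_top : (2 : ℕ∞) ≤ ⊤))).eq _ _

end Derivatives

/-! ### Symmetries of the curvature -/

section Curvature

variable {g : Coord → Matrix (Fin 4) (Fin 4) ℝ} {O : Set Coord} {y : Coord}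

/-- A smooth nondegenerate symmetric matrix field on an open set. -/
structure IsMetricOn (g : Coord → Matrix (Fin 4) (Fin 4) ℝ) (O : Set Coord) : Prop where
  isOpen : IsOpen O
  smooth : ∀ μ ν, ContDiffOn ℝ ∞ (fun y => g y μ ν) O
  symm : ∀ y ∈ O, (g y).IsSymm
  unit : ∀ y ∈ O, IsUnit (g y).det

/-- The Christoffel symbols of the first kind. -/
def christoffelLow (g : Coord → Matrix (Fin 4) (Fin 4) ℝ) (σ μ ν : Fin 4) (y : Coord) : ℝ :=
  (1 / 2) * (pd μ (fun z => g z σ ν) y + pd ν (fun z => g z σ μ) y - pd σ (fun z => g z μ ν) y)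

lemma christoffel_eq (l μ ν : Fin 4) (y : Coord) :
    christoffel g l μ ν y = ∑ σ, (g y)⁻¹ l σ * christoffelLow g σ μ ν y := by
  simp only [christoffel, christoffelLow, Finset.mul_sum]
  exact Finset.sum_congr rfl fun _ _ => by ring

lemma IsMetricOn.det (hg : IsMetricOn g O) : ContDiffOn ℝ ∞ (fun y => (g y).det) O := by
  simp only [Matrix.det_apply]
  refine ContDiffOn.sum fun σ _ => ?_
  simp only [Units.smul_def, zsmul_eq_mul]
  exact contDiffOn_const.mul (contDiffOn_prod fun i _ => hg.smooth _ _)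

lemma IsMetricOn.inv (hg : IsMetricOn g O) (μ ν : Fin 4) :
    ContDiffOn ℝ ∞ (fun y => (g y)⁻¹ μ ν) O := by
  -- By Cramer's rule the inverse metric is rational in the entries with nonvanishing denominator.
  have h : ∀ y ∈ O, (g y)⁻¹ μ ν = ((g y).det)⁻¹ * (g y).adjugate μ ν := fun y hy => by
    rw [Matrix.inv_def, Ring.inverse_eq_inv']; rfl
  refine ContDiffOn.congr ?_ h
  refine (hg.det.inv fun y hy => (hg.unit y hy).ne_zero).mul ?_
  simp only [Matrix.adjugate_apply, Matrix.det_apply]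
  refine ContDiffOn.sum fun σ _ => ?_
  simp only [Units.smul_def, zsmul_eq_mul]
  refine contDiffOn_const.mul (contDiffOn_prod fun i _ => ?_)
  simp only [Matrix.updateRow_apply]
  split_ifs
  · exact contDiffOn_const
  · exact hg.smooth _ _

lemma IsMetricOn.christoffelLow (hg : IsMetricOn g O) (σ μ ν : Fin 4) :
    ContDiffOn ℝ ∞ (christoffelLow g σ μ ν) O :=
  contDiffOn_const.mul (((contDiffOn_pd hg.isOpen (hg.smooth _ _) _).add
    (contDiffOn_pd hg.isOpen (hg.smooth _ _) _)).sub (contDiffOn_pd hg.isOpen (hg.smooth _ _) _))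

lemma IsMetricOn.christoffel (hg : IsMetricOn g O) (l μ ν : Fin 4) :
    ContDiffOn ℝ ∞ (christoffel g l μ ν) O := by
  have : Spacetime4.christoffel g l μ ν =
      fun y => ∑ σ, (g y)⁻¹ l σ * Spacetime4.christoffelLow g σ μ ν y :=
    funext fun y => christoffel_eq l μ ν y
  rw [this]
  exact ContDiffOn.sum fun σ _ => (hg.inv _ _).mul (hg.christoffelLow _ _ _)

lemma IsMetricOn.riemannUp (hg : IsMetricOn g O) (α β μ ν : Fin 4) :
    ContDiffOn ℝ ∞ (riemannUp g α β μ ν) O :=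
  ((contDiffOn_pd hg.isOpen (hg.christoffel _ _ _) _).sub
    (contDiffOn_pd hg.isOpen (hg.christoffel _ _ _) _)).add
    (ContDiffOn.sum fun _ _ => ((hg.christoffel _ _ _).mul (hg.christoffel _ _ _)).sub
      ((hg.christoffel _ _ _).mul (hg.christoffel _ _ _)))

lemma IsMetricOn.riemann (hg : IsMetricOn g O) (α β μ ν : Fin 4) :
    ContDiffOn ℝ ∞ (riemann g α β μ ν) O :=
  ContDiffOn.sum fun _ _ => (hg.smooth _ _).mul (hg.riemannUp _ _ _ _)

lemma IsMetricOn.ricci (hg : IsMetricOn g O) (β ν : Fin 4) :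
    ContDiffOn ℝ ∞ (ricci g β ν) O :=
  ContDiffOn.sum fun _ _ => hg.riemannUp _ _ _ _

lemma IsMetricOn.scalarCurvature (hg : IsMetricOn g O) :
    ContDiffOn ℝ ∞ (scalarCurvature g) O :=
  ContDiffOn.sum fun _ _ => ContDiffOn.sum fun _ _ => (hg.inv _ _).mul (hg.ricci _ _)

lemma IsMetricOn.weyl (hg : IsMetricOn g O) (α β μ ν : Fin 4) :
    ContDiffOn ℝ ∞ (weyl g α β μ ν) O := by
  have hs := hg.smooth
  have hr := hg.ricci
  refine ((hg.riemann α β μ ν).sub (contDiffOn_const.mul ?_)).add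
    ((hg.scalarCurvature.div_const 6).mul ?_)
  · exact ((((hs _ _).mul (hr _ _)).sub ((hs _ _).mul (hr _ _))).sub ((hs _ _).mul (hr _ _))).add
      ((hs _ _).mul (hr _ _))
  · exact ((hs _ _).mul (hs _ _)).sub ((hs _ _).mul (hs _ _))

lemma IsMetricOn.symm_fun (hg : IsMetricOn g O) (hy : y ∈ O) (α β μ : Fin 4) :
    pd μ (fun z => g z α β) y = pd μ (fun z => g z β α) y :=
  pd_congr (by
    filter_upwards [hg.isOpen.mem_nhds hy] with z hz using ((hg.symm z hz).apply β α)) μ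

lemma IsMetricOn.christoffelLow_symm (hg : IsMetricOn g O) (hy : y ∈ O) (σ μ ν : Fin 4) :
    Spacetime4.christoffelLow g σ μ ν y = Spacetime4.christoffelLow g σ ν μ y := by
  simp only [Spacetime4.christoffelLow]
  rw [hg.symm_fun hy μ ν]; ring

/-- Compatibility of the Levi-Civita connection with the metric. -/
lemma IsMetricOn.pd_metric (hg : IsMetricOn g O) (hy : y ∈ O) (μ α β : Fin 4) :
    pd μ (fun z => g z α β) y =
      Spacetime4.christoffelLow g α μ β y + Spacetime4.christoffelLow g β μ α y := by
  simp only [Spacetime4.christoffelLow]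
  rw [hg.symm_fun hy β α, hg.symm_fun hy μ α, hg.symm_fun hy μ β]; ring

lemma IsMetricOn.mul_inv (hg : IsMetricOn g O) (hy : y ∈ O) (α β : Fin 4) :
    ∑ σ, g y α σ * (g y)⁻¹ σ β = if α = β then 1 else 0 := by
  have := congrFun (congrFun (Matrix.mul_nonsing_inv _ (hg.unit y hy)) α) β
  rwa [Matrix.mul_apply, Matrix.one_apply] at this

lemma IsMetricOn.lower_christoffel (hg : IsMetricOn g O) (hy : y ∈ O) (α μ ν : Fin 4) :
    ∑ l, g y α l * Spacetime4.christoffel g l μ ν y =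
      Spacetime4.christoffelLow g α μ ν y := by
  simp only [christoffel_eq, Finset.mul_sum, ← mul_assoc]
  rw [Finset.sum_comm]
  simp only [← Finset.sum_mul, hg.mul_inv hy, ite_mul, one_mul, zero_mul, Finset.sum_ite_eq,
    Finset.mem_univ, if_true]

/-- The quadratic term `Γ_{σ p q} Γ^σ_{μν}` of the curvature. -/
def quadTerm (g : Coord → Matrix (Fin 4) (Fin 4) ℝ) (y : Coord) (p q μ ν : Fin 4) : ℝ :=
  ∑ σ, christoffelLow g σ p q y * christoffel g σ μ ν y

lemma IsMetricOn.quadTerm_comm (hg : IsMetricOn g O) (hy : y ∈ O) (p q μ ν : Fin 4) :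
    quadTerm g y p q μ ν = quadTerm g y μ ν p q := by
  simp only [quadTerm, christoffel_eq, Finset.mul_sum]
  rw [Finset.sum_comm]
  refine Finset.sum_congr rfl fun σ _ => Finset.sum_congr rfl fun τ _ => ?_
  rw [inv_symm (hg.symm y hy) σ τ]; ring

lemma IsMetricOn.quadTerm_symm (hg : IsMetricOn g O) (hy : y ∈ O) (p q μ ν : Fin 4) :
    quadTerm g y p q μ ν = quadTerm g y q p μ ν := by
  simp only [quadTerm]
  exact Finset.sum_congr rfl fun σ _ => by rw [hg.christoffelLow_symm hy]

/-- Product rule for `Γ_{αμν} = g_{αl} Γ^l_{μν}`, with `∂g` rewritten by metric compatibility. -/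
lemma IsMetricOn.lower_pd_christoffel (hg : IsMetricOn g O) (hy : y ∈ O) (α κ μ ν : Fin 4) :
    ∑ l, g y α l * pd κ (Spacetime4.christoffel g l μ ν) y =
      pd κ (Spacetime4.christoffelLow g α μ ν) y
        - ∑ l, (Spacetime4.christoffelLow g α κ l y + Spacetime4.christoffelLow g l κ α y)
          * Spacetime4.christoffel g l μ ν y := by
  have h1 : pd κ (Spacetime4.christoffelLow g α μ ν) y =
      pd κ (fun z => ∑ l, g z α l * Spacetime4.christoffel g l μ ν z) y :=
    pd_congr (by
      filter_upwards [hg.isOpen.mem_nhds hy] with z hz using (hg.lower_christoffel hz _ _ _).symm) κ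
  have hd1 : ∀ l, DifferentiableAt ℝ (fun z => g z α l) y := fun l =>
    (hg.smooth α l).differentiableAt_of_isOpen hg.isOpen hy
  have hd2 : ∀ l, DifferentiableAt ℝ (fun z => Spacetime4.christoffel g l μ ν z) y := fun l =>
    (hg.christoffel l μ ν).differentiableAt_of_isOpen hg.isOpen hy
  rw [h1, pd_sum (f := fun l z => g z α l * Spacetime4.christoffel g l μ ν z)
    fun l _ => (hd1 l).mul (hd2 l), ← Finset.sum_sub_distrib]
  refine Finset.sum_congr rfl fun l _ => ?_
  rw [pd_mul (hd1 l) (hd2 l), hg.pd_metric hy]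
  ring

/-- Lowering the index of `∂Γ` produces `∂g · Γ` terms. Half of them cancel the `Γ Γ` products of
the curvature, and the rest are the quadratic terms `g(Γ, Γ)`, in which the symmetries become
visible. -/
lemma IsMetricOn.riemann_eq (hg : IsMetricOn g O) (hy : y ∈ O) (α β μ ν : Fin 4) :
    Spacetime4.riemann g α β μ ν y =
      pd μ (Spacetime4.christoffelLow g α ν β) y - pd ν (Spacetime4.christoffelLow g α μ β) y
        - quadTerm g y μ α ν β + quadTerm g y ν α μ β := by
  have h1 := hg.lower_pd_christoffel hy α μ ν β
  have h2 := hg.lower_pd_christoffel hy α ν μ β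
  have h4 : ∀ p q s, ∑ σ, g y α σ * ∑ τ, Spacetime4.christoffel g σ p τ y *
      Spacetime4.christoffel g τ q s y =
      ∑ τ, Spacetime4.christoffelLow g α p τ y * Spacetime4.christoffel g τ q s y := by
    intro p q s
    simp only [Finset.mul_sum, ← mul_assoc]
    rw [Finset.sum_comm]
    simp only [← Finset.sum_mul, hg.lower_christoffel hy]
  have h5 := h4 μ ν β
  have h6 := h4 ν μ β
  simp only [add_mul, Finset.sum_add_distrib] at h1 h2
  simp only [Spacetime4.riemann, Spacetime4.riemannUp, mul_add, mul_sub, Finset.sum_add_distrib,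
    Finset.sum_sub_distrib, h1, h2, h5, h6, quadTerm]
  ring

lemma IsMetricOn.pd_christoffelLow (hg : IsMetricOn g O) (hy : y ∈ O) (κ σ μ ν : Fin 4) :
    pd κ (Spacetime4.christoffelLow g σ μ ν) y =
      (1 / 2) * (pd κ (pd μ (fun z => g z σ ν)) y + pd κ (pd ν (fun z => g z σ μ)) y
        - pd κ (pd σ (fun z => g z μ ν)) y) := by
  have hd : ∀ l p q, DifferentiableAt ℝ (fun w => pd l (fun z => g z p q) w) y := fun l p q =>
    (contDiffOn_pd hg.isOpen (hg.smooth p q) l).differentiableAt_of_isOpen hg.isOpen hy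
  have : Spacetime4.christoffelLow g σ μ ν = fun w => (1 / 2) * (pd μ (fun z => g z σ ν) w
      + pd ν (fun z => g z σ μ) w - pd σ (fun z => g z μ ν) w) := rfl
  have hd' : DifferentiableAt ℝ (fun w => pd μ (fun z => g z σ ν) w
      + pd ν (fun z => g z σ μ) w) y := (hd _ _ _).add (hd _ _ _)
  rw [this, pd_const_mul _ (hd'.fun_sub (hd _ _ _)), pd_sub hd' (hd _ _ _),
    pd_add (hd _ _ _) (hd _ _ _)]

lemma IsMetricOn.symm_fun₂ (hg : IsMetricOn g O) (hy : y ∈ O) (κ μ α β : Fin 4) :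
    pd κ (pd μ (fun z => g z α β)) y = pd κ (pd μ (fun z => g z β α)) y :=
  pd_congr (by
    filter_upwards [hg.isOpen.mem_nhds hy] with z hz using hg.symm_fun hz _ _ _) κ

lemma IsMetricOn.riemann_anti_right (α β μ ν : Fin 4) :
    Spacetime4.riemann g α β μ ν y = -Spacetime4.riemann g α β ν μ y := by
  simp only [Spacetime4.riemann, ← Finset.sum_neg_distrib, Spacetime4.riemannUp]
  refine Finset.sum_congr rfl fun σ _ => ?_
  simp only [Finset.sum_sub_distrib]
  ring

/-- The part linear in second derivatives of `g` has the pair symmetry because `g` is symmetric and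
partial derivatives commute; the quadratic part has it because `quadTerm` is symmetric within each
pair and under their exchange. -/
lemma IsMetricOn.riemann_pair (hg : IsMetricOn g O) (hy : y ∈ O) (α β μ ν : Fin 4) :
    Spacetime4.riemann g α β μ ν y = Spacetime4.riemann g μ ν α β y := by
  have D := fun κ l p q => pd_comm hg.isOpen (hg.smooth p q) hy κ l
  have S := hg.symm_fun₂ hy
  have C := hg.quadTerm_comm hy
  have T := hg.quadTerm_symm hy
  rw [hg.riemann_eq hy, hg.riemann_eq hy]
  simp only [hg.pd_christoffelLow hy]
  have Q1 : quadTerm g y μ α ν β = quadTerm g y α μ β ν := by rw [T, C, T, C]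
  have Q2 : quadTerm g y ν α μ β = quadTerm g y β μ α ν := by rw [C, T, C, T, C]
  linear_combination (1 / 2) * D μ ν α β + (1 / 2) * D μ β α ν - (1 / 2) * D μ α ν β
    - (1 / 2) * S α μ ν β - (1 / 2) * D ν β α μ - (1 / 2) * S β ν α μ + (1 / 2) * D ν α μ β
    - (1 / 2) * D α β μ ν - Q1 + Q2

lemma IsMetricOn.riemann_anti_left (hg : IsMetricOn g O) (hy : y ∈ O) (α β μ ν : Fin 4) :
    Spacetime4.riemann g α β μ ν y = -Spacetime4.riemann g β α μ ν y := by
  rw [hg.riemann_pair hy, IsMetricOn.riemann_anti_right, hg.riemann_pair hy]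

lemma IsMetricOn.inv_mul (hg : IsMetricOn g O) (hy : y ∈ O) (α β : Fin 4) :
    ∑ σ, (g y)⁻¹ α σ * g y σ β = if α = β then 1 else 0 := by
  have := congrFun (congrFun (Matrix.nonsing_inv_mul _ (hg.unit y hy)) α) β
  rwa [Matrix.mul_apply, Matrix.one_apply] at this

lemma IsMetricOn.ricci_eq (hg : IsMetricOn g O) (hy : y ∈ O) (β ν : Fin 4) :
    Spacetime4.ricci g β ν y = ∑ α, ∑ σ, (g y)⁻¹ α σ * Spacetime4.riemann g α β σ ν y := by
  have h : ∀ α, Spacetime4.riemannUp g α β α ν y =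
      ∑ σ, (g y)⁻¹ α σ * Spacetime4.riemann g σ β α ν y := by
    intro α
    simp only [Spacetime4.riemann, Finset.mul_sum, ← mul_assoc]
    rw [Finset.sum_comm]
    simp only [← Finset.sum_mul, hg.inv_mul hy, ite_mul, one_mul, zero_mul, Finset.sum_ite_eq,
      Finset.mem_univ, if_true]
  simp only [Spacetime4.ricci, h]
  rw [Finset.sum_comm]
  exact Finset.sum_congr rfl fun _ _ => Finset.sum_congr rfl fun _ _ => by
    rw [inv_symm (hg.symm y hy)]

lemma IsMetricOn.ricci_symm (hg : IsMetricOn g O) (hy : y ∈ O) (β ν : Fin 4) :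
    Spacetime4.ricci g β ν y = Spacetime4.ricci g ν β y := by
  rw [hg.ricci_eq hy, hg.ricci_eq hy, Finset.sum_comm]
  exact Finset.sum_congr rfl fun _ _ => Finset.sum_congr rfl fun _ _ => by
    rw [inv_symm (hg.symm y hy), hg.riemann_pair hy]

/-- The symmetries are inherited from the Riemann and Ricci tensors. In dimension four the trace is
`Ric - (1/2)(4 Ric - 2 Ric + R g) + (R/6)(4 g - g) = 0`. -/
lemma IsMetricOn.isWeylLike (hg : IsMetricOn g O) (hy : y ∈ O) :
    IsWeylLike (g y) (fun α β μ ν => Spacetime4.weyl g α β μ ν y) := by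
  have gs : ∀ α β, g y α β = g y β α := fun α β => (hg.symm y hy).apply β α
  refine ⟨fun α β μ ν => ?_, fun α β μ ν => ?_, fun β ν => ?_⟩
  · simp only [Spacetime4.weyl]
    rw [hg.riemann_anti_left hy]; ring
  · simp only [Spacetime4.weyl]
    rw [hg.riemann_pair hy, gs α μ, gs α ν, gs β μ, gs β ν, hg.ricci_symm hy β ν,
      hg.ricci_symm hy β μ, hg.ricci_symm hy α ν, hg.ricci_symm hy α μ]
    ring
  · have hk : ∀ (p : Fin 4) (x : Fin 4 → ℝ),
        ∑ α, ∑ μ, (g y)⁻¹ α μ * (g y α p * x μ) = x p := by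
      intro p x
      rw [Finset.sum_comm]
      have : ∀ μ, ∑ α, (g y)⁻¹ α μ * (g y α p * x μ) = if μ = p then x μ else 0 := fun μ => by
        simp only [← mul_assoc, ← Finset.sum_mul]
        rw [Finset.sum_congr rfl fun α _ => by rw [inv_symm (hg.symm y hy) α μ], hg.inv_mul hy]
        simp
      simp [this]
    have hk' : ∀ (p : Fin 4) (x : Fin 4 → ℝ),
        ∑ α, ∑ μ, (g y)⁻¹ α μ * (g y p μ * x α) = x p := by
      intro p x
      rw [← hk p x, Finset.sum_comm]
      exact Finset.sum_congr rfl fun _ _ => Finset.sum_congr rfl fun _ _ => by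
        rw [inv_symm (hg.symm y hy), gs p]
    have htr : ∑ α, ∑ μ, (g y)⁻¹ α μ * g y α μ = 4 := by
      have : ∀ α, ∑ μ, (g y)⁻¹ α μ * g y α μ = 1 := fun α => by
        rw [Finset.sum_congr rfl fun μ _ => by rw [gs α μ], hg.inv_mul hy, if_pos rfl]
      simp [this]
    have t1 := hg.ricci_eq hy β ν
    have t2 := hk ν (fun μ => Spacetime4.ricci g β μ y)
    have t3 := hk' β (fun α => Spacetime4.ricci g α ν y)
    have t4 := hk ν (fun μ => g y β μ)
    have t5 : Spacetime4.scalarCurvature g y = ∑ α, ∑ μ, (g y)⁻¹ α μ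
        * Spacetime4.ricci g α μ y := rfl
    have e : ∑ α, ∑ μ, (g y)⁻¹ α μ * Spacetime4.weyl g α β μ ν y =
        ∑ α, ∑ μ, (g y)⁻¹ α μ * Spacetime4.riemann g α β μ ν y
        - (1 / 2) * ((∑ α, ∑ μ, (g y)⁻¹ α μ * g y α μ) * Spacetime4.ricci g β ν y
          - ∑ α, ∑ μ, (g y)⁻¹ α μ * (g y α ν * Spacetime4.ricci g β μ y)
          - ∑ α, ∑ μ, (g y)⁻¹ α μ * (g y β μ * Spacetime4.ricci g α ν y)
          + (∑ α, ∑ μ, (g y)⁻¹ α μ * Spacetime4.ricci g α μ y) * g y β ν)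
        + (Spacetime4.scalarCurvature g y / 6) *
          ((∑ α, ∑ μ, (g y)⁻¹ α μ * g y α μ) * g y β ν
            - ∑ α, ∑ μ, (g y)⁻¹ α μ * (g y α ν * g y β μ)) := by
      simp only [Finset.sum_mul, Finset.mul_sum, ← Finset.sum_add_distrib,
        ← Finset.sum_sub_distrib]
      exact Finset.sum_congr rfl fun _ _ => Finset.sum_congr rfl fun _ _ => by
        simp only [Spacetime4.weyl]; ring
    rw [e, ← t1, t2, t3, t4, ← t5, htr]
    ring

end Curvature

/-! ### Components of a spacetime in a chart -/

section Chart

variable {M : Type*} [TopologicalSpace M] [ChartedSpace Coord M]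
  {φ : OpenPartialHomeomorph M Coord} {y : Coord}

/-- The differential of the inverse of a chart. -/
def chartDeriv (φ : OpenPartialHomeomorph M Coord) (y : Coord) :
    Coord →ₗ[ℝ] TangentSpace 𝓘(ℝ, Coord) (φ.symm y) :=
  (mfderiv 𝓘(ℝ, Coord) 𝓘(ℝ, Coord) φ.symm y).toLinearMap

lemma chartDeriv_single (μ : Fin 4) :
    chartDeriv φ y (Pi.single μ 1) = coordVec φ y μ := rfl

lemma chartDeriv_apply (v : Coord) : chartDeriv φ y v = ∑ μ, v μ • coordVec φ y μ := by
  have h : v = ∑ μ, v μ • (Pi.single μ (1 : ℝ) : Coord) := by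
    ext i; simp [Finset.sum_apply, Pi.single_apply]
  conv_lhs => rw [h]
  simp only [map_sum, map_smul, chartDeriv_single]

/-- The differential of a chart inverts that of its inverse, so the latter is injective, hence
surjective by dimension. It serves to write tangent frames in coordinate components. -/
lemma chartDeriv_surjective
    (hφ : φ ∈ IsManifold.maximalAtlas 𝓘(ℝ, Coord) ∞ M)
    (hy : y ∈ φ.target) : Function.Surjective (chartDeriv φ y) := by
  have hd : φ.MDifferentiable 𝓘(ℝ, Coord) 𝓘(ℝ, Coord) :=
    ⟨(contMDiffOn_of_mem_maximalAtlas hφ).mdifferentiableOn (by simp),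
      (contMDiffOn_symm_of_mem_maximalAtlas hφ).mdifferentiableOn (by simp)⟩
  have h := hd.comp_symm_deriv hy
  have hinj : Function.Injective (chartDeriv φ y) := by
    refine Function.LeftInverse.injective
      (g := mfderiv 𝓘(ℝ, Coord) 𝓘(ℝ, Coord) φ (φ.symm y)) fun v => ?_
    exact congrArg (fun T => T v) h
  exact (LinearMap.injective_iff_surjective (V := Coord)
    (f := (chartDeriv φ y : Coord →ₗ[ℝ] Coord))).1 hinj

variable [IsManifold 𝓘(ℝ, Coord) ∞ M] (S : Spacetime M)

lemma Spacetime.sum_g (v w : Coord) :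
    ∑ μ, ∑ ν, S.g φ y μ ν * v μ * w ν =
      S.metric (φ.symm y) (chartDeriv φ y v) (chartDeriv φ y w) := by
  rw [chartDeriv_apply, chartDeriv_apply]
  simp only [map_sum, map_smul, LinearMap.sum_apply, LinearMap.smul_apply, smul_eq_mul,
    Spacetime.g]
  rw [Finset.sum_comm]
  exact Finset.sum_congr rfl fun μ _ => by
    rw [Finset.mul_sum]
    exact Finset.sum_congr rfl fun ν _ => by ring

lemma Spacetime.g_isSymm : (S.g φ y).IsSymm := by
  ext μ ν
  exact S.metric_symm _ _ _

/-- The volume element pulled back to coordinates. -/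
def Spacetime.vol (φ : OpenPartialHomeomorph M Coord) (y : Coord) : Coord [⋀^Fin 4]→ₗ[ℝ] ℝ :=
  (S.volume (φ.symm y)).compLinearMap (chartDeriv φ y)

lemma Spacetime.vol_eq_det (v : Fin 4 → Coord) :
    S.vol φ y v = S.η φ y 0 1 2 3 * (Matrix.of v).det := by
  have h := congrArg (fun f => f v) ((S.vol φ y).eq_smul_basis_det (Pi.basisFun ℝ (Fin 4)))
  simp only [AlternatingMap.smul_apply, Pi.basisFun_det_apply, smul_eq_mul] at h
  rw [h]
  congr 1
  rw [Spacetime.vol, AlternatingMap.compLinearMap_apply, Spacetime.η]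
  congr 1
  ext i : 1
  fin_cases i <;> simp [chartDeriv_single]

lemma Spacetime.η_eq (α β γ δ : Fin 4) : S.η φ y α β γ δ = S.η φ y 0 1 2 3 *
    det4 (Pi.single α 1) (Pi.single β 1) (Pi.single γ 1) (Pi.single δ 1) := by
  rw [det4, ← S.vol_eq_det, Spacetime.vol, AlternatingMap.compLinearMap_apply, Spacetime.η]
  congr 1
  ext i : 1
  fin_cases i <;> simp [chartDeriv_single]

lemma Spacetime.isVolumeSymbol : IsVolumeSymbol (S.η φ y) := ⟨_, S.η_eq⟩

lemma Spacetime.sum_η (v : Fin 4 → Coord) :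
    ∑ α, ∑ β, ∑ γ, ∑ δ, S.η φ y α β γ δ * v 0 α * v 1 β * v 2 γ * v 3 δ =
      S.volume (φ.symm y) (fun i => chartDeriv φ y (v i)) := by
  have h : S.volume (φ.symm y) (fun i => chartDeriv φ y (v i)) = S.vol φ y v := rfl
  rw [h, S.vol_eq_det, ← det4_frame, ← sum_det4_single]
  -- Naming the constant keeps the rewriting from acting on `η 0 1 2 3` again.
  obtain ⟨k, hk⟩ : ∃ k, ∀ α β γ δ, S.η φ y α β γ δ = k * det4 (Pi.single α 1) (Pi.single β 1)
    (Pi.single γ 1) (Pi.single δ 1) ∧ S.η φ y 0 1 2 3 = k :=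
    ⟨_, fun α β γ δ => ⟨S.η_eq α β γ δ, rfl⟩⟩
  rw [(hk 0 0 0 0).2]
  simp only [(hk _ _ _ _).1, Finset.mul_sum]
  exact Finset.sum_congr rfl fun α _ => Finset.sum_congr rfl fun β _ =>
    Finset.sum_congr rfl fun γ _ => Finset.sum_congr rfl fun δ _ => by ring

lemma Spacetime.exists_frame (hφ : φ ∈ IsManifold.maximalAtlas 𝓘(ℝ, Coord) ∞ M)
    (hy : y ∈ φ.target) : ∃ e, IsOrientedOrthonormal (S.g φ y) (S.η φ y) e := by
  obtain ⟨b, hb⟩ : ∃ b : Fin 4 → TangentSpace 𝓘(ℝ, Coord) (φ.symm y),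
      (∀ i j, S.metric (φ.symm y) (b i) (b j) = signature i j) ∧ S.volume (φ.symm y) b = 1 := by
    obtain ⟨b, hb⟩ := S.metric_signature (φ.symm y)
    rcases S.volume_unit _ b hb with h | h
    · exact ⟨b, hb, h⟩
    -- A basis of the wrong orientation is corrected by reversing one vector.
    · refine ⟨Function.update b 1 (-b 1), fun i j => ?_, ?_⟩
      · by_cases hi : i = 1 <;> by_cases hj : j = 1
        · subst hi; subst hj; simp [hb]
        · subst hi; simp [hb, hj, signature_eq, Ne.symm hj]
        · subst hj; simp [hb, hi, signature_eq]
        · simp [hb, hi, hj]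
      · have h1 := (S.volume (φ.symm y)).map_update_neg b 1 (b 1)
        rw [h1, Function.update_eq_self, h, neg_neg]
  choose e he using fun a => chartDeriv_surjective hφ hy (b a)
  refine ⟨e, fun i j => ?_, ?_⟩
  · rw [S.sum_g, he, he, hb.1]
  · rw [S.sum_η]
    simp only [he]
    exact hb.2

lemma Spacetime.isMetricOn (hφ : φ ∈ IsManifold.maximalAtlas 𝓘(ℝ, Coord) ∞ M) :
    IsMetricOn (S.g φ) φ.target where
  isOpen := φ.open_target
  smooth μ ν := S.metric_smooth φ hφ μ ν
  symm _ _ := S.g_isSymm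
  unit y hy := by
    obtain ⟨e, he⟩ := S.exists_frame hφ hy
    exact he.orthonormal.isUnit_det_metric

lemma Spacetime.η_smooth (hφ : φ ∈ IsManifold.maximalAtlas 𝓘(ℝ, Coord) ∞ M)
    (α β γ δ : Fin 4) : ContDiffOn ℝ ∞ (fun y => S.η φ y α β γ δ) φ.target := by
  have h : (fun y => S.η φ y α β γ δ) = fun y => S.volume (φ.symm y) (coordVec φ y) *
      det4 (Pi.single α 1) (Pi.single β 1) (Pi.single γ 1) (Pi.single δ 1) := by
    ext y
    rw [S.η_eq, Spacetime.η]
    congr 2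
    ext i : 1
    fin_cases i <;> rfl
  rw [h]
  exact (S.volume_smooth φ hφ).mul contDiffOn_const

/-- The self-dual Weyl tensor of type II admits a principal frame at each point. -/
lemma Spacetime.exists_canonical (hφ : φ ∈ IsManifold.maximalAtlas 𝓘(ℝ, Coord) ∞ M)
    (hy : y ∈ φ.target) (hII : IsTypeII (S.g φ y) (S.G φ y) (S.W φ y)) :
    ∃ (e : Fin 4 → Fin 4 → ℝ) (r : ℂ), r ≠ 0 ∧
      IsOrientedOrthonormal (S.g φ y) (S.η φ y) e ∧
      IsCanonical (S.g φ y) (S.G φ y) (S.W φ y) (triad (S.g φ y) (S.η φ y) e) r := by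
  obtain ⟨e, he⟩ := S.exists_frame hφ hy
  obtain ⟨A, hA, hW⟩ := ((S.isMetricOn hφ).isWeylLike hy).exists_tri S.g_isSymm
    S.isVolumeSymbol he
  obtain ⟨e', r, hr, he', hW'⟩ := exists_principal_frame (W := S.W φ y) S.g_isSymm
    S.isVolumeSymbol he hA hW hII
  exact ⟨e', r, hr, he', S.g_isSymm, he'.isTriad S.isVolumeSymbol,
    he'.sdMetric_eq_tri S.g_isSymm S.isVolumeSymbol, hW'⟩

end Chart

/-! ### Tensors with given components in a frame -/

section

variable {g : Matrix (Fin 4) (Fin 4) ℝ} {η : Fin 4 → Fin 4 → Fin 4 → Fin 4 → ℝ}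
  {e : Fin 4 → Fin 4 → ℝ} {u : Fin 3 → Tensor2} {G W : Tensor4} {r : ℂ}

/-- The tensor with components `C` with respect to the covectors of a frame. -/
def frameTensor (g : Matrix (Fin 4) (Fin 4) ℝ) (e : Fin 4 → Fin 4 → ℝ)
    (C : Matrix (Fin 4) (Fin 4) ℂ) : Tensor2 :=
  fun α β => ∑ a, ∑ b, C a b * (lower g e a α : ℂ) * (lower g e b β : ℂ)

/-- The contraction `F_{αμ} K^μ_β`. -/
def mul2 (g : Matrix (Fin 4) (Fin 4) ℝ) (F K : Tensor2) : Tensor2 :=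
  fun α β => ∑ μ, ∑ ν, F α μ * ((g⁻¹ μ ν : ℝ) : ℂ) * K ν β

lemma contract_eq_mul2 (D : Fin 4 → Fin 4 → Fin 4 → ℂ) (K : Tensor2) (l α β : Fin 4) :
    contract g D K l α β = mul2 g (D l) K α β := rfl

/-- The signature matrix over `ℂ`. -/
def sgnC : Matrix (Fin 4) (Fin 4) ℂ := Matrix.diagonal ![-1, 1, 1, 1]

lemma sgnC_apply (a b : Fin 4) : sgnC a b = ((signature a b : ℝ) : ℂ) := by
  fin_cases a <;> fin_cases b <;> simp [sgnC, signature]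

lemma frameTensor_add (C D : Matrix (Fin 4) (Fin 4) ℂ) :
    frameTensor g e (C + D) = frameTensor g e C + frameTensor g e D := by
  ext α β
  simp only [frameTensor, Matrix.add_apply, add_mul, Finset.sum_add_distrib, Pi.add_apply]

lemma frameTensor_smul (c : ℂ) (C : Matrix (Fin 4) (Fin 4) ℂ) :
    frameTensor g e (c • C) = c • frameTensor g e C := by
  ext α β
  simp only [frameTensor, Matrix.smul_apply, smul_eq_mul, Pi.smul_apply, Finset.mul_sum, mul_assoc]

lemma frameTensor_sub (C D : Matrix (Fin 4) (Fin 4) ℂ) :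
    frameTensor g e (C - D) = frameTensor g e C - frameTensor g e D := by
  ext α β
  simp only [frameTensor, Matrix.sub_apply, sub_mul, Finset.sum_sub_distrib, Pi.sub_apply]

lemma conj2_frameTensor (C : Matrix (Fin 4) (Fin 4) ℂ) :
    conj2 (frameTensor g e C) = frameTensor g e (C.map (starRingEnd ℂ)) := by
  ext α β
  simp only [conj2, frameTensor, map_sum, map_mul, Complex.conj_ofReal, Matrix.map_apply]

lemma IsOrthonormal.sum_inv_lower_lower (he : IsOrthonormal g e) (a b : Fin 4) :
    ∑ μ, ∑ ν, (lower g e a μ : ℂ) * ((g⁻¹ μ ν : ℝ) : ℂ) * (lower g e b ν : ℂ) = sgnC a b := by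
  rw [sgnC_apply, ← he.sum_lower a b]
  push_cast
  refine Finset.sum_congr rfl fun μ _ => ?_
  rw [← he.inv_metric_lower b μ]
  push_cast
  rw [Finset.mul_sum]
  exact Finset.sum_congr rfl fun ν _ => by ring

/-- The matrix of covariant components of a frame. -/
def lowerMatrix (g : Matrix (Fin 4) (Fin 4) ℝ) (e : Fin 4 → Fin 4 → ℝ) :
    Matrix (Fin 4) (Fin 4) ℂ :=
  Matrix.of fun a α => (lower g e a α : ℂ)

lemma frameTensor_eq_mul (C : Matrix (Fin 4) (Fin 4) ℂ) :
    frameTensor g e C = (lowerMatrix g e).transpose * C * lowerMatrix g e := by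
  ext α β
  simp only [frameTensor, Matrix.mul_apply, lowerMatrix, Matrix.transpose_apply, Matrix.of_apply,
    Finset.sum_mul]
  rw [Finset.sum_comm]
  exact Finset.sum_congr rfl fun b _ => Finset.sum_congr rfl fun a _ => by ring

lemma mul2_eq_mul (F K : Matrix (Fin 4) (Fin 4) ℂ) :
    mul2 g F K = F * (g⁻¹).map Complex.ofReal * K := by
  ext α β
  simp only [mul2, Matrix.mul_apply, Matrix.map_apply, Finset.sum_mul]
  rw [Finset.sum_comm]

lemma IsOrthonormal.lowerMatrix_inv (he : IsOrthonormal g e) :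
    lowerMatrix g e * (g⁻¹).map Complex.ofReal * (lowerMatrix g e).transpose = sgnC := by
  ext a b
  rw [← he.sum_inv_lower_lower a b]
  simp only [Matrix.mul_apply, Matrix.map_apply, Finset.sum_mul, lowerMatrix, Matrix.of_apply,
    Matrix.transpose_apply]
  rw [Finset.sum_comm]

/-- In an orthonormal frame the inverse metric is the signature matrix, so contractions become
products of constant matrices. -/
lemma IsOrthonormal.mul2_frameTensor (he : IsOrthonormal g e) (C D : Matrix (Fin 4) (Fin 4) ℂ) :
    mul2 g (frameTensor g e C) (frameTensor g e D) = frameTensor g e (C * sgnC * D) := by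
  rw [frameTensor_eq_mul, frameTensor_eq_mul, frameTensor_eq_mul, mul2_eq_mul,
    ← he.lowerMatrix_inv]
  simp only [Matrix.mul_assoc]
  rfl

/-- The frame components of the unnormalized self-dual triad. -/
def triadCoeff : Fin 3 → Matrix (Fin 4) (Fin 4) ℂ :=
  ![!![0, 1, 0, 0; -1, 0, 0, 0; 0, 0, 0, -Complex.I; 0, 0, Complex.I, 0],
    !![0, 0, 1, 0; 0, 0, 0, Complex.I; -1, 0, 0, 0; 0, -Complex.I, 0, 0],
    !![0, 0, 0, 1; 0, 0, -Complex.I, 0; 0, Complex.I, 0, 0; -1, 0, 0, 0]]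

lemma IsOrientedOrthonormal.triad_eq (hη : IsVolumeSymbol η)
    (he : IsOrientedOrthonormal g η e) (i : Fin 3) :
    triad g η e i = frameTensor g e (isq • triadCoeff i) := by
  rw [frameTensor_smul]
  fin_cases i
  · change triad g η e 0 = _
    rw [he.triad_zero hη, selfDualWedge_eq]
    congr 1
    ext α β
    rw [rawWedge_apply]
    simp [frameTensor, triadCoeff, Fin.sum_univ_four]
    ring
  · change triad g η e 1 = _
    rw [he.triad_one hη, selfDualWedge_eq]
    congr 1
    ext α β
    rw [rawWedge_apply]
    simp [frameTensor, triadCoeff, Fin.sum_univ_four]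
    ring
  · change triad g η e 2 = _
    rw [he.triad_two hη, selfDualWedge_eq]
    congr 1
    ext α β
    rw [rawWedge_apply]
    simp [frameTensor, triadCoeff, Fin.sum_univ_four]
    ring

/-- The frame components of `𝓛₊`. -/
def lpCoeff : Matrix (Fin 4) (Fin 4) ℂ :=
  (1 / 2 : ℂ) • !![0, 0, 1, Complex.I; 0, 0, 1, Complex.I; -1, -1, 0, 0;
    -Complex.I, -Complex.I, 0, 0]

/-- The frame components of `𝓛₋`. -/
def lmCoeff : Matrix (Fin 4) (Fin 4) ℂ :=
  (1 / 2 : ℂ) • !![0, 0, 1, -Complex.I; 0, 0, -1, Complex.I; -1, 1, 0, 0;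
    Complex.I, -Complex.I, 0, 0]

lemma IsOrientedOrthonormal.triadLp_frameTensor (hη : IsVolumeSymbol η)
    (he : IsOrientedOrthonormal g η e) : triadLp (triad g η e) = frameTensor g e lpCoeff := by
  rw [triadLp, he.triad_eq hη, he.triad_eq hη, lpCoeff, ← isq_sq, ← frameTensor_smul,
    ← frameTensor_add, ← frameTensor_smul, smul_comm Complex.I, ← smul_add, smul_smul]
  congr 2
  ext a b
  fin_cases a <;> fin_cases b <;> simp [triadCoeff]

lemma IsOrientedOrthonormal.triadLm_frameTensor (hη : IsVolumeSymbol η)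
    (he : IsOrientedOrthonormal g η e) : triadLm (triad g η e) = frameTensor g e lmCoeff := by
  rw [triadLm, he.triad_eq hη, he.triad_eq hη, lmCoeff, ← isq_sq, ← frameTensor_smul,
    ← frameTensor_sub, ← frameTensor_smul, smul_comm Complex.I, ← smul_sub, smul_smul]
  congr 2
  ext a b
  fin_cases a <;> fin_cases b <;> simp [triadCoeff]

lemma IsOrthonormal.metric_frameTensor (hs : g.IsSymm) (he : IsOrthonormal g e) (α β : Fin 4) :
    (g α β : ℂ) = frameTensor g e sgnC α β := by
  rw [he.metric_apply hs]
  simp [frameTensor, sgnC, Fin.sum_univ_four, sg]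

/-- The null terms combine to those of `u_2` and `u_3`, so the triad enters through `2 ∑ u_A · ū_A`,
which is insensitive to spatial rotations. Its components are `diag(-3, -1, -1, -1)`, and adding the
metric leaves `-4` in the time direction only. -/
lemma frame_zero_matrix : (-(1 / 4) : ℂ) •
    ((2 : ℂ) • (lpCoeff * sgnC * lpCoeff.map (starRingEnd ℂ))
      + (2 : ℂ) • (lmCoeff * sgnC * lmCoeff.map (starRingEnd ℂ))
      + triadCoeff 0 * sgnC * (triadCoeff 0).map (starRingEnd ℂ) + sgnC) =
    Matrix.of fun a b => if a = 0 ∧ b = 0 then 1 else 0 := by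
  ext a b
  simp only [Matrix.smul_apply, Matrix.add_apply, Matrix.mul_apply, Fin.sum_univ_four,
    Matrix.map_apply, Matrix.of_apply, sgnC, Matrix.diagonal_apply, lpCoeff, lmCoeff]
  fin_cases a <;> fin_cases b <;> simp [triadCoeff, map_ofNat (starRingEnd ℂ)] <;>
    ring_nf <;> simp
  norm_num

/-- The product `θ_0 ⊗ θ_0` of a frame in terms of the self-dual bivectors. -/
def timeSquare (g : Matrix (Fin 4) (Fin 4) ℝ) (U Lp Lm : Tensor2) : Tensor2 := fun α β =>
  -(1 / 4) * (2 * mul2 g Lp (conj2 Lp) α β + 2 * mul2 g Lm (conj2 Lm) α β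
    + 2 * mul2 g U (conj2 U) α β + (g α β : ℂ))

lemma mul2_conj_smul (c : ℝ) (hc : c * c = 1) (F : Tensor2) :
    mul2 g ((c : ℂ) • F) (conj2 ((c : ℂ) • F)) = mul2 g F (conj2 F) := by
  ext α β
  simp only [mul2, conj2, Pi.smul_apply, smul_eq_mul, map_mul, Complex.conj_ofReal]
  have hc' : (c : ℂ) * c = 1 := by exact_mod_cast hc
  refine Finset.sum_congr rfl fun μ _ => Finset.sum_congr rfl fun ν _ => ?_
  linear_combination (F α μ * ((g⁻¹ μ ν : ℝ) : ℂ) * (starRingEnd ℂ) (F ν β)) * hc'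

lemma IsOrientedOrthonormal.timeSquare_eq (hs : g.IsSymm) (hη : IsVolumeSymbol η)
    (he : IsOrientedOrthonormal g η e) {c d c' : ℝ} (hc : c * c = 1) (hd : d * d = 1)
    (hc' : c' * c' = 1) (α β : Fin 4) :
    timeSquare g ((c : ℂ) • triad g η e 0) ((d : ℂ) • triadLp (triad g η e))
      ((c' : ℂ) • triadLm (triad g η e)) α β = lower g e 0 α * lower g e 0 β := by
  have he' := he.orthonormal
  have h1 : 2 * mul2 g (triad g η e 0) (conj2 (triad g η e 0)) α β =
      frameTensor g e (triadCoeff 0 * sgnC * (triadCoeff 0).map (starRingEnd ℂ)) α β := by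
    rw [he.triad_eq hη, frameTensor_smul]
    have : conj2 (isq • frameTensor g e (triadCoeff 0)) =
        isq • conj2 (frameTensor g e (triadCoeff 0)) := by
      ext; simp [conj2, conj_isq]
    rw [this, conj2_frameTensor, ← he'.mul2_frameTensor]
    simp only [mul2, Pi.smul_apply, smul_eq_mul, Finset.mul_sum]
    refine Finset.sum_congr rfl fun μ _ => Finset.sum_congr rfl fun ν _ => ?_
    linear_combination 2 * (frameTensor g e (triadCoeff 0) α μ * ((g⁻¹ μ ν : ℝ) : ℂ) *
      frameTensor g e ((triadCoeff 0).map (starRingEnd ℂ)) ν β) * isq_sq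
  have h2 := congrArg (fun C => frameTensor g e C α β) frame_zero_matrix
  simp only [frameTensor_smul, frameTensor_add, Pi.smul_apply, Pi.add_apply, smul_eq_mul] at h2
  rw [timeSquare, mul2_conj_smul c hc, mul2_conj_smul d hd, mul2_conj_smul c' hc', h1,
    he.triadLp_frameTensor hη, he.triadLm_frameTensor hη, conj2_frameTensor, conj2_frameTensor,
    he'.mul2_frameTensor, he'.mul2_frameTensor, he'.metric_frameTensor hs]
  refine h2.trans ?_
  simp [frameTensor, Fin.sum_univ_four]

/-- The vector `2 F^μ_β v^β`. -/
def applyUp (g : Matrix (Fin 4) (Fin 4) ℝ) (F : Tensor2) (v : Fin 4 → ℂ) (μ : Fin 4) : ℂ :=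
  ∑ α, ((g⁻¹ μ α : ℝ) : ℂ) * ∑ β, F α β * v β

lemma IsOrthonormal.applyUp_frameTensor (he : IsOrthonormal g e) (C : Matrix (Fin 4) (Fin 4) ℂ)
    (v : Fin 4 → ℂ) (μ : Fin 4) :
    applyUp g (frameTensor g e C) (fun β => ∑ c, v c * (e c β : ℂ)) μ =
      ∑ a, (∑ b, ∑ c, C a b * sgnC b c * v c) * (e a μ : ℂ) := by
  have h1 : ∀ b c, ∑ β, (lower g e b β : ℂ) * (e c β : ℂ) = sgnC b c := fun b c => by
    rw [sgnC_apply, ← he.sum_lower]; push_cast; rfl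
  have h2 : ∀ a, ∑ α, ((g⁻¹ μ α : ℝ) : ℂ) * (lower g e a α : ℂ) = (e a μ : ℂ) := fun a => by
    rw [← he.inv_metric_lower]; push_cast; rfl
  simp only [← h1, ← h2, applyUp, frameTensor, Fin.sum_univ_four]
  ring

/-- Together with `applyUp_conj` this rebuilds the whole frame from `e_0` and `𝓛₊` by algebraic,
hence smooth, operations. -/
lemma IsOrientedOrthonormal.applyUp_time (hη : IsVolumeSymbol η)
    (he : IsOrientedOrthonormal g η e) (μ : Fin 4) :
    2 * applyUp g (triadLp (triad g η e)) (fun β => (e 0 β : ℂ)) μ =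
      (e 2 μ : ℂ) + Complex.I * (e 3 μ : ℂ) := by
  have h := he.orthonormal.applyUp_frameTensor lpCoeff ![1, 0, 0, 0] μ
  rw [← he.triadLp_frameTensor hη] at h
  rw [show (fun β => (e 0 β : ℂ)) = fun β => ∑ c, ![1, 0, 0, 0] c * (e c β : ℂ) by
    ext β; simp [Fin.sum_univ_four], h]
  simp [Fin.sum_univ_four, lpCoeff, sgnC]
  ring

lemma IsOrientedOrthonormal.applyUp_conj (hη : IsVolumeSymbol η)
    (he : IsOrientedOrthonormal g η e) (μ : Fin 4) :
    applyUp g (triadLp (triad g η e)) (fun β => (e 2 β : ℂ) - Complex.I * (e 3 β : ℂ)) μ =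
      (e 0 μ : ℂ) + (e 1 μ : ℂ) := by
  have h := he.orthonormal.applyUp_frameTensor lpCoeff ![0, 0, 1, -Complex.I] μ
  rw [← he.triadLp_frameTensor hη] at h
  rw [show (fun β => (e 2 β : ℂ) - Complex.I * (e 3 β : ℂ)) =
      fun β => ∑ c, ![0, 0, 1, -Complex.I] c * (e c β : ℂ) by
    ext β; simp [Fin.sum_univ_four]; ring, h]
  simp [Fin.sum_univ_four, lpCoeff, sgnC]
  ring_nf
  simp
  ring

/-- The change of signs of the vectors of a frame that does not affect `𝓤`. -/
def signChange (c d : ℝ) : Matrix (Fin 4) (Fin 4) ℝ := Matrix.diagonal ![c, c, c * d, c * d]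

/-- `c` is the sign left open for `e_0`, `d` the one for `𝓛₊`. The determinant `c² (cd)²` is `1`,
`𝓤` is quadratic in signs that cancel, and `𝓛₊ ⊗ 𝓛₊` is unchanged, so the canonical form survives.
-/
lemma IsOrientedOrthonormal.sign_change (hη : IsVolumeSymbol η)
    (he : IsOrientedOrthonormal g η e) {c d : ℝ} (hc : c * c = 1) (hd : d * d = 1) :
    IsOrientedOrthonormal g η (mulFrame (signChange c d) e) ∧
      triad g η (mulFrame (signChange c d) e) 0 = triad g η e 0 ∧
      triadLp (triad g η (mulFrame (signChange c d) e)) = (d : ℂ) • triadLp (triad g η e) := by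
  have hcd : c * d * (c * d) = 1 := by linear_combination d * d * hc + hd
  have hc' : (c : ℂ) * c = 1 := by exact_mod_cast hc
  have hd' : (d : ℂ) * d = 1 := by exact_mod_cast hd
  have h1 : signChange c d * sgn * (signChange c d).transpose = sgn := by
    refine mul_sgn_mul_transpose fun a b => ?_
    fin_cases a <;> fin_cases b <;> simp [signChange, signature, hc, hcd]
  have h2 : (signChange c d).det = 1 := by
    rw [signChange, Matrix.det_diagonal, Fin.prod_univ_four]
    simp
    linear_combination hcd + (c * d) * (c * d) * hc
  have he' : IsOrientedOrthonormal g η (mulFrame (signChange c d) e) := he.transform hη _ h1 h2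
  have hl : ∀ a μ, lower g (mulFrame (signChange c d) e) a μ =
    ∑ b, signChange c d a b * lower g e b μ := lower_mulFrame _
  refine ⟨he', ?_, ?_⟩
  · rw [IsOrientedOrthonormal.triad_zero hη he', he.triad_zero hη, selfDualWedge_eq,
      selfDualWedge_eq]
    congr 1
    ext α β
    simp only [rawWedge_apply, hl, Fin.sum_univ_four]
    simp [signChange]
    linear_combination (lower g e 0 α * lower g e 1 β - lower g e 0 β * lower g e 1 α : ℂ) * hc'
      - Complex.I * (lower g e 2 α * lower g e 3 β - lower g e 2 β * lower g e 3 α : ℂ)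
        * (hc' * (d : ℂ) ^ 2 + hd')
  · rw [he.triadLp_eq hη, IsOrientedOrthonormal.triadLp_eq hη he', smul_comm _ (1 / 2 : ℂ)]
    congr 1
    ext α β
    simp only [rawWedge_apply, Pi.add_apply, Pi.smul_apply, smul_eq_mul, hl, Fin.sum_univ_four]
    simp [signChange]
    linear_combination ((d : ℂ) * ((lower g e 0 α * lower g e 2 β - lower g e 0 β * lower g e 2 α)
      - Complex.I * (lower g e 3 α * lower g e 1 β - lower g e 3 β * lower g e 1 α)
      + Complex.I * ((lower g e 0 α * lower g e 3 β - lower g e 0 β * lower g e 3 α)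
      - Complex.I * (lower g e 1 α * lower g e 2 β - lower g e 1 β * lower g e 2 α)))) * hc'

end

/-! ### Smoothness of the algebraic operations -/

section Smoothness

variable {g : Coord → Matrix (Fin 4) (Fin 4) ℝ} {O : Set Coord} {n : WithTop ℕ∞}

lemma contDiffOn_tensor2 {F : Coord → Tensor2} :
    ContDiffOn ℝ n F O ↔ ∀ α β, ContDiffOn ℝ n (fun y => F y α β) O := by
  rw [contDiffOn_pi]
  exact forall_congr' fun α => contDiffOn_pi

lemma contDiffOn_tensor4 {A : Coord → Tensor4} :
    ContDiffOn ℝ n A O ↔ ∀ α β μ ν, ContDiffOn ℝ n (fun y => A y α β μ ν) O := by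
  rw [contDiffOn_pi]
  refine forall_congr' fun α => ?_
  rw [contDiffOn_pi]
  exact forall_congr' fun β => contDiffOn_tensor2

lemma _root_.ContDiffOn.ofReal {f : Coord → ℝ} (hf : ContDiffOn ℝ n f O) :
    ContDiffOn ℝ n (fun y => (f y : ℂ)) O :=
  Complex.ofRealCLM.contDiff.comp_contDiffOn hf

lemma _root_.ContDiffOn.conj {f : Coord → ℂ} (hf : ContDiffOn ℝ n f O) :
    ContDiffOn ℝ n (fun y => (starRingEnd ℂ) (f y)) O :=
  Complex.conjCLE.contDiff.comp_contDiffOn hf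

lemma _root_.ContDiffOn.div_complex {f h : Coord → ℂ} (hf : ContDiffOn ℝ n f O)
    (hh : ContDiffOn ℝ n h O) (h0 : ∀ y ∈ O, h y ≠ 0) : ContDiffOn ℝ n (fun y => f y / h y) O := by
  simp only [div_eq_mul_inv]
  exact hf.mul (hh.inv h0)

variable (hg : IsMetricOn g O) (hn : n ≤ ∞)
include hg hn

lemma IsMetricOn.inv_ofReal (μ ν : Fin 4) :
    ContDiffOn ℝ n (fun y => (((g y)⁻¹ μ ν : ℝ) : ℂ)) O :=
  ((hg.inv μ ν).of_le hn).ofReal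

lemma IsMetricOn.raise {F : Coord → Tensor2} (hF : ContDiffOn ℝ n F O) :
    ContDiffOn ℝ n (fun y => raise (g y) (F y)) O := by
  rw [contDiffOn_tensor2] at hF ⊢
  exact fun μ ν => ContDiffOn.sum fun α _ => ContDiffOn.sum fun β _ =>
    ((hg.inv_ofReal hn _ _).mul (hg.inv_ofReal hn _ _)).mul (hF _ _)

lemma IsMetricOn.raise_apply {F : Coord → Tensor2} (hF : ContDiffOn ℝ n F O) (μ ν : Fin 4) :
    ContDiffOn ℝ n (fun y => Spacetime4.raise (g y) (F y) μ ν) O :=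
  contDiffOn_tensor2.1 (hg.raise hn hF) μ ν

lemma IsMetricOn.act {A : Coord → Tensor4} {F : Coord → Tensor2} (hA : ContDiffOn ℝ n A O)
    (hF : ContDiffOn ℝ n F O) : ContDiffOn ℝ n (fun y => act (g y) (A y) (F y)) O := by
  rw [contDiffOn_tensor2]
  exact fun α β => contDiffOn_const.mul <| ContDiffOn.sum fun μ _ => ContDiffOn.sum fun ν _ =>
    (contDiffOn_tensor4.1 hA _ _ _ _).mul (hg.raise_apply hn hF _ _)

lemma IsMetricOn.eval {A : Coord → Tensor4} {F K : Coord → Tensor2} (hA : ContDiffOn ℝ n A O)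
    (hF : ContDiffOn ℝ n F O) (hK : ContDiffOn ℝ n K O) :
    ContDiffOn ℝ n (fun y => eval (g y) (A y) (F y) (K y)) O :=
  contDiffOn_const.mul <| ContDiffOn.sum fun _ _ => ContDiffOn.sum fun _ _ =>
    ContDiffOn.sum fun _ _ => ContDiffOn.sum fun _ _ =>
    ((contDiffOn_tensor4.1 hA _ _ _ _).mul (hg.raise_apply hn hF _ _)).mul
      (hg.raise_apply hn hK _ _)

lemma IsMetricOn.comp {A B : Coord → Tensor4} (hA : ContDiffOn ℝ n A O)
    (hB : ContDiffOn ℝ n B O) : ContDiffOn ℝ n (fun y => comp (g y) (A y) (B y)) O := by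
  rw [contDiffOn_tensor4]
  refine fun α β μ ν => contDiffOn_const.mul <| ContDiffOn.sum fun l _ => ContDiffOn.sum fun r _ =>
    (contDiffOn_tensor4.1 hA _ _ _ _).mul (hg.raise_apply hn ?_ _ _)
  exact contDiffOn_tensor2.2 fun κ τ => contDiffOn_tensor4.1 hB κ τ μ ν

lemma IsMetricOn.trace {A : Coord → Tensor4} (hA : ContDiffOn ℝ n A O) :
    ContDiffOn ℝ n (fun y => trace (g y) (A y)) O := by
  refine contDiffOn_const.mul <| ContDiffOn.sum fun μ _ => ContDiffOn.sum fun ν _ =>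
    hg.raise_apply hn (F := fun y κ τ => A y κ τ μ ν) ?_ μ ν
  exact contDiffOn_tensor2.2 fun κ τ => contDiffOn_tensor4.1 hA κ τ μ ν

lemma IsMetricOn.mul2 {F K : Coord → Tensor2} (hF : ContDiffOn ℝ n F O)
    (hK : ContDiffOn ℝ n K O) : ContDiffOn ℝ n (fun y => mul2 (g y) (F y) (K y)) O := by
  rw [contDiffOn_tensor2] at hF hK ⊢
  exact fun α β => ContDiffOn.sum fun μ _ => ContDiffOn.sum fun ν _ =>
    ((hF _ _).mul (hg.inv_ofReal hn _ _)).mul (hK _ _)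

omit hg hn in
lemma contDiffOn_tensor {F K : Coord → Tensor2} (hF : ContDiffOn ℝ n F O)
    (hK : ContDiffOn ℝ n K O) : ContDiffOn ℝ n (fun y => tensor (F y) (K y)) O := by
  rw [contDiffOn_tensor2] at hF hK
  exact contDiffOn_tensor4.2 fun _ _ _ _ => (hF _ _).mul (hK _ _)

omit hg hn in
lemma contDiffOn_conj2 {F : Coord → Tensor2} (hF : ContDiffOn ℝ n F O) :
    ContDiffOn ℝ n (fun y => conj2 (F y)) O := by
  rw [contDiffOn_tensor2] at hF ⊢
  exact fun _ _ => (hF _ _).conj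

lemma IsMetricOn.rho {W : Coord → Tensor4} (hW : ContDiffOn ℝ n W O)
    (ha : ∀ y ∈ O, scalarA (g y) (W y) ≠ 0) : ContDiffOn ℝ n (fun y => rho (g y) (W y)) O :=
  (hg.trace hn (hg.comp hn (hg.comp hn hW hW) hW)).neg.div_complex
    (hg.trace hn (hg.comp hn hW hW)) ha

lemma IsMetricOn.concP {G W : Coord → Tensor4} (hG : ContDiffOn ℝ n G O) (hW : ContDiffOn ℝ n W O)
    (ha : ∀ y ∈ O, scalarA (g y) (W y) ≠ 0) :
    ContDiffOn ℝ n (fun y => concP (g y) (G y) (W y)) O :=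
  hg.comp hn (hW.sub ((hg.rho hn hW ha).smul hG)) (hW.sub ((hg.rho hn hW ha).smul hG))

lemma IsMetricOn.concQ {G W : Coord → Tensor4} (hG : ContDiffOn ℝ n G O) (hW : ContDiffOn ℝ n W O)
    (ha : ∀ y ∈ O, scalarA (g y) (W y) ≠ 0) (hr : ∀ y ∈ O, Spacetime4.rho (g y) (W y) ≠ 0) :
    ContDiffOn ℝ n (fun y => concQ (g y) (G y) (W y)) O :=
  (contDiffOn_const.div_complex (contDiffOn_const.mul (hg.rho hn hW ha)) fun y hy =>
    mul_ne_zero three_ne_zero (hr y hy)).smul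
    (hg.comp hn (hW.sub ((hg.rho hn hW ha).smul hG))
      (hW.add ((contDiffOn_const.mul (hg.rho hn hW ha)).smul hG)))

lemma IsMetricOn.lMinus {G : Coord → Tensor4} {U L Z : Coord → Tensor2} (hG : ContDiffOn ℝ n G O)
    (hU : ContDiffOn ℝ n U O) (hL : ContDiffOn ℝ n L O) (hZ : ContDiffOn ℝ n Z O)
    (h0 : ∀ y ∈ O, Spacetime4.eval (g y) (G y) (L y) (Z y) ≠ 0) :
    ContDiffOn ℝ n (fun y => lMinus (g y) (G y) (U y) (L y) (Z y)) O := by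
  have hS := hG.add (contDiffOn_tensor hU hU)
  have hE := hg.eval hn hG hL hZ
  exact (contDiffOn_const.div_complex (contDiffOn_const.mul (hE.pow 2)) fun y hy =>
    mul_ne_zero two_ne_zero (pow_ne_zero 2 (h0 y hy))).smul
    (((hg.eval hn hS hZ hZ).smul hL).sub ((contDiffOn_const.mul hE).smul (hg.act hn hS hZ)))

lemma IsMetricOn.timeSquare {U L L' : Coord → Tensor2} (hU : ContDiffOn ℝ n U O)
    (hL : ContDiffOn ℝ n L O) (hL' : ContDiffOn ℝ n L' O) :
    ContDiffOn ℝ n (fun y => timeSquare (g y) (U y) (L y) (L' y)) O := by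
  rw [contDiffOn_tensor2]
  intro α β
  have h : ∀ {F : Coord → Tensor2}, ContDiffOn ℝ n F O →
      ContDiffOn ℝ n (fun y => 2 * Spacetime4.mul2 (g y) (F y) (conj2 (F y)) α β) O := fun hF =>
    contDiffOn_const.mul (contDiffOn_tensor2.1 (hg.mul2 hn hF (contDiffOn_conj2 hF)) α β)
  exact contDiffOn_const.mul ((((h hL).add (h hL')).add (h hU)).add
    ((hg.smooth α β).of_le hn).ofReal)

lemma IsMetricOn.applyUp {F : Coord → Tensor2} {v : Coord → Fin 4 → ℂ} (hF : ContDiffOn ℝ n F O)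
    (hv : ∀ μ, ContDiffOn ℝ n (fun y => v y μ) O) (μ : Fin 4) :
    ContDiffOn ℝ n (fun y => applyUp (g y) (F y) (v y) μ) O :=
  ContDiffOn.sum fun _ _ => (hg.inv_ofReal hn _ _).mul <| ContDiffOn.sum fun _ _ =>
    (contDiffOn_tensor2.1 hF _ _).mul (hv _)

end Smoothness

/-! ### Smoothness of the self-dual metric and of the self-dual Weyl tensor -/

section Chart

variable {M : Type*} [TopologicalSpace M] [ChartedSpace Coord M] [IsManifold 𝓘(ℝ, Coord) ∞ M]
  {φ : OpenPartialHomeomorph M Coord} (S : Spacetime M)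
  (hφ : φ ∈ IsManifold.maximalAtlas 𝓘(ℝ, Coord) ∞ M)
include hφ

lemma Spacetime.G_smooth : ContDiffOn ℝ ∞ (S.G φ) φ.target := by
  have hg := (S.isMetricOn hφ).smooth
  rw [contDiffOn_tensor4]
  exact fun α β μ ν => contDiffOn_const.mul
    ((((hg _ _).mul (hg _ _)).sub ((hg _ _).mul (hg _ _))).ofReal.sub
      (contDiffOn_const.mul (S.η_smooth hφ α β μ ν).ofReal))

lemma Spacetime.W_smooth : ContDiffOn ℝ ∞ (S.W φ) φ.target := by
  have hg := S.isMetricOn hφ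
  rw [contDiffOn_tensor4]
  intro α β μ ν
  have hη : ContDiffOn ℝ ∞ (fun y α β μ ν => (S.η φ y α β μ ν : ℂ) : Coord → Tensor4) φ.target :=
    contDiffOn_tensor4.2 fun α β μ ν => (S.η_smooth hφ α β μ ν).ofReal
  have hw : ContDiffOn ℝ ∞ (fun y l r => (weyl (S.g φ) l r μ ν y : ℂ) : Coord → Tensor2)
      φ.target := contDiffOn_tensor2.2 fun l r => (hg.weyl l r μ ν).ofReal
  exact contDiffOn_const.mul ((hg.weyl α β μ ν).ofReal.sub
    (contDiffOn_const.mul (contDiffOn_tensor2.1 (hg.act le_rfl hη hw) α β)))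

end Chart

/-- A smooth symmetric tensor of rank one is locally the square of a smooth vector. -/
lemma exists_smooth_root {ι : Type*} {O : Set Coord} (hO : IsOpen O) {y : Coord} (hy : y ∈ O)
    {K : Coord → ι → ι → ℂ} (hK : ∀ i j, ContDiffOn ℝ ∞ (fun z => K z i j) O)
    {u : Coord → ι → ℂ} (hu : ∀ z ∈ O, ∀ i j, K z i j = u z i * u z j) (h0 : u y ≠ 0) :
    ∃ V, IsOpen V ∧ y ∈ V ∧ V ⊆ O ∧ ∃ u' : Coord → ι → ℂ,
      (∀ i, ContDiffOn ℝ ∞ (fun z => u' z i) V) ∧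
      ∀ z ∈ V, ∃ c : ℝ, c * c = 1 ∧ u' z = (c : ℂ) • u z := by
  obtain ⟨a, ha⟩ := Function.ne_iff.1 h0
  -- Dividing by `c₀²` moves the value of `K a a` at `y` to `1`, away from the cut of the logarithm;
  -- the square root is then `c₀ exp(log(·) / 2)`, and the remaining components are `K i a` divided
  -- by it.
  set c₀ := u y a
  have hc₀ : c₀ ≠ 0 := ha
  have hq : ContDiffOn ℝ ∞ (fun z => K z a a / c₀ ^ 2) O := (hK a a).div_const _
  refine ⟨O ∩ (fun z => K z a a / c₀ ^ 2) ⁻¹' Complex.slitPlane,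
    hq.continuousOn.isOpen_inter_preimage hO Complex.isOpen_slitPlane, ⟨hy, ?_⟩,
    Set.inter_subset_left,
    fun z i => K z i a / (c₀ * Complex.exp ((1 / 2) * Complex.log (K z a a / c₀ ^ 2))), ?_, ?_⟩
  · have : K y a a / c₀ ^ 2 = 1 := by
      rw [hu y hy, ← pow_two]; exact div_self (pow_ne_zero 2 hc₀)
    rw [Set.mem_preimage, this]
    exact Complex.one_mem_slitPlane
  · intro i
    have hlog : ContDiffOn ℝ ∞ (fun z => Complex.log (K z a a / c₀ ^ 2))
        (O ∩ (fun z => K z a a / c₀ ^ 2) ⁻¹' Complex.slitPlane) := fun z hz =>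
      ((Complex.contDiffAt_log hz.2).restrict_scalars ℝ).comp_contDiffWithinAt (g := Complex.log) z
        ((hq z hz.1).mono Set.inter_subset_left)
    refine ((hK i a).mono Set.inter_subset_left).div_complex
      (contDiffOn_const.mul (contDiffOn_const.mul hlog).cexp) fun z _ =>
        mul_ne_zero hc₀ (Complex.exp_ne_zero _)
  · rintro z ⟨hz, hz'⟩
    set w := c₀ * Complex.exp ((1 / 2) * Complex.log (K z a a / c₀ ^ 2)) with hw
    have hw0 : w ≠ 0 := mul_ne_zero hc₀ (Complex.exp_ne_zero _)
    have hw2 : w ^ 2 = u z a ^ 2 := by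
      rw [hw, mul_pow, ← Complex.exp_nat_mul]
      have : ((2 : ℕ) : ℂ) * ((1 / 2) * Complex.log (K z a a / c₀ ^ 2)) =
          Complex.log (K z a a / c₀ ^ 2) := by push_cast; ring
      rw [this, Complex.exp_log (Complex.slitPlane_ne_zero hz')]
      change c₀ ^ 2 * (K z a a / c₀ ^ 2) = _
      rw [hu z hz]
      field_simp
    rcases sq_eq_sq_iff_eq_or_eq_neg.1 hw2 with h | h
    · refine ⟨1, by norm_num, ?_⟩
      ext i
      change K z i a / w = _
      rw [hu z hz, ← h, mul_div_assoc, div_self hw0]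
      simp
    · refine ⟨-1, by norm_num, ?_⟩
      ext i
      change K z i a / w = _
      have h' : u z a = -w := by rw [h, neg_neg]
      rw [hu z hz, h', mul_div_assoc, neg_div, div_self hw0]
      simp

/-! ### Smooth principal frames -/

lemma IsOrthonormal.raise_lower {g : Matrix (Fin 4) (Fin 4) ℝ} {e : Fin 4 → Fin 4 → ℝ}
    (he : IsOrthonormal g e) {T : Tensor2}
    (hT : ∀ α β, T α β = lower g e 0 α * lower g e 0 β) (μ ν : Fin 4) :
    raise g T μ ν = (e 0 μ : ℂ) * (e 0 ν : ℂ) := by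
  rw [← he.inv_metric_lower 0 μ, ← he.inv_metric_lower 0 ν]
  push_cast
  simp only [raise, hT]
  rw [Finset.sum_mul]
  exact Finset.sum_congr rfl fun α _ => by
    rw [Finset.mul_sum]
    exact Finset.sum_congr rfl fun β _ => by ring

lemma mulFrame_signChange (c d : ℝ) (e : Fin 4 → Fin 4 → ℝ) (μ : Fin 4) :
    mulFrame (signChange c d) e 0 μ = c * e 0 μ ∧ mulFrame (signChange c d) e 1 μ = c * e 1 μ ∧
    mulFrame (signChange c d) e 2 μ = c * d * e 2 μ ∧
    mulFrame (signChange c d) e 3 μ = c * d * e 3 μ := by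
  simp [mulFrame, signChange, Fin.sum_univ_four]

lemma applyUp_smul (g : Matrix (Fin 4) (Fin 4) ℝ) (c d : ℂ) (F : Tensor2) (v : Fin 4 → ℂ)
    (μ : Fin 4) : applyUp g (c • F) (fun β => d * v β) μ = c * d * applyUp g F v μ := by
  simp only [applyUp, Pi.smul_apply, smul_eq_mul, Finset.mul_sum]
  exact Finset.sum_congr rfl fun α _ => Finset.sum_congr rfl fun β _ => by ring

lemma IsTriad.dot_Lm_ne_zero {g : Matrix (Fin 4) (Fin 4) ℝ} {u : Fin 3 → Tensor2}
    (hu : IsTriad g u) : dot g (triadLp u) (triadLm u) ≠ 0 := by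
  rw [hu.dot_Lp_Lm]
  norm_num

/-- A smooth double bivector of rank one is locally the square of a smooth bivector. -/
lemma exists_smooth_root_tensor {O : Set Coord} (hO : IsOpen O) {y : Coord} (hy : y ∈ O)
    {A : Coord → Tensor4} (hA : ContDiffOn ℝ ∞ A O) {F : Coord → Tensor2}
    (hF : ∀ z ∈ O, A z = tensor (F z) (F z)) (h0 : F y ≠ 0) :
    ∃ V, IsOpen V ∧ y ∈ V ∧ V ⊆ O ∧ ∃ F' : Coord → Tensor2, ContDiffOn ℝ ∞ F' V ∧
      ∃ c : Coord → ℝ, ∀ z ∈ V, c z * c z = 1 ∧ F' z = (c z : ℂ) • F z := by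
  obtain ⟨V, hV, hyV, hVO, L, hL, hLe⟩ := exists_smooth_root (ι := Fin 4 × Fin 4) hO hy
    (K := fun z i j => A z i.1 i.2 j.1 j.2) (fun i j => contDiffOn_tensor4.1 hA _ _ _ _)
    (u := fun z i => F z i.1 i.2) (fun z hz i j => by rw [hF z hz]; rfl)
    (fun h => h0 (by ext α β; exact congrFun h (α, β)))
  choose! c hc hLe using hLe
  exact ⟨V, hV, hyV, hVO, fun z α β => L z (α, β), contDiffOn_tensor2.2 fun α β => hL (α, β), c,
    fun z hz => ⟨hc z hz, by ext α β; exact congrFun (hLe z hz) (α, β)⟩⟩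

section Chart

variable {M : Type*} [TopologicalSpace M] [ChartedSpace Coord M] [IsManifold 𝓘(ℝ, Coord) ∞ M]
  {φ : OpenPartialHomeomorph M Coord} (S : Spacetime M)

lemma IsMetricOn.mono {g : Coord → Matrix (Fin 4) (Fin 4) ℝ} {O V : Set Coord}
    (hg : IsMetricOn g O) (hV : IsOpen V) (hVO : V ⊆ O) : IsMetricOn g V :=
  ⟨hV, fun μ ν => (hg.smooth μ ν).mono hVO, fun z hz => hg.symm z (hVO hz),
    fun z hz => hg.unit z (hVO hz)⟩

/-- Principal frames at the points of an open set yield a smooth one locally. -/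
lemma Spacetime.exists_smooth_frame (hφ : φ ∈ IsManifold.maximalAtlas 𝓘(ℝ, Coord) ∞ M)
    {Ω : Set Coord} (hΩ : IsOpen Ω) (hΩφ : Ω ⊆ φ.target)
    (hII : ∀ y ∈ Ω, IsTypeII (S.g φ y) (S.G φ y) (S.W φ y)) {y : Coord} (hy : y ∈ Ω) :
    ∃ V : Set Coord, IsOpen V ∧ y ∈ V ∧ V ⊆ Ω ∧ ∃ E : Coord → Fin 4 → Fin 4 → ℝ,
      ContDiffOn ℝ ∞ E V ∧
        ∀ z ∈ V, IsWeylPrincipalFrame (S.g φ z) (S.η φ z) (S.W φ z) (E z) := by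
  -- These frames are chosen point by point with no continuity. They serve only to identify smooth
  -- tensors up to sign.
  have hex := fun z hz => S.exists_canonical hφ (hΩφ hz) (hII z hz)
  choose! e r hr he hc using hex
  have hg := (S.isMetricOn hφ).mono hΩ hΩφ
  have hG := (S.G_smooth hφ).mono hΩφ
  have hW := (S.W_smooth hφ).mono hΩφ
  have ha : ∀ z ∈ Ω, scalarA (S.g φ z) (S.W φ z) ≠ 0 := fun z hz => by
    rw [(hc z hz).scalarA]; exact mul_ne_zero (by norm_num) (pow_ne_zero 2 (hr z hz))
  have hρ : ∀ z ∈ Ω, rho (S.g φ z) (S.W φ z) ≠ 0 := fun z hz => by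
    rw [(hc z hz).rho]; exact hr z hz
  have hu : ∀ z ∈ Ω, IsTriad (S.g φ z) (triad (S.g φ z) (S.η φ z) (e z)) := fun z hz =>
    (he z hz).isTriad S.isVolumeSymbol
  have hLn := (hu y hy).dot_Lm_ne_zero
  obtain ⟨V₁, hV₁, hyV₁, hV₁Ω, L, hL, d, hd⟩ := exists_smooth_root_tensor hΩ hy
    (hg.concQ le_rfl hG hW ha hρ) (fun z hz => (hc z hz).concQ (hr z hz))
    (fun h => hLn (by rw [h, map_zero, LinearMap.zero_apply]))
  -- Division of `𝓟` by `-9ρ²` leaves `𝓤 ⊗ 𝓤`.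
  obtain ⟨V₂, hV₂, hyV₂, hV₂V₁, U, hU, c', hc'⟩ := exists_smooth_root_tensor hV₁ hyV₁
    (A := fun z => (1 / (-9 * rho (S.g φ z) (S.W φ z) ^ 2)) •
      concP (S.g φ z) (S.G φ z) (S.W φ z))
    (((contDiffOn_const.div_complex (contDiffOn_const.mul ((hg.rho le_rfl hW ha).pow 2))
      fun z hz => mul_ne_zero (by norm_num) (pow_ne_zero 2 (hρ z hz))).smul
      (hg.concP le_rfl hG hW ha)).mono hV₁Ω)
    (F := fun z => triad (S.g φ z) (S.η φ z) (e z) 0)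
    (fun z hz => by
      rw [(hc z (hV₁Ω hz)).concP, (hc z (hV₁Ω hz)).rho, smul_smul, one_div_mul_cancel, one_smul]
      exact mul_ne_zero (by norm_num) (pow_ne_zero 2 (hr z (hV₁Ω hz))))
    (fun h => by simpa [h] using (hu y hy).dot_zero_zero)
  -- the null bivector `𝓛₋`
  have hV₂Ω := hV₂V₁.trans hV₁Ω
  have hg₂ := hg.mono hV₂ hV₂Ω
  -- A field with constant components suffices: at `y` it pairs with `𝓛₊` to `-1`, so the pairing
  -- stays nonzero near `y`, which defines `V₃`.
  set Z : Coord → Tensor2 := fun _ => triadLm (triad (S.g φ y) (S.η φ y) (e y)) with hZ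
  have hLZ : ∀ z ∈ V₂, eval (S.g φ z) (S.G φ z) (L z) (Z z) =
      d z * dot (S.g φ z) (triadLp (triad (S.g φ z) (S.η φ z) (e z))) (Z z) := fun z hz => by
    rw [(hd z (hV₂V₁ hz)).2, eval_smul_left, (hc z (hV₂Ω hz)).2.2.1,
      (hu z (hV₂Ω hz)).eval_one_Lp S.g_isSymm]
  have hLZs := hg₂.eval le_rfl (hG.mono hV₂Ω) (hL.mono hV₂V₁) (contDiffOn_const (c := Z y))
  have hd0 : ∀ z ∈ V₁, (d z : ℂ) * d z = 1 := fun z hz => by exact_mod_cast (hd z hz).1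
  have hc0 : ∀ z ∈ V₂, (c' z : ℂ) * c' z = 1 := fun z hz => by exact_mod_cast (hc' z hz).1
  set V₃ := V₂ ∩ (fun z => eval (S.g φ z) (S.G φ z) (L z) (Z z)) ⁻¹' {0}ᶜ with hV₃
  have hV₃o : IsOpen V₃ := hLZs.continuousOn.isOpen_inter_preimage hV₂ isOpen_compl_singleton
  have hyV₃ : y ∈ V₃ := by
    refine ⟨hyV₂, ?_⟩
    change eval _ _ _ _ ≠ 0
    rw [hLZ y hyV₂]
    exact mul_ne_zero (fun h => by simpa [h] using hd0 y hyV₁) hLn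
  have h32 : V₃ ⊆ V₂ := Set.inter_subset_left
  have h31 := h32.trans hV₂V₁
  have h3Ω := h32.trans hV₂Ω
  have hg₃ := hg.mono hV₃o h3Ω
  have hL₃ := hL.mono h31
  have hN := hg₃.lMinus le_rfl (hG.mono h3Ω) (hU.mono h32) hL₃ (contDiffOn_const (c := Z y))
    fun z hz => hz.2
  have hNe : ∀ z ∈ V₃, lMinus (S.g φ z) (S.G φ z) (U z) (L z) (Z z) =
      (d z : ℂ) • triadLm (triad (S.g φ z) (S.η φ z) (e z)) := fun z hz => by
    rw [(hd z (h31 hz)).2, (hc' z (h32 hz)).2, (hc z (h3Ω hz)).2.2.1]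
    refine (hu z (h3Ω hz)).lMinus_eq S.g_isSymm (hc0 z (h32 hz)) (hd0 z (h31 hz)) fun h0 => hz.2 ?_
    change eval _ _ _ _ = 0
    rw [hLZ z (h32 hz), h0, mul_zero]
  -- the time-like vector
  obtain ⟨V, hV, hyV, hVV₃, v, hv, hve⟩ := exists_smooth_root hV₃o hyV₃
    (K := fun z μ ν => raise (S.g φ z) (timeSquare (S.g φ z) (U z) (L z)
      (lMinus (S.g φ z) (S.G φ z) (U z) (L z) (Z z))) μ ν)
    (fun μ ν => hg₃.raise_apply le_rfl (hg₃.timeSquare le_rfl (hU.mono h32) hL₃ hN) μ ν)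
    (u := fun z μ => (e z 0 μ : ℂ))
    (fun z hz μ ν => by
      refine (he z (h3Ω hz)).orthonormal.raise_lower (fun α β => ?_) μ ν
      rw [hNe z hz, (hd z (h31 hz)).2, (hc' z (h32 hz)).2]
      exact (he z (h3Ω hz)).timeSquare_eq S.g_isSymm S.isVolumeSymbol (hc' z (h32 hz)).1
        (hd z (h31 hz)).1 (hd z (h31 hz)).1 α β)
    (fun h => by
      have h' : ∀ μ, e y 0 μ = 0 := fun μ => Complex.ofReal_eq_zero.1 (congrFun h μ)
      have := (he y hy).1 0 0
      simp [h', signature] at this)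
  choose! c hc1 hve using hve
  have hVΩ := hVV₃.trans h3Ω
  have hgV := hg.mono hV hVΩ
  have hLV := hL₃.mono hVV₃
  set m : Coord → Fin 4 → ℂ := fun z μ => 2 * applyUp (S.g φ z) (L z) (v z) μ with hm
  set k : Coord → Fin 4 → ℂ := fun z μ =>
    applyUp (S.g φ z) (L z) (fun β => (starRingEnd ℂ) (m z β)) μ with hk
  have hms : ∀ μ, ContDiffOn ℝ ∞ (fun z => m z μ) V := fun μ =>
    contDiffOn_const.mul (hgV.applyUp le_rfl hLV hv μ)
  have hks : ∀ μ, ContDiffOn ℝ ∞ (fun z => k z μ) V := fun μ =>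
    hgV.applyUp le_rfl hLV (fun β => (hms β).conj) μ
  have hme : ∀ z ∈ V, ∀ μ, m z μ = c z * d z * ((e z 2 μ : ℂ) + Complex.I * (e z 3 μ : ℂ)) := by
    intro z hz μ
    have h1 : v z = fun β => (c z : ℂ) * (e z 0 β : ℂ) := hve z hz
    simp only [hm]
    rw [(hd z (h31 (hVV₃ hz))).2, h1, applyUp_smul,
      ← (he z (hVΩ hz)).applyUp_time S.isVolumeSymbol]
    ring
  have hke : ∀ z ∈ V, ∀ μ, k z μ = c z * ((e z 0 μ : ℂ) + (e z 1 μ : ℂ)) := by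
    intro z hz μ
    have h1 : (fun β => (starRingEnd ℂ) (m z β)) =
        fun β => ((c z * d z : ℝ) : ℂ) * ((e z 2 β : ℂ) - Complex.I * (e z 3 β : ℂ)) := by
      ext β
      rw [hme z hz]
      simp only [map_mul, map_add, Complex.conj_ofReal, Complex.conj_I]
      push_cast
      ring
    simp only [hk]
    rw [(hd z (h31 (hVV₃ hz))).2, h1, applyUp_smul,
      (he z (hVΩ hz)).applyUp_conj S.isVolumeSymbol]
    push_cast
    linear_combination (c z * ((e z 0 μ : ℂ) + (e z 1 μ : ℂ))) * hd0 z (h31 (hVV₃ hz))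
  -- Here `v = c e_0`, `k = c (e_0 + e_1)` and `m = cd (e_2 + i e_3)`, so this is the pointwise
  -- frame after `signChange c d`.
  refine ⟨V, hV, hyV, hVΩ, fun z a μ =>
    ![(v z μ).re, (k z μ).re - (v z μ).re, (m z μ).re, (m z μ).im] a, ?_, ?_⟩
  · have hre : ∀ {f : Coord → ℂ}, ContDiffOn ℝ ∞ f V → ContDiffOn ℝ ∞ (fun z => (f z).re) V :=
      fun hf => Complex.reCLM.contDiff.comp_contDiffOn hf
    have him : ∀ {f : Coord → ℂ}, ContDiffOn ℝ ∞ f V → ContDiffOn ℝ ∞ (fun z => (f z).im) V :=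
      fun hf => Complex.imCLM.contDiff.comp_contDiffOn hf
    rw [contDiffOn_pi]
    intro a
    rw [contDiffOn_pi]
    intro μ
    fin_cases a
    · exact hre (hv μ)
    · exact (hre (hks μ)).sub (hre (hv μ))
    · exact hre (hms μ)
    · exact him (hms μ)
  · intro z hz
    have hE : (fun a μ => ![(v z μ).re, (k z μ).re - (v z μ).re, (m z μ).re, (m z μ).im] a) =
        mulFrame (signChange (c z) (d z)) (e z) := by
      ext a μ
      obtain ⟨h0, h1, h2, h3⟩ := mulFrame_signChange (c z) (d z) (e z) μ
      have hv' : v z μ = (c z : ℂ) * (e z 0 μ : ℂ) := congrFun (hve z hz) μ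
      have hm' := hme z hz μ
      fin_cases a
      · simp [h0, hv']
      · simp [h1, hv', hke z hz μ]; ring
      · simp [h2, hm']
      · simp [h3, hm']
    obtain ⟨hE1, hE2, hE3⟩ := (he z (hVΩ hz)).sign_change S.isVolumeSymbol (hc1 z hz)
      (hd z (h31 (hVV₃ hz))).1
    change IsWeylPrincipalFrame _ _ _
      (fun a μ => ![(v z μ).re, (k z μ).re - (v z μ).re, (m z μ).re, (m z μ).im] a)
    rw [hE]
    refine hE1.isWeylPrincipalFrame S.g_isSymm S.isVolumeSymbol (r := r z) ?_
    rw [(hc z (hVΩ hz)).2.2.2, tri_canonII, tri_canonII, hE2, hE3, tensor_smul_smul,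
      hd0 z (h31 (hVV₃ hz)), one_smul, ← hE1.sdMetric_eq_tri S.g_isSymm S.isVolumeSymbol,
      ← (he z (hVΩ hz)).sdMetric_eq_tri S.g_isSymm S.isVolumeSymbol]

end Chart

/-! ### The connection of a frame field -/

section Connection

variable {g : Coord → Matrix (Fin 4) (Fin 4) ℝ} {e : Coord → Fin 4 → Fin 4 → ℝ} {O : Set Coord}
  {y : Coord}

lemma IsOrthonormal.sum_dualFrame {g : Matrix (Fin 4) (Fin 4) ℝ} {e : Fin 4 → Fin 4 → ℝ}
    (he : IsOrthonormal g e) (α μ : Fin 4) :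
    ∑ b, dualFrame e b α * e b μ = if α = μ then 1 else 0 := by
  have h := congrFun (congrFun (Matrix.nonsing_inv_mul _ he.isUnit_det) α) μ
  rwa [Matrix.mul_apply, Matrix.one_apply] at h

lemma sgnC_eq : sgnC = Matrix.diagonal fun a => (sg a : ℂ) := by
  ext i j
  rw [sgnC_apply, signature_eq, Matrix.diagonal_apply]
  split_ifs <;> simp

lemma transpose_mul_mul_apply (C A B : Matrix (Fin 4) (Fin 4) ℂ) (α β : Fin 4) :
    (A.transpose * C * B) α β = ∑ a, ∑ b, C a b * A a α * B b β := by
  simp only [Matrix.mul_apply, Matrix.transpose_apply, Finset.sum_mul]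
  rw [Finset.sum_comm]
  exact Finset.sum_congr rfl fun b _ => Finset.sum_congr rfl fun a _ => by ring

/-- The covariant components of the covariant derivatives of the vectors of a frame. -/
def frameDeriv (g : Coord → Matrix (Fin 4) (Fin 4) ℝ) (e : Coord → Fin 4 → Fin 4 → ℝ)
    (l a α : Fin 4) (y : Coord) : ℝ :=
  pd l (fun z => lower (g z) (e z) a α) y - ∑ σ, christoffel g σ l α y * lower (g y) (e y) a σ

/-- The frame components of the covariant derivatives of the vectors of a frame. -/
def frameConn (g : Coord → Matrix (Fin 4) (Fin 4) ℝ) (e : Coord → Fin 4 → Fin 4 → ℝ)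
    (l : Fin 4) (y : Coord) : Matrix (Fin 4) (Fin 4) ℝ :=
  Matrix.of fun a b => ∑ α, frameDeriv g e l a α y * e y b α

/-- Expansion of the covector `∇_l e_a` in the dual frame, whose members are the lowered frame
vectors up to the signs `sg`. -/
lemma frameDeriv_eq (he : IsOrthonormal (g y) (e y)) (l a α : Fin 4) :
    frameDeriv g e l a α y =
      ∑ b, frameConn g e l y a b * sg b * lower (g y) (e y) b α := by
  have h := he.sum_dualFrame
  simp only [frameConn, Matrix.of_apply, Finset.sum_mul]
  rw [Finset.sum_comm]
  have h1 : ∀ μ, ∑ b, frameDeriv g e l a μ y * e y b μ * sg b * lower (g y) (e y) b α =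
      if α = μ then frameDeriv g e l a μ y else 0 := fun μ => by
    rw [← mul_boole, ← h, Finset.mul_sum]
    exact Finset.sum_congr rfl fun b _ => by rw [he.dualFrame_eq]; ring
  simp [h1]

lemma IsMetricOn.differentiableAt_lower (hg : IsMetricOn g O) (hy : y ∈ O)
    (hd : DifferentiableAt ℝ e y) (a α : Fin 4) :
    DifferentiableAt ℝ (fun z => lower (g z) (e z) a α) y := by
  have h : ∀ a μ, DifferentiableAt ℝ (fun z => e z a μ) y := fun a μ =>
    differentiableAt_pi.1 (differentiableAt_pi.1 hd a) μ
  have h' : ∀ μ, DifferentiableAt ℝ (fun z => g z α μ) y := fun μ =>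
    (hg.smooth _ _).differentiableAt_of_isOpen hg.isOpen hy
  have h1 : (fun z => lower (g z) (e z) a α) = fun z => ∑ ν, g z α ν * e z a ν := rfl
  rw [h1]
  exact DifferentiableAt.fun_sum fun ν _ => (h' ν).mul (h a ν)

lemma IsMetricOn.pd_lower (hg : IsMetricOn g O) (hy : y ∈ O)
    (hd : DifferentiableAt ℝ e y) (l a α : Fin 4) :
    pd l (fun z => lower (g z) (e z) a α) y =
      ∑ ν, ((Spacetime4.christoffelLow g α l ν y + Spacetime4.christoffelLow g ν l α y) * e y a ν
        + g y α ν * pd l (fun z => e z a ν) y) := by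
  have h : ∀ a μ, DifferentiableAt ℝ (fun z => e z a μ) y := fun a μ =>
    differentiableAt_pi.1 (differentiableAt_pi.1 hd a) μ
  have h' : ∀ α ν, DifferentiableAt ℝ (fun z => g z α ν) y := fun α ν =>
    (hg.smooth _ _).differentiableAt_of_isOpen hg.isOpen hy
  have h1 : (fun z => lower (g z) (e z) a α) = fun z => ∑ ν, g z α ν * e z a ν := rfl
  rw [h1, pd_sum (f := fun ν z => g z α ν * e z a ν) fun ν _ => (h' α ν).mul (h a ν)]
  exact Finset.sum_congr rfl fun ν _ => by rw [pd_mul (h' α ν) (h a ν), hg.pd_metric hy]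

lemma IsMetricOn.sum_christoffel_lower (hg : IsMetricOn g O) (hy : y ∈ O) (l a α : Fin 4) :
    ∑ σ, Spacetime4.christoffel g σ l α y * lower (g y) (e y) a σ =
      ∑ ν, Spacetime4.christoffelLow g ν l α y * e y a ν := by
  have h1 : ∀ σ, lower (g y) (e y) a σ = ∑ ν, g y σ ν * e y a ν := fun σ => rfl
  simp only [h1, Finset.mul_sum]
  rw [Finset.sum_comm]
  refine Finset.sum_congr rfl fun ν _ => ?_
  rw [← hg.lower_christoffel hy, Finset.sum_mul]
  exact Finset.sum_congr rfl fun σ _ => by rw [(hg.symm y hy).apply ν σ]; ring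

/-- The covariant derivative commutes with the lowering of an index. -/
lemma IsMetricOn.frameDeriv_eq_lower (hg : IsMetricOn g O) (hy : y ∈ O)
    (hd : DifferentiableAt ℝ e y) (l a β : Fin 4) :
    frameDeriv g e l a β y = ∑ μ, g y β μ *
      (pd l (fun z => e z a μ) y + ∑ σ, Spacetime4.christoffel g μ l σ y * e y a σ) := by
  rw [frameDeriv, hg.pd_lower hy hd, hg.sum_christoffel_lower hy]
  simp only [mul_add, Finset.sum_add_distrib, Finset.mul_sum]
  rw [Finset.sum_comm (f := fun μ σ => g y β μ * (Spacetime4.christoffel g μ l σ y * e y a σ))]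
  simp only [← mul_assoc, ← Finset.sum_mul, hg.lower_christoffel hy, add_mul,
    Finset.sum_add_distrib]
  ring

/-- Differentiate the constant function `g(e_a, e_b)`; metric compatibility turns its derivative
into `g(∇e_a, e_b) + g(e_a, ∇e_b)`. -/
lemma IsMetricOn.frameConn_antisymm (hg : IsMetricOn g O) (hy : y ∈ O)
    (hd : DifferentiableAt ℝ e y) (he : ∀ z ∈ O, IsOrthonormal (g z) (e z)) (l a b : Fin 4) :
    frameConn g e l y a b = -frameConn g e l y b a := by
  have h : ∀ a μ, DifferentiableAt ℝ (fun z => e z a μ) y := fun a μ =>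
    differentiableAt_pi.1 (differentiableAt_pi.1 hd a) μ
  have hl := hg.differentiableAt_lower hy hd
  have h0 : pd l (fun z => ∑ α, lower (g z) (e z) a α * e z b α) y = 0 := by
    have : (fun z => ∑ α, lower (g z) (e z) a α * e z b α) =ᶠ[𝓝 y] fun _ => signature a b := by
      filter_upwards [hg.isOpen.mem_nhds hy] with z hz using (he z hz).sum_lower a b
    rw [pd_congr this]
    simp [pd]
  rw [pd_sum (f := fun α z => lower (g z) (e z) a α * e z b α)
    fun α _ => (hl a α).mul (h b α)] at h0
  simp only [pd_mul (hl a _) (h b _), Finset.sum_add_distrib] at h0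
  have h1 : ∑ α, lower (g y) (e y) a α * pd l (fun z => e z b α) y =
      ∑ α, pd l (fun z => lower (g z) (e z) b α) y * e y a α
      - ∑ α, (∑ ν, (Spacetime4.christoffelLow g α l ν y + Spacetime4.christoffelLow g ν l α y)
        * e y b ν) * e y a α := by
    simp only [hg.pd_lower hy hd, Finset.sum_add_distrib, add_mul, Finset.sum_mul]
    have h2 : ∑ α, lower (g y) (e y) a α * pd l (fun z => e z b α) y =
        ∑ α, ∑ ν, g y α ν * pd l (fun z => e z b ν) y * e y a α := by
      have h3 : ∀ σ, lower (g y) (e y) a σ = ∑ ν, g y σ ν * e y a ν := fun σ => rfl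
      simp only [h3, Finset.sum_mul]
      rw [Finset.sum_comm]
      exact Finset.sum_congr rfl fun α _ => Finset.sum_congr rfl fun ν _ => by
        rw [(hg.symm y hy).apply α ν]; ring
    rw [h2]
    ring
  have h4 : ∑ α, (∑ ν, (Spacetime4.christoffelLow g α l ν y + Spacetime4.christoffelLow g ν l α y)
        * e y b ν) * e y a α =
      ∑ α, (∑ ν, Spacetime4.christoffelLow g ν l α y * e y a ν) * e y b α
      + ∑ α, (∑ ν, Spacetime4.christoffelLow g ν l α y * e y b ν) * e y a α := by
    simp only [add_mul, Finset.sum_add_distrib, Finset.sum_mul]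
    congr 1
    rw [Finset.sum_comm]
    exact Finset.sum_congr rfl fun α _ => Finset.sum_congr rfl fun ν _ => by ring
  simp only [frameConn, Matrix.of_apply, frameDeriv, hg.sum_christoffel_lower hy, sub_mul,
    Finset.sum_sub_distrib]
  linarith

/-- Two of the three frame sums are resolutions of the identity: `∑ θ^b_l e_b^k = δ_l^k` and `∑
θ^c_μ (e_c)_β = g_{βμ}`. Only the sum over the differentiated vector remains. -/
lemma IsOrthonormal.connTensor_eq (hg : IsMetricOn g O) (hy : y ∈ O)
    (hd : DifferentiableAt ℝ e y) (he : IsOrthonormal (g y) (e y)) (l α β : Fin 4) :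
    connTensor g e l α β y = ∑ a, dualFrame (e y) a α * frameDeriv g e l a β y := by
  set D : Fin 4 → Fin 4 → Fin 4 → ℝ := fun a k μ =>
    pd k (fun z => e z a μ) y + ∑ σ, christoffel g μ k σ y * e y a σ with hD
  have h1 : ∀ a c, ∑ b, connCoeff g e c a b y * dualFrame (e y) b l =
      ∑ μ, dualFrame (e y) c μ * D a l μ := by
    intro a c
    have h2 : ∀ b, connCoeff g e c a b y = ∑ μ, ∑ k, dualFrame (e y) c μ * e y b k * D a k μ :=
      fun b => rfl
    simp only [h2, Finset.sum_mul]
    rw [Finset.sum_comm]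
    refine Finset.sum_congr rfl fun μ _ => ?_
    rw [Finset.sum_comm]
    have h3 : ∀ k, ∑ b, dualFrame (e y) c μ * e y b k * D a k μ * dualFrame (e y) b l =
        if l = k then dualFrame (e y) c μ * D a k μ else 0 := fun k => by
      rw [← mul_boole, ← he.sum_dualFrame, Finset.mul_sum]
      exact Finset.sum_congr rfl fun b _ => by ring
    simp [h3]
  have h2 : ∀ μ, ∑ c, dualFrame (e y) c μ * (g y).mulVec (e y c) β = g y β μ := by
    intro μ
    rw [he.metric_apply (hg.symm y hy)]
    exact Finset.sum_congr rfl fun c _ => by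
      rw [he.dualFrame_eq]
      change sg c * lower (g y) (e y) c μ * lower (g y) (e y) c β = _
      ring
  rw [connTensor]
  refine Finset.sum_congr rfl fun a _ => ?_
  rw [Finset.sum_comm, hg.frameDeriv_eq_lower hy hd]
  change _ = dualFrame (e y) a α * ∑ μ, g y β μ * D a l μ
  have h3 : ∀ c, ∑ b, connCoeff g e c a b y * dualFrame (e y) b l * dualFrame (e y) a α *
      (g y).mulVec (e y c) β = ∑ μ, dualFrame (e y) a α * (dualFrame (e y) c μ *
        (g y).mulVec (e y c) β * D a l μ) := by
    intro c
    rw [← Finset.sum_mul, ← Finset.sum_mul, h1, Finset.sum_mul, Finset.sum_mul]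
    exact Finset.sum_congr rfl fun μ _ => by ring
  simp only [h3]
  rw [Finset.sum_comm, Finset.mul_sum]
  refine Finset.sum_congr rfl fun μ _ => ?_
  rw [← Finset.mul_sum, ← Finset.sum_mul, h2]

lemma IsOrthonormal.connTensor_frameTensor (hg : IsMetricOn g O) (hy : y ∈ O)
    (hd : DifferentiableAt ℝ e y) (he : IsOrthonormal (g y) (e y)) (l α β : Fin 4) :
    (connTensor g e l α β y : ℂ) = frameTensor (g y) (e y)
      (sgnC * (frameConn g e l y).map Complex.ofReal * sgnC) α β := by
  have h : ∀ a b, (sgnC * (frameConn g e l y).map Complex.ofReal * sgnC) a b =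
      ((sg a * frameConn g e l y a b * sg b : ℝ) : ℂ) := by
    intro a b
    rw [sgnC_eq, Matrix.mul_diagonal, Matrix.diagonal_mul, Matrix.map_apply]
    push_cast
    rfl
  rw [he.connTensor_eq hg hy hd]
  simp only [frameTensor, h, frameDeriv_eq he, he.dualFrame_eq, Finset.mul_sum]
  push_cast
  exact Finset.sum_congr rfl fun a _ => Finset.sum_congr rfl fun b _ => by ring

/-- The frame components of the covariant derivative of a tensor with constant components `C`. -/
def derivCoeff (N C : Matrix (Fin 4) (Fin 4) ℂ) : Matrix (Fin 4) (Fin 4) ℂ :=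
  N.transpose * C + C * N

/-- Leibniz rule: the coefficients are constant, so only the frame covectors are differentiated,
each by the connection matrix acting on its own index. Differentiability of the frame alone is
required; that of `F` follows. -/
lemma IsMetricOn.covDeriv_frameTensor (hg : IsMetricOn g O) (hy : y ∈ O)
    (hd : DifferentiableAt ℝ e y) (he : IsOrthonormal (g y) (e y)) {F : Coord → Tensor2}
    {C : Matrix (Fin 4) (Fin 4) ℂ} (hF : F =ᶠ[𝓝 y] fun z => frameTensor (g z) (e z) C)
    (l α β : Fin 4) :
    covDeriv g F l α β y = frameTensor (g y) (e y)
      (derivCoeff ((frameConn g e l y).map Complex.ofReal * sgnC) C) α β := by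
  have hl : ∀ a α, DifferentiableAt ℝ (fun z => (lower (g z) (e z) a α : ℂ)) y := fun a α =>
    Complex.ofRealCLM.differentiableAt.comp y (hg.differentiableAt_lower hy hd a α)
  have h1 : pd l (fun z => F z α β) y = ∑ a, ∑ b, C a b *
      (pd l (fun z => lower (g z) (e z) a α) y * lower (g y) (e y) b β
        + lower (g y) (e y) a α * pd l (fun z => lower (g z) (e z) b β) y) := by
    have h2 : (fun z => F z α β) =ᶠ[𝓝 y] fun z => frameTensor (g z) (e z) C α β := by
      filter_upwards [hF] with z hz
      rw [hz]
    rw [pd_congr h2]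
    have h3 : ∀ a b, DifferentiableAt ℝ (fun z => C a b * (lower (g z) (e z) a α : ℂ) *
      (lower (g z) (e z) b β : ℂ)) y := fun a b => ((hl a α).const_mul _).mul (hl b β)
    have h4 : (fun z => frameTensor (g z) (e z) C α β) = fun z => ∑ a, ∑ b, C a b *
      (lower (g z) (e z) a α : ℂ) * (lower (g z) (e z) b β : ℂ) := rfl
    rw [h4, pd_sum (f := fun a z => ∑ b, C a b *
      (lower (g z) (e z) a α : ℂ) * (lower (g z) (e z) b β : ℂ))
      fun a _ => DifferentiableAt.fun_sum fun b _ => h3 a b]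
    refine Finset.sum_congr rfl fun a _ => ?_
    rw [pd_sum (f := fun b z => C a b *
      (lower (g z) (e z) a α : ℂ) * (lower (g z) (e z) b β : ℂ)) fun b _ => h3 a b]
    refine Finset.sum_congr rfl fun b _ => ?_
    rw [pd_mul ((hl a α).const_mul _) (hl b β), pd_const_mul _ (hl a α),
      pd_ofReal (hg.differentiableAt_lower hy hd _ _),
      pd_ofReal (hg.differentiableAt_lower hy hd _ _)]
    ring
  have h5 : covDeriv g F l α β y = ∑ a, ∑ b, C a b *
      (frameDeriv g e l a α y * lower (g y) (e y) b β
        + lower (g y) (e y) a α * frameDeriv g e l b β y) := by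
    have hA : ∑ σ, (Spacetime4.christoffel g σ l α y : ℂ) * F y σ β = ∑ a, ∑ b, C a b *
        ((∑ σ, (Spacetime4.christoffel g σ l α y : ℂ) * lower (g y) (e y) a σ) *
          lower (g y) (e y) b β) := by
      rw [hF.self_of_nhds]
      simp only [frameTensor, Finset.mul_sum, Finset.sum_mul]
      rw [Finset.sum_comm]
      refine Finset.sum_congr rfl fun a _ => ?_
      rw [Finset.sum_comm]
      exact Finset.sum_congr rfl fun b _ => Finset.sum_congr rfl fun σ _ => by ring
    have hB : ∑ σ, (Spacetime4.christoffel g σ l β y : ℂ) * F y α σ = ∑ a, ∑ b, C a b *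
        (lower (g y) (e y) a α *
          ∑ σ, (Spacetime4.christoffel g σ l β y : ℂ) * lower (g y) (e y) b σ) := by
      rw [hF.self_of_nhds]
      simp only [frameTensor, Finset.mul_sum]
      rw [Finset.sum_comm]
      refine Finset.sum_congr rfl fun a _ => ?_
      rw [Finset.sum_comm]
      exact Finset.sum_congr rfl fun b _ => Finset.sum_congr rfl fun σ _ => by ring
    rw [covDeriv, h1, Finset.sum_add_distrib, hA, hB]
    simp only [← Finset.sum_add_distrib, ← Finset.sum_sub_distrib, frameDeriv]
    push_cast
    exact Finset.sum_congr rfl fun a _ => Finset.sum_congr rfl fun b _ => by ring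
  have hD : (Matrix.of fun a α => (frameDeriv g e l a α y : ℂ)) =
      (frameConn g e l y).map Complex.ofReal * sgnC * lowerMatrix (g y) (e y) := by
    ext a α
    rw [Matrix.of_apply, frameDeriv_eq he, sgnC_eq, Matrix.mul_apply]
    push_cast
    exact Finset.sum_congr rfl fun b _ => by
      rw [Matrix.mul_diagonal, Matrix.map_apply]; rfl
  have h6 := transpose_mul_mul_apply C (Matrix.of fun a α => (frameDeriv g e l a α y : ℂ))
    (lowerMatrix (g y) (e y)) α β
  have h7 := transpose_mul_mul_apply C (lowerMatrix (g y) (e y))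
    (Matrix.of fun a α => (frameDeriv g e l a α y : ℂ)) α β
  rw [hD] at h6 h7
  have h8 : ∀ a α, (lower (g y) (e y) a α : ℂ) = lowerMatrix (g y) (e y) a α := fun _ _ => rfl
  have h9 : ∀ a α, (frameDeriv g e l a α y : ℂ) =
    ((frameConn g e l y).map Complex.ofReal * sgnC * lowerMatrix (g y) (e y)) a α := fun a α => by
      rw [← hD]; rfl
  rw [h5, frameTensor_eq_mul]
  simp only [h8, h9, mul_add, Finset.sum_add_distrib, ← mul_assoc, ← h6, ← h7]
  rw [← Matrix.add_apply, derivCoeff]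
  simp only [Matrix.mul_add, Matrix.add_mul, Matrix.mul_assoc, Matrix.transpose_mul]

end Connection

/-! ### The self-dual projection of the connection -/

lemma derivCoeff_smul (N C : Matrix (Fin 4) (Fin 4) ℂ) (c : ℂ) :
    derivCoeff N (c • C) = c • derivCoeff N C := by
  simp only [derivCoeff, Matrix.mul_smul, Matrix.smul_mul, smul_add]

/-- The null terms sum to those of `u_2` and `u_3`, so the left side is `∑ [h, u_A] u_A` over the
triad, up to normalization. The anti-self-dual part of `h` commutes with every `u_A`; on the
self-dual part, where the `u_A` multiply like quaternion units, the sum is a scalar. The result is a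
multiple of `h` plus `i` times its dual. -/
lemma derivCoeff_eq (h : Matrix (Fin 4) (Fin 4) ℂ) (hh : ∀ a b, h a b = -h b a) :
    derivCoeff (h * sgnC) (triadCoeff 0) * sgnC * triadCoeff 0 +
      (2 : ℂ) • (derivCoeff (h * sgnC) lpCoeff * sgnC * lmCoeff
        + derivCoeff (h * sgnC) lmCoeff * sgnC * lpCoeff) =
    (-2 : ℂ) • (sgnC * (h + Complex.I • !![0, -h 2 3, h 1 3, -h 1 2; h 2 3, 0, h 0 3, -h 0 2;
      -h 1 3, -h 0 3, 0, h 0 1; h 1 2, h 0 2, -h 0 1, 0]) * sgnC) := by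
  have h0 : ∀ a, h a a = 0 := fun a => self_eq_neg.1 (hh a a)
  have e : h = !![0, h 0 1, h 0 2, h 0 3; -h 0 1, 0, h 1 2, h 1 3; -h 0 2, -h 1 2, 0, h 2 3;
      -h 0 3, -h 1 3, -h 2 3, 0] := by
    ext a b
    fin_cases a <;> fin_cases b <;> simp [h0] <;> exact hh _ _
  -- The six independent entries become free variables, so that all that follows is polynomial
  -- arithmetic in explicit matrices.
  generalize h 0 1 = a at *
  generalize h 0 2 = b at *
  generalize h 0 3 = c at *
  generalize h 1 2 = d at *
  generalize h 1 3 = f at *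
  generalize h 2 3 = k at *
  clear hh h0
  subst e
  have hN : !![0, a, b, c; -a, 0, d, f; -b, -d, 0, k; -c, -f, -k, 0] * sgnC =
      !![0, a, b, c; a, 0, d, f; b, -d, 0, k; c, -f, -k, 0] := by
    ext i j
    fin_cases i <;> fin_cases j <;> simp [sgnC]
  -- The three derivatives are evaluated separately, which keeps the final entrywise check small.
  have h1 : derivCoeff !![0, a, b, c; a, 0, d, f; b, -d, 0, k; c, -f, -k, 0] (triadCoeff 0) =
      !![0, 0, d + c * Complex.I, f - b * Complex.I;
        0, 0, -Complex.I * (f - b * Complex.I), Complex.I * (d + c * Complex.I);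
        -(d + c * Complex.I), Complex.I * (f - b * Complex.I), 0, 0;
        -(f - b * Complex.I), -Complex.I * (d + c * Complex.I), 0, 0] := by
    ext i j
    fin_cases i <;> fin_cases j <;>
      simp [derivCoeff, triadCoeff, Matrix.mul_apply, Fin.sum_univ_four] <;>
      ring_nf <;> simp <;> try ring
  have h2 : derivCoeff !![0, a, b, c; a, 0, d, f; b, -d, 0, k; c, -f, -k, 0] lpCoeff =
      (1 / 2 : ℂ) • !![0, -(b + d + (c + f) * Complex.I), a - k * Complex.I, a * Complex.I + k;
        b + d + (c + f) * Complex.I, 0, a - k * Complex.I, a * Complex.I + k;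
        -(a - k * Complex.I), -(a - k * Complex.I), 0, (b + d) * Complex.I - (c + f);
        -(a * Complex.I + k), -(a * Complex.I + k), -((b + d) * Complex.I - (c + f)), 0] := by
    rw [lpCoeff, derivCoeff_smul]
    congr 1
    ext i j
    fin_cases i <;> fin_cases j <;>
      simp [derivCoeff, Matrix.mul_apply, Fin.sum_univ_four] <;> ring
  have h3 : derivCoeff !![0, a, b, c; a, 0, d, f; b, -d, 0, k; c, -f, -k, 0] lmCoeff =
      (1 / 2 : ℂ) • !![0, b - d - (c - f) * Complex.I, -(a - k * Complex.I), a * Complex.I + k;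
        -(b - d - (c - f) * Complex.I), 0, a - k * Complex.I, -(a * Complex.I + k);
        a - k * Complex.I, -(a - k * Complex.I), 0, -((b - d) * Complex.I + (c - f));
        -(a * Complex.I + k), a * Complex.I + k, (b - d) * Complex.I + (c - f), 0] := by
    rw [lmCoeff, derivCoeff_smul]
    congr 1
    ext i j
    fin_cases i <;> fin_cases j <;>
      simp [derivCoeff, Matrix.mul_apply, Fin.sum_univ_four] <;> ring
  rw [hN, h1, h2, h3, lpCoeff, lmCoeff]
  simp only [sgnC, Matrix.smul_mul, Matrix.mul_smul, smul_smul, ← smul_add]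
  ext i j
  simp only [Matrix.add_apply, Matrix.smul_apply, Matrix.mul_apply (M := _ * Matrix.diagonal _),
    Matrix.mul_diagonal, Matrix.diagonal_mul, Fin.sum_univ_four, smul_eq_mul]
  fin_cases i <;> fin_cases j <;> simp [triadCoeff] <;> ring_nf <;> simp <;> try ring

/-- The complex combination of connection coefficients that gives the connection of the self-dual
bivectors has the given real part. -/
lemma exists_derivCoeff_eq (h : Matrix (Fin 4) (Fin 4) ℝ) (hh : ∀ a b, h a b = -h b a) :
    ∃ K : Matrix (Fin 4) (Fin 4) ℝ,
      derivCoeff (h.map Complex.ofReal * sgnC) (triadCoeff 0) * sgnC * triadCoeff 0 +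
        (2 : ℂ) • (derivCoeff (h.map Complex.ofReal * sgnC) lpCoeff * sgnC * lmCoeff
          + derivCoeff (h.map Complex.ofReal * sgnC) lmCoeff * sgnC * lpCoeff) =
      (-2 : ℂ) • (sgnC * (h.map Complex.ofReal + Complex.I • K.map Complex.ofReal) * sgnC) := by
  refine ⟨!![0, -h 2 3, h 1 3, -h 1 2; h 2 3, 0, h 0 3, -h 0 2;
      -h 1 3, -h 0 3, 0, h 0 1; h 1 2, h 0 2, -h 0 1, 0], ?_⟩
  rw [derivCoeff_eq _ fun a b => by
    rw [Matrix.map_apply, Matrix.map_apply, hh]; exact Complex.ofReal_neg _]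
  congr 5
  ext a b
  fin_cases a <;> fin_cases b <;> simp

/-- `h` and `K` are real, so conjugation reverses the sign of the dual term only. The exact form of
`K` is therefore irrelevant. -/
lemma add_map_conj (h K : Matrix (Fin 4) (Fin 4) ℝ) :
    sgnC * (h.map Complex.ofReal + Complex.I • K.map Complex.ofReal) * sgnC +
      (sgnC * (h.map Complex.ofReal + Complex.I • K.map Complex.ofReal) * sgnC).map
        (starRingEnd ℂ) = (2 : ℂ) • (sgnC * h.map Complex.ofReal * sgnC) := by
  ext a b
  simp only [sgnC_eq, Matrix.add_apply, Matrix.map_apply, Matrix.mul_diagonal,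
    Matrix.diagonal_mul, Matrix.smul_apply, smul_eq_mul, map_mul, map_add, Complex.conj_ofReal,
    Complex.conj_I]
  ring

section Connection

variable {g : Coord → Matrix (Fin 4) (Fin 4) ℝ} {e : Coord → Fin 4 → Fin 4 → ℝ} {O : Set Coord}
  {y : Coord}

lemma IsMetricOn.contract_frameTensor (hg : IsMetricOn g O) (hy : y ∈ O)
    (hd : DifferentiableAt ℝ e y) (he : IsOrthonormal (g y) (e y)) {F K : Coord → Tensor2}
    {C D : Matrix (Fin 4) (Fin 4) ℂ} (hF : F =ᶠ[𝓝 y] fun z => frameTensor (g z) (e z) C)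
    (hK : K y = frameTensor (g y) (e y) D) (l α β : Fin 4) :
    contract (g y) (fun l α β => covDeriv g F l α β y) (K y) l α β = frameTensor (g y) (e y)
      (derivCoeff ((frameConn g e l y).map Complex.ofReal * sgnC) C * sgnC * D) α β := by
  rw [contract_eq_mul2, ← he.mul2_frameTensor, hK]
  congr 1
  ext α β
  exact hg.covDeriv_frameTensor hy hd he hF l α β

/-- The connection tensor in terms of the self-dual bivectors of the frame. -/
lemma IsMetricOn.connTensor_eq_sdConn (hg : IsMetricOn g O) (hy : y ∈ O)
    (hd : DifferentiableAt ℝ e y) (he : ∀ z ∈ O, IsOrthonormal (g z) (e z))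
    {U Lp Lm : Coord → Tensor2} {c d : ℂ} (hc : c * c = 1) (hd' : d * d = 1)
    (hU : U =ᶠ[𝓝 y] fun z => frameTensor (g z) (e z) (c • isq • triadCoeff 0))
    (hLp : Lp =ᶠ[𝓝 y] fun z => frameTensor (g z) (e z) (d • lpCoeff))
    (hLm : Lm =ᶠ[𝓝 y] fun z => frameTensor (g z) (e z) (d • lmCoeff)) (l α β : Fin 4) :
    (connTensor g e l α β y : ℂ) =
      isq * (sdConn g U Lp Lm l α β y + (starRingEnd ℂ) (sdConn g U Lp Lm l α β y)) := by
  have he' := he y hy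
  set N := (frameConn g e l y).map Complex.ofReal * sgnC with hN
  obtain ⟨K, hK⟩ := exists_derivCoeff_eq _ (hg.frameConn_antisymm hy hd he l)
  rw [← hN] at hK
  set A := sgnC * ((frameConn g e l y).map Complex.ofReal + Complex.I • K.map Complex.ofReal)
    * sgnC with hA
  have h1 : sdConn g U Lp Lm l α β y = isq * frameTensor (g y) (e y) A α β := by
    -- The signs occur as `c²` and `d²` and disappear; `isq² = 1/2` accounts for the factor `2` in
    -- front of the null terms in `hK`.
    have h2 : derivCoeff N (c • isq • triadCoeff 0) * sgnC * (c • isq • triadCoeff 0)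
        + derivCoeff N (d • lpCoeff) * sgnC * (d • lmCoeff)
        + derivCoeff N (d • lmCoeff) * sgnC * (d • lpCoeff) = (-1 : ℂ) • A := by
      simp only [derivCoeff_smul, Matrix.smul_mul, Matrix.mul_smul, smul_smul]
      rw [show c * isq * (c * isq) = 1 / 2 by linear_combination isq * isq * hc + isq_sq, hd',
        one_smul, one_smul, show (-1 : ℂ) = 1 / 2 * (-2) by norm_num, mul_smul, ← hK, smul_add,
        smul_smul, add_assoc]
      norm_num
    rw [sdConn, hg.contract_frameTensor hy hd he' hU hU.self_of_nhds,
      hg.contract_frameTensor hy hd he' hLp hLm.self_of_nhds,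
      hg.contract_frameTensor hy hd he' hLm hLp.self_of_nhds]
    have h3 := congrArg (fun C => frameTensor (g y) (e y) C α β) h2
    simp only [frameTensor_add, frameTensor_smul, Pi.add_apply, Pi.smul_apply, smul_eq_mul] at h3
    change -isq * _ = _
    rw [h3]
    ring
  have h4 := congrArg (fun C => frameTensor (g y) (e y) C α β)
    (add_map_conj (frameConn g e l y) K)
  simp only [frameTensor_add, frameTensor_smul, ← conj2_frameTensor, Pi.add_apply, Pi.smul_apply,
    smul_eq_mul] at h4
  have h5 : (starRingEnd ℂ) (frameTensor (g y) (e y) A α β) =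
    conj2 (frameTensor (g y) (e y) A) α β := rfl
  rw [he'.connTensor_frameTensor hg hy hd, h1, map_mul, conj_isq, h5]
  linear_combination -(frameTensor (g y) (e y) A α β + conj2 (frameTensor (g y) (e y) A) α β)
    * isq_sq - (1 / 2 : ℂ) * h4

lemma IsMetricOn.continuousAt_frameTensor (hg : IsMetricOn g O) (hy : y ∈ O)
    (hd : DifferentiableAt ℝ e y) (C : Matrix (Fin 4) (Fin 4) ℂ) :
    ContinuousAt (fun z => frameTensor (g z) (e z) C) y := by
  have hl : ∀ a α, ContinuousAt (fun z => (lower (g z) (e z) a α : ℂ)) y := fun a α =>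
    (Complex.continuous_ofReal.tendsto (lower (g y) (e y) a α)).comp
      (hg.differentiableAt_lower hy hd a α).continuousAt
  refine continuousAt_pi.2 fun α => continuousAt_pi.2 fun β => ?_
  exact tendsto_finsetSum _ fun a _ => tendsto_finsetSum _ fun b _ =>
    ((continuousAt_const (y := C a b)).mul (hl a α)).mul (hl b β)

end Connection

/-- Continuous fields that agree up to a sign at each point agree locally up to a common sign. -/
lemma eventuallyEq_smul_of_sign {f h : Coord → Tensor2} {y : Coord} (hf : ContinuousAt f y)
    (hh : ContinuousAt h y) (h0 : h y ≠ 0)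
    (hfh : ∀ᶠ z in 𝓝 y, ∃ c : ℂ, (c = 1 ∨ c = -1) ∧ f z = c • h z) :
    ∃ c : ℂ, (c = 1 ∨ c = -1) ∧ f =ᶠ[𝓝 y] fun z => c • h z := by
  obtain ⟨c, hc, hcy⟩ := hfh.self_of_nhds
  refine ⟨c, hc, ?_⟩
  have hc0 : c ≠ 0 := by rcases hc with rfl | rfl <;> norm_num
  -- At `y` this sum is `2 c h(y) ≠ 0`, whereas at a point with the opposite sign it would vanish.
  have h1 : ContinuousAt (fun z => f z + c • h z) y := hf.add (hh.const_smul c)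
  have h2 : f y + c • h y ≠ 0 := by
    rw [hcy, ← two_smul ℂ]
    exact smul_ne_zero two_ne_zero (smul_ne_zero hc0 h0)
  filter_upwards [hfh, h1.eventually_ne h2] with z ⟨c', hc', hz⟩ hne
  rw [hz] at hne ⊢
  rcases hc with rfl | rfl <;> rcases hc' with rfl | rfl <;> simp at hne ⊢

section Chart

variable {M : Type*} [TopologicalSpace M] [ChartedSpace Coord M] [IsManifold 𝓘(ℝ, Coord) ∞ M]
  {φ : OpenPartialHomeomorph M Coord} (S : Spacetime M)

/-- The scalars of a Weyl tensor of type II do not vanish. -/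
lemma Spacetime.scalarA_ne_zero_and_rho_ne_zero
    (hφ : φ ∈ IsManifold.maximalAtlas 𝓘(ℝ, Coord) ∞ M) {y : Coord} (hy : y ∈ φ.target)
    (hII : IsTypeII (S.g φ y) (S.G φ y) (S.W φ y)) :
    scalarA (S.g φ y) (S.W φ y) ≠ 0 ∧ rho (S.g φ y) (S.W φ y) ≠ 0 := by
  obtain ⟨e, r, hr, -, hc⟩ := S.exists_canonical hφ hy hII
  rw [hc.scalarA, hc.rho]
  exact ⟨mul_ne_zero (by norm_num) (pow_ne_zero 2 hr), hr⟩

end Chart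

/-- The concomitants of a Weyl tensor in canonical form recover the bivectors of the frame. -/
lemma IsCanonical.recover {g : Matrix (Fin 4) (Fin 4) ℝ} {G W : Tensor4} {u : Fin 3 → Tensor2}
    {r : ℂ} (h : IsCanonical g G W u r) (hr : r ≠ 0) {Y X Z U Lp Lm : Tensor2} {s t : ℂ}
    (hY : act g (Spacetime4.concP g G W) Y ≠ 0)
    (hX : act g (Spacetime4.concQ g G W) X ≠ 0)
    (hs : s ^ 2 = -eval g (comp g (Spacetime4.concP g G W) (Spacetime4.concP g G W)) Y Y)
    (ht : t ^ 2 = eval g (Spacetime4.concQ g G W) X X)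
    (hU : U = (1 / s) • act g (Spacetime4.concP g G W) Y)
    (hLp : Lp = (1 / t) • act g (Spacetime4.concQ g G W) X)
    (hZ : eval g G Lp Z ≠ 0) (hLm : Lm = lMinus g G U Lp Z) :
    ∃ c d : ℂ, (c = 1 ∨ c = -1) ∧ (d = 1 ∨ d = -1) ∧ U = c • u 0 ∧ Lp = d • triadLp u ∧
      Lm = d • triadLm u := by
  obtain ⟨-, c, hc, hUc⟩ := h.recover_U hr hY hs
  obtain ⟨-, -, d, hd, hLd⟩ := h.recover_Lp hr hX ht
  rw [← hU] at hUc
  rw [← hLp] at hLd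
  have hc' : c * c = 1 := by rcases hc with rfl | rfl <;> norm_num
  have hd' : d * d = 1 := by rcases hd with rfl | rfl <;> norm_num
  refine ⟨c, d, hc, hd, hUc, hLd, ?_⟩
  rw [hLd, h.2.2.1, eval_smul_left, h.2.1.eval_one_Lp h.1] at hZ
  rw [hLm, hUc, hLd, h.2.2.1, h.2.1.lMinus_eq h.1 hc' hd' (right_ne_zero_of_mul hZ)]

end Spacetime4

end

/-! ### Assembly of the theorem -/

open Spacetime4 in
theorem proposition4 {M : Type*} [TopologicalSpace M] [ChartedSpace Coord M]
    [IsManifold 𝓘(ℝ, Coord) ∞ M] (S : Spacetime M)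
    (φ : OpenPartialHomeomorph M Coord)
    (hφ : φ ∈ IsManifold.maximalAtlas 𝓘(ℝ, Coord) ∞ M)
    (Ω : Set Coord) (hΩ : IsOpen Ω) (hΩφ : Ω ⊆ φ.target)
    (hII : ∀ y ∈ Ω, IsTypeII (S.g φ y) (S.G φ y) (S.W φ y)) :
    -- the scalars are admissible and smooth Weyl principal frames exist locally
    (∀ y ∈ Ω, scalarA (S.g φ y) (S.W φ y) ≠ 0 ∧ rho (S.g φ y) (S.W φ y) ≠ 0 ∧
      ∃ V : Set Coord, IsOpen V ∧ y ∈ V ∧ V ⊆ Ω ∧ ∃ e : Coord → Fin 4 → Fin 4 → ℝ,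
        ContDiffOn ℝ ∞ e V ∧
          ∀ z ∈ V, IsWeylPrincipalFrame (S.g φ z) (S.η φ z) (S.W φ z) (e z)) ∧
    -- `Y`, `X`, `Z` are arbitrary auxiliary bivector fields, `s` and `t` are continuous branches
    -- of the square roots of `-𝓟²(Y,Y)` and `𝓠(X,X)`
    ∀ (Y X Z U Lp Lm : Coord → Tensor2) (s t : Coord → ℂ),
      DifferentiableOn ℝ Y Ω → DifferentiableOn ℝ X Ω → DifferentiableOn ℝ Z Ω →
      (∀ y ∈ Ω, IsBivector (Y y) ∧ IsBivector (X y) ∧ IsBivector (Z y)) →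
      (∀ y ∈ Ω, act (S.g φ y) (concP (S.g φ y) (S.G φ y) (S.W φ y)) (Y y) ≠ 0) →
      (∀ y ∈ Ω, act (S.g φ y) (concQ (S.g φ y) (S.G φ y) (S.W φ y)) (X y) ≠ 0) →
      ContinuousOn s Ω → ContinuousOn t Ω →
      (∀ y ∈ Ω, s y ^ 2 = -eval (S.g φ y)
        (comp (S.g φ y) (concP (S.g φ y) (S.G φ y) (S.W φ y))
          (concP (S.g φ y) (S.G φ y) (S.W φ y))) (Y y) (Y y)) →
      (∀ y ∈ Ω, t y ^ 2 = eval (S.g φ y) (concQ (S.g φ y) (S.G φ y) (S.W φ y)) (X y) (X y)) →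
      (∀ y ∈ Ω, U y = (1 / s y) • act (S.g φ y) (concP (S.g φ y) (S.G φ y) (S.W φ y)) (Y y)) →
      (∀ y ∈ Ω, Lp y = (1 / t y) • act (S.g φ y) (concQ (S.g φ y) (S.G φ y) (S.W φ y)) (X y)) →
      (∀ y ∈ Ω, eval (S.g φ y) (S.G φ y) (Lp y) (Z y) ≠ 0) →
      (∀ y ∈ Ω, Lm y = lMinus (S.g φ y) (S.G φ y) (U y) (Lp y) (Z y)) →
      -- the denominators do not vanish, and `Z = X` is an admissible choice
      (∀ y ∈ Ω, s y ≠ 0 ∧ t y ≠ 0 ∧ eval (S.g φ y) (S.G φ y) (Lp y) (X y) ≠ 0) ∧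
      -- for every Weyl principal frame field
      ∀ (V : Set Coord) (e : Coord → Fin 4 → Fin 4 → ℝ), IsOpen V → V ⊆ Ω →
        DifferentiableOn ℝ e V →
        (∀ y ∈ V, IsWeylPrincipalFrame (S.g φ y) (S.η φ y) (S.W φ y) (e y)) →
        ∀ y ∈ V,
          (U y = frameU (S.g φ y) (S.η φ y) (e y) 1 ∨
            U y = -frameU (S.g φ y) (S.η φ y) (e y) 1) ∧
          ((Lp y = frameLp (S.g φ y) (S.η φ y) (e y) ∧
              Lm y = frameLm (S.g φ y) (S.η φ y) (e y)) ∨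
            (Lp y = -frameLp (S.g φ y) (S.η φ y) (e y) ∧
              Lm y = -frameLm (S.g φ y) (S.η φ y) (e y))) ∧
          ∀ l α β : Fin 4, (connTensor (S.g φ) e l α β y : ℂ) =
            (1 / (Real.sqrt 2 : ℂ)) * (sdConn (S.g φ) U Lp Lm l α β y
              + (starRingEnd ℂ) (sdConn (S.g φ) U Lp Lm l α β y)) := by
  have hρ := fun y hy => S.scalarA_ne_zero_and_rho_ne_zero hφ (hΩφ hy) (hII y hy)
  have hg := (S.isMetricOn hφ).mono hΩ hΩφ
  refine ⟨fun y hy => ⟨(hρ y hy).1, (hρ y hy).2, S.exists_smooth_frame hφ hΩ hΩφ hII hy⟩, ?_⟩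
  intro Y X Z U Lp Lm s t hYd hXd hZd hbiv hP hQ hsc htc hs ht hU hLp hLZ hLm
  have hst : ∀ y ∈ Ω, s y ≠ 0 ∧ t y ≠ 0 ∧ eval (S.g φ y) (S.G φ y) (Lp y) (X y) ≠ 0 := by
    intro y hy
    obtain ⟨e, r, hr, -, hc⟩ := S.exists_canonical hφ (hΩφ hy) (hII y hy)
    obtain ⟨hs0, -⟩ := hc.recover_U hr (hP y hy) (hs y hy)
    obtain ⟨ht0, hX, d, hd, hLd⟩ := hc.recover_Lp hr (hQ y hy) (ht y hy)
    refine ⟨hs0, ht0, ?_⟩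
    rw [hLp y hy, hLd, eval_smul_left, hc.2.2.1, hc.2.1.eval_one_Lp hc.1]
    refine mul_ne_zero ?_ hX
    rcases hd with rfl | rfl <;> norm_num
  refine ⟨hst, ?_⟩
  intro V e hV hVΩ he hpf
  have hrec : ∀ z ∈ V, ∃ c d : ℂ, (c = 1 ∨ c = -1) ∧ (d = 1 ∨ d = -1) ∧
      U z = c • triad (S.g φ z) (S.η φ z) (e z) 0 ∧
      Lp z = d • triadLp (triad (S.g φ z) (S.η φ z) (e z)) ∧
      Lm z = d • triadLm (triad (S.g φ z) (S.η φ z) (e z)) := by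
    intro z hz
    obtain ⟨r, hc⟩ := (hpf z hz).isCanonical S.g_isSymm S.isVolumeSymbol
    -- The scalar of the given frame must equal the invariant `ρ`, which is nonzero by type II.
    have hr : r ≠ 0 := by rw [← hc.rho]; exact (hρ z (hVΩ hz)).2
    exact hc.recover hr (hP z (hVΩ hz)) (hQ z (hVΩ hz)) (hs z (hVΩ hz)) (ht z (hVΩ hz))
      (hU z (hVΩ hz)) (hLp z (hVΩ hz)) (hLZ z (hVΩ hz)) (hLm z (hVΩ hz))
  have hG := (S.G_smooth hφ).mono hΩφ
  have hW := (S.W_smooth hφ).mono hΩφ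
  -- Continuity is all that is needed here, to make the sign locally constant; differentiability
  -- near `y` then comes from the frame.
  have hUc : ContinuousOn U Ω := by
    have h1 := hg.act (n := 0) (by simp) ((hg.concP le_rfl hG hW fun z hz => (hρ z hz).1).of_le
      (by simp)) (contDiffOn_zero.2 hYd.continuousOn)
    exact ((continuousOn_const.div hsc fun z hz => (hst z hz).1).smul h1.continuousOn).congr hU
  have hLc : ContinuousOn Lp Ω := by
    have h1 := hg.act (n := 0) (by simp) ((hg.concQ le_rfl hG hW (fun z hz => (hρ z hz).1)
      fun z hz => (hρ z hz).2).of_le (by simp)) (contDiffOn_zero.2 hXd.continuousOn)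
    exact ((continuousOn_const.div htc fun z hz => (hst z hz).2.1).smul h1.continuousOn).congr hLp
  intro y hy
  refine ⟨?_, ?_, ?_⟩
  · obtain ⟨c, d, hc, hd, h1, h2, h3⟩ := hrec y hy
    rw [h1]
    rcases hc with rfl | rfl
    · exact Or.inl (one_smul ℂ _)
    · exact Or.inr (neg_one_smul ℂ _)
  · obtain ⟨c, d, hc, hd, h1, h2, h3⟩ := hrec y hy
    rw [h2, h3]
    rcases hd with rfl | rfl
    · exact Or.inl ⟨one_smul ℂ _, one_smul ℂ _⟩
    · exact Or.inr ⟨neg_one_smul ℂ _, neg_one_smul ℂ _⟩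
  · have hgV := hg.mono hV hVΩ
    have hey : DifferentiableAt ℝ e y := (he y hy).differentiableAt (hV.mem_nhds hy)
    have hΩy : Ω ∈ 𝓝 y := hΩ.mem_nhds (hVΩ hy)
    have hu := (hpf y hy).1.isTriad S.isVolumeSymbol
    have hVn : ∀ᶠ z in 𝓝 y, z ∈ V := hV.mem_nhds hy
    have t0 : ∀ z ∈ V, triad (S.g φ z) (S.η φ z) (e z) 0 =
        frameTensor (S.g φ z) (e z) (isq • triadCoeff 0) := fun z hz =>
      (hpf z hz).1.triad_eq S.isVolumeSymbol 0
    have tp : ∀ z ∈ V, triadLp (triad (S.g φ z) (S.η φ z) (e z)) =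
        frameTensor (S.g φ z) (e z) lpCoeff := fun z hz =>
      (hpf z hz).1.triadLp_frameTensor S.isVolumeSymbol
    have tm : ∀ z ∈ V, triadLm (triad (S.g φ z) (S.η φ z) (e z)) =
        frameTensor (S.g φ z) (e z) lmCoeff := fun z hz =>
      (hpf z hz).1.triadLm_frameTensor S.isVolumeSymbol
    obtain ⟨c, hc, hUe⟩ := eventuallyEq_smul_of_sign (hUc.continuousAt hΩy)
      (hgV.continuousAt_frameTensor hy hey (isq • triadCoeff 0))
      (fun h => by
        have := hu.dot_zero_zero
        rw [t0 y hy, h] at this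
        simp at this)
      (by
        filter_upwards [hVn] with z hz
        obtain ⟨c, d, hc, hd, h1, h2, h3⟩ := hrec z hz
        exact ⟨c, hc, by rw [h1, t0 z hz]⟩)
    obtain ⟨d, hd, hLe⟩ := eventuallyEq_smul_of_sign (hLc.continuousAt hΩy)
      (hgV.continuousAt_frameTensor hy hey lpCoeff)
      (fun h => hu.dot_Lm_ne_zero (by rw [tp y hy, h, map_zero, LinearMap.zero_apply]))
      (by
        filter_upwards [hVn] with z hz
        obtain ⟨c, d, hc, hd, h1, h2, h3⟩ := hrec z hz
        exact ⟨d, hd, by rw [h2, tp z hz]⟩)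
    -- At each point `𝓛₋` carries the sign of `𝓛₊`, and this sign is determined because `𝓛₊ ≠ 0`; so
    -- the locally constant sign `d` serves both.
    have hMe : Lm =ᶠ[𝓝 y] fun z => d • frameTensor (S.g φ z) (e z) lmCoeff := by
      filter_upwards [hVn, hLe] with z hz hLz
      obtain ⟨c, d', hc, hd, h1, h2, h3⟩ := hrec z hz
      have hne : triadLp (triad (S.g φ z) (S.η φ z) (e z)) ≠ 0 := fun h =>
        ((hpf z hz).1.isTriad S.isVolumeSymbol).dot_Lm_ne_zero
          (by rw [h, map_zero, LinearMap.zero_apply])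
      rw [← tp z hz, h2] at hLz
      rw [h3, tm z hz, smul_left_injective ℂ hne hLz]
    have hcc : c * c = 1 := by rcases hc with rfl | rfl <;> norm_num
    have hdd : d * d = 1 := by rcases hd with rfl | rfl <;> norm_num
    exact hgV.connTensor_eq_sdConn hy hey (fun z hz => (hpf z hz).1.orthonormal) hcc hdd
      (by simpa only [frameTensor_smul] using hUe) (by simpa only [frameTensor_smul] using hLe)
      (by simpa only [frameTensor_smul] using hMe)
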